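/- Throughout $p=3$ and $k=\mathbb{F}_3$. Let $P=\mathbb{F}_3[\xi_1,\xi_2,\dots]$ with $|\xi_n|=2(3^n-1)$ and $\Delta\xi_n=\sum_{i+j=n}\xi_i\otimes\xi_j^{3^i}$ (where $\xi_0=1$), and let $D=\mathbb{F}_3[\xi_1]/(\xi_1^3)$ with $\xi_1$ primitive. Let $\Gamma$ be a graded quotient Hopf algebra of $P$ through which the projection $P\to D$ ($\xi_1\mapsto\xi_1$, $\xi_n\mapsto 0$ for $n\ge 2$) factors, let $B_\Gamma=\Gamma\,\square_D\,k$, a left $\Gamma$-comodule, and let $\bar B_\Gamma=\operatorname{coker}(k\to B_\Gamma)$. Let $M$ be a non-negatively graded left $\Gamma$-comodule. Tensor products of comodules carry the diagonal coaction. $\operatorname{Ext}^{t,u}$ denotes the part of homological degree $t$ and internal degree $u$, and $b_{10}\in\operatorname{Ext}^{2,12}$ is the class of the cobar cocycle $[\xi_1|\xi_1^2]+[\xi_1^2|\xi_1]$, which acts on $\operatorname{Ext}_\Gamma(k,N)$ and $\operatorname{Ext}_D(k,N)$ for every comodule $N$. Put $N_s=\bar B_\Gamma^{\otimes s}\otimes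 M$. The long exact sequences in $\operatorname{Ext}_\Gamma(k,-)$ of the short exact sequences $0\to N_s\to B_\Gamma\otimes N_s\to N_{s+1}\to 0$ form an exact couple with $D_s=\operatorname{Ext}_\Gamma(k,N_s)$ and $E_1^{s}=\operatorname{Ext}_\Gamma(k,B_\Gamma\otimes N_s)$; its spectral sequence is the $B_\Gamma$-based Adams spectral sequence, with $d_r:E_r^{s,t,u}\to E_r^{s+r,t-r+1,u}$. The $b_{10}$-localized $K(\xi_1)$-based MPASS is the spectral sequence whose pages are the localizations $b_{10}^{-1}E_r$ (graded by $s\ge 0$ and $t,u\in\mathbb{Z}$), with the localized differentials. Then: 1. The map induced by $\Gamma\to D$ and the counit $B_\Gamma\to k$ is an isomorphism $b_{10}^{-1}E_1^{s,t,u}\cong b_{10}^{-1}\operatorname{Ext}_D^{t,u}(k,\bar B_\Gamma^{\otimes s}\otimes M)$ for all $s,t,u$. 2. $b_{10}^{-1}E_1^{s,t,u}=0$ if $u<12s+6t-2$. 3. The localized spectral sequence converges to $b_{10}^{-1}\operatorname{Ext}_\Gamma(k,M)$. That is, let $F^s$ be the image of $b_{10}^{-1}\operatorname{Ext}_\Gamma(k,N_s)\to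 b_{10}^{-1}\operatorname{Ext}_\Gamma(k,M)$ (the $s$-fold composite of connecting homomorphisms). Then $F^0$ is everything, and for all $n,u$ the part of $F^s$ of degree $(n,u)$ is zero for all sufficiently large $s$; for all $s,t,u$ the localized differential $d_r$ vanishes on $b_{10}^{-1}E_r^{s,t,u}$ for all sufficiently large $r$; and for every $s$ the map $b_{10}^{-1}\operatorname{Ext}_\Gamma(k,N_s)\to b_{10}^{-1}E_1^s$ induces a $k[b_{10}]$-linear isomorphism from $F^s/F^{s+1}$ to the page $E_\infty^s$ of the localized spectral sequence, under which the part of degree $(s+t,u)$ corresponds to $E_\infty^{s,t,u}$. -/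

import Mathlib

open scoped TensorProduct DirectSum Polynomial

noncomputable section

namespace LocExt

/-- The algebra `P = 𝔽₃[ξ₁, ξ₂, …]`; the variable `X n` is `ξ_{n+1}`. -/
def RedPow : Type := MvPolynomial ℕ (ZMod 3)

namespace RedPow

instance : CommRing RedPow := inferInstanceAs (CommRing (MvPolynomial ℕ (ZMod 3)))
instance : Algebra (ZMod 3) RedPow := inferInstanceAs (Algebra (ZMod 3) (MvPolynomial ℕ (ZMod 3)))

/-- The elements `ξ_n`, with `ξ₀ = 1`. -/
def xi : ℕ → RedPow
  | 0 => 1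
  | n + 1 => (MvPolynomial.X n : MvPolynomial ℕ (ZMod 3))

/-- The degree `|ξ_n| = 2 (3 ^ n - 1)` of the `n`-th variable `ξ_{n+1}`. -/
def wt (n : ℕ) : ℕ := 2 * (3 ^ (n + 1) - 1)

/-- The homogeneous part of internal degree `u`. -/
def homog (u : ℕ) : Submodule (ZMod 3) RedPow :=
  MvPolynomial.weightedHomogeneousSubmodule (ZMod 3) wt u

theorem algHom_ext {A : Type*} [CommRing A] [Algebra (ZMod 3) A] {f g : RedPow →ₐ[ZMod 3] A}
    (h : ∀ n, f (xi n) = g (xi n)) : f = g :=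
  MvPolynomial.algHom_ext (R := ZMod 3) (f := f) (g := g) fun n => h (n + 1)

/-- The algebra map out of `P` with prescribed values on `ξ₁, ξ₂, …`. -/
def lift {A : Type*} [CommRing A] [Algebra (ZMod 3) A] (f : ℕ → A) : RedPow →ₐ[ZMod 3] A :=
  MvPolynomial.aeval (R := ZMod 3) f

theorem lift_xi {A : Type*} [CommRing A] [Algebra (ZMod 3) A] (f : ℕ → A) (n : ℕ) :
    lift f (xi (n + 1)) = f n :=
  MvPolynomial.aeval_X (R := ZMod 3) f n

/-- The coproduct `Δ ξ_n = ∑_{i+j=n} ξ_i ⊗ ξ_j ^ (3 ^ i)`. -/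
def comulHom : RedPow →ₐ[ZMod 3] RedPow ⊗[ZMod 3] RedPow :=
  lift fun n => ∑ p ∈ Finset.HasAntidiagonal.antidiagonal (n + 1), xi p.1 ⊗ₜ[ZMod 3] (xi p.2 ^ 3 ^ p.1)

/-- The counit, `ξ_n ↦ 0` for `n ≥ 1`. -/
def counitHom : RedPow →ₐ[ZMod 3] ZMod 3 := lift fun _ => 0

theorem comulHom_xi (n : ℕ) :
    comulHom (xi n) = ∑ p ∈ Finset.HasAntidiagonal.antidiagonal n, xi p.1 ⊗ₜ[ZMod 3] (xi p.2 ^ 3 ^ p.1) := by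
  cases n with
  | zero => simp [xi, Algebra.TensorProduct.one_def]
  | succ n => exact lift_xi _ n

theorem counitHom_xi (n : ℕ) : counitHom (xi n) = if n = 0 then 1 else 0 := by
  cases n with
  | zero => simp [xi]
  | succ n =>
    rw [if_neg n.succ_ne_zero]
    exact lift_xi (fun _ => (0 : ZMod 3)) n

theorem frob {A : Type*} [CommRing A] [Algebra (ZMod 3) A] {ι : Type*} (s : Finset ι) (f : ι → A)
    (m : ℕ) : (∑ i ∈ s, f i) ^ 3 ^ m = ∑ i ∈ s, f i ^ 3 ^ m := by
  rcases subsingleton_or_nontrivial A with h | h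
  · exact Subsingleton.elim _ _
  · have : CharP A 3 := charP_of_injective_algebraMap (algebraMap (ZMod 3) A).injective 3
    exact sum_pow_char_pow 3 m s f

instance : Bialgebra (ZMod 3) RedPow :=
  Bialgebra.ofAlgHom comulHom counitHom
    (by
      apply algHom_ext
      intro n
      simp only [AlgHom.comp_apply, comulHom_xi, map_sum, Algebra.TensorProduct.map_tmul,
        map_pow, AlgHom.id_apply, frob, Algebra.TensorProduct.tmul_pow, TensorProduct.sum_tmul,
        TensorProduct.tmul_sum]
      rw [Finset.sum_sigma', Finset.sum_sigma']
      refine Finset.sum_nbij' (fun p => ⟨(p.2.1, p.2.2 + p.1.2), (p.2.2, p.1.2)⟩)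
        (fun p => ⟨(p.1.1 + p.2.1, p.2.2), (p.1.1, p.2.1)⟩) ?_ ?_ ?_ ?_ ?_
      · rintro ⟨⟨a, b⟩, ⟨c, d⟩⟩ h
        simp only [Finset.mem_sigma, Finset.HasAntidiagonal.mem_antidiagonal] at h ⊢
        refine ⟨?_, ?_⟩ <;> first | trivial | omega
      · rintro ⟨⟨a, b⟩, ⟨c, d⟩⟩ h
        simp only [Finset.mem_sigma, Finset.HasAntidiagonal.mem_antidiagonal] at h ⊢
        refine ⟨?_, ?_⟩ <;> first | trivial | omega
      · rintro ⟨⟨a, b⟩, ⟨c, d⟩⟩ h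
        simp only [Finset.mem_sigma, Finset.HasAntidiagonal.mem_antidiagonal] at h
        obtain ⟨h1, rfl⟩ := h
        rfl
      · rintro ⟨⟨a, b⟩, ⟨c, d⟩⟩ h
        simp only [Finset.mem_sigma, Finset.HasAntidiagonal.mem_antidiagonal] at h
        obtain ⟨h1, rfl⟩ := h
        rfl
      · rintro ⟨⟨a, b⟩, ⟨c, d⟩⟩ h
        simp only [Finset.mem_sigma, Finset.HasAntidiagonal.mem_antidiagonal] at h
        obtain ⟨h1, rfl⟩ := h
        change xi c ⊗ₜ[ZMod 3] ((xi d ^ 3 ^ c) ⊗ₜ[ZMod 3] (xi b ^ 3 ^ (c + d))) = _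
        simp only [← pow_mul, ← pow_add]
        rw [add_comm d c])
    (by
      apply algHom_ext
      intro n
      simp only [AlgHom.comp_apply, comulHom_xi, map_sum, Algebra.TensorProduct.map_tmul,
        counitHom_xi, AlgHom.id_apply]
      rw [Finset.sum_eq_single (0, n)]
      · simp
      · rintro ⟨a, b⟩ hab hne
        have : a ≠ 0 := by
          rintro rfl
          simp at hab
          exact hne (by simp [hab])
        simp [this]
      · simp)
    (by
      apply algHom_ext
      intro n
      simp only [AlgHom.comp_apply, comulHom_xi, map_sum, Algebra.TensorProduct.map_tmul,
        map_pow, counitHom_xi, AlgHom.id_apply]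
      rw [Finset.sum_eq_single (n, 0)]
      · simp
      · rintro ⟨a, b⟩ hab hne
        have : b ≠ 0 := by
          rintro rfl
          simp at hab
          exact hne (by simp [hab])
        simp [this]
      · simp)

end RedPow

/-- `D = 𝔽₃[x] / (x³)`, with `x` the class of `ξ₁`. -/
def TruncD : Type := AdjoinRoot ((Polynomial.X : (ZMod 3)[X]) ^ 3)

namespace TruncD

instance : CommRing TruncD := inferInstanceAs (CommRing (AdjoinRoot _))
instance : Algebra (ZMod 3) TruncD :=
  inferInstanceAs (Algebra (ZMod 3) (AdjoinRoot ((Polynomial.X : (ZMod 3)[X]) ^ 3)))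

/-- The generator of `D`. -/
def x : TruncD := AdjoinRoot.root ((Polynomial.X : (ZMod 3)[X]) ^ 3)

theorem x_pow : x ^ 3 = 0 := by
  have := AdjoinRoot.eval₂_root ((Polynomial.X : (ZMod 3)[X]) ^ 3)
  rw [Polynomial.eval₂_pow, Polynomial.eval₂_X] at this
  exact this

theorem algHom_ext {A : Type*} [CommRing A] [Algebra (ZMod 3) A] {f g : TruncD →ₐ[ZMod 3] A}
    (h : f x = g x) : f = g :=
  AdjoinRoot.algHom_ext (f := ((Polynomial.X : (ZMod 3)[X]) ^ 3)) h

/-- The algebra map out of `D` sending `x` to an element of cube zero. -/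
def lift {A : Type*} [CommRing A] [Algebra (ZMod 3) A] (a : A) (ha : a ^ 3 = 0) :
    TruncD →ₐ[ZMod 3] A :=
  AdjoinRoot.liftAlgHom ((Polynomial.X : (ZMod 3)[X]) ^ 3) (Algebra.ofId (ZMod 3) A) a (by simpa)

theorem lift_x {A : Type*} [CommRing A] [Algebra (ZMod 3) A] (a : A) (ha : a ^ 3 = 0) :
    lift a ha x = a :=
  AdjoinRoot.liftAlgHom_root _ _ _ _

theorem comul_cube : (x ⊗ₜ[ZMod 3] (1 : TruncD) + (1 : TruncD) ⊗ₜ[ZMod 3] x) ^ 3 = 0 := by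
  have := RedPow.frob (A := TruncD ⊗[ZMod 3] TruncD) Finset.univ
    ![x ⊗ₜ[ZMod 3] 1, 1 ⊗ₜ[ZMod 3] x] 1
  simpa [Fin.sum_univ_two, Algebra.TensorProduct.tmul_pow, x_pow] using this

/-- The coproduct of `D`, for which `x` is primitive. -/
def comulHom : TruncD →ₐ[ZMod 3] TruncD ⊗[ZMod 3] TruncD := lift _ comul_cube

/-- The counit of `D`. -/
def counitHom : TruncD →ₐ[ZMod 3] ZMod 3 := lift 0 (by simp)

instance : Bialgebra (ZMod 3) TruncD :=
  Bialgebra.ofAlgHom comulHom counitHom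
    (by
      apply algHom_ext
      simp [comulHom, lift_x, TensorProduct.add_tmul, TensorProduct.tmul_add,
        Algebra.TensorProduct.one_def, add_assoc])
    (by
      apply algHom_ext
      simp [comulHom, counitHom, lift_x])
    (by
      apply algHom_ext
      simp [comulHom, counitHom, lift_x])

theorem comul_x : Coalgebra.comul (R := ZMod 3) x = x ⊗ₜ[ZMod 3] 1 + 1 ⊗ₜ[ZMod 3] x :=
  lift_x _ comul_cube

end TruncD

section Comodules

universe v

/-- A left comodule over a commutative bialgebra `Γ` over the field `k`. -/
structure Comod (k Γ : Type) [Field k] [CommRing Γ] [Bialgebra k Γ] where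
  /-- the underlying vector space -/
  carrier : Type v
  [addCommGroup : AddCommGroup carrier]
  [module : Module k carrier]
  /-- the coaction -/
  coact : carrier →ₗ[k] Γ ⊗[k] carrier
  coassoc : ∀ m, TensorProduct.assoc k Γ Γ carrier
    ((Coalgebra.comul (R := k) (A := Γ)).rTensor carrier (coact m)) = coact.lTensor Γ (coact m)
  counit : ∀ m, TensorProduct.lid k carrier
    ((Coalgebra.counit (R := k) (A := Γ)).rTensor carrier (coact m)) = m

attribute [instance] Comod.addCommGroup Comod.module

variable {k Γ D : Type} [Field k] [CommRing Γ] [Bialgebra k Γ] [CommRing D] [Bialgebra k D]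

/-- A map from a `Γ`-comodule `N` to a `D`-comodule `N'` which is compatible with the coactions
along a map of bialgebras `φ : Γ → D`. -/
structure Comod.Hom (φ : Γ →ₐc[k] D) (N : Comod.{v} k Γ) (N' : Comod.{v} k D) where
  /-- the underlying linear map -/
  lin : N.carrier →ₗ[k] N'.carrier
  comm : ∀ m, TensorProduct.map (φ : Γ →ₗ[k] D) lin (N.coact m) = N'.coact (lin m)

/-- `(a ⊗ x) ⊗ (b ⊗ n) ↦ a b ⊗ (x ⊗ n)`. -/
def diagMul (k Γ : Type) [Field k] [CommRing Γ] [Bialgebra k Γ] (X N : Type*) [AddCommGroup X]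
    [Module k X] [AddCommGroup N] [Module k N] :
    (Γ ⊗[k] X) ⊗[k] (Γ ⊗[k] N) →ₗ[k] Γ ⊗[k] (X ⊗[k] N) :=
  (LinearMap.mul' k Γ).rTensor (X ⊗[k] N) ∘ₗ
    (TensorProduct.tensorTensorTensorComm k Γ X Γ N).toLinearMap

theorem diagMul_tmul {X N : Type*} [AddCommGroup X]
    [Module k X] [AddCommGroup N] [Module k N] (a b : Γ) (x : X) (n : N) :
    diagMul k Γ X N ((a ⊗ₜ x) ⊗ₜ (b ⊗ₜ n)) = (a * b) ⊗ₜ (x ⊗ₜ n) := by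
  simp [diagMul]

theorem diagMul_comul {X N : Type*} [AddCommGroup X]
    [Module k X] [AddCommGroup N] [Module k N] (u : Γ ⊗[k] X) (v : Γ ⊗[k] N) :
    TensorProduct.assoc k Γ Γ (X ⊗[k] N)
      ((Coalgebra.comul (R := k) (A := Γ)).rTensor _ (diagMul k Γ X N (u ⊗ₜ v))) =
    (diagMul k Γ X N).lTensor Γ (diagMul k Γ (Γ ⊗[k] X) (Γ ⊗[k] N)
      (TensorProduct.assoc k Γ Γ X ((Coalgebra.comul (R := k) (A := Γ)).rTensor _ u) ⊗ₜ
        TensorProduct.assoc k Γ Γ N ((Coalgebra.comul (R := k) (A := Γ)).rTensor _ v))) := by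
  have key : ∀ (p q : Γ ⊗[k] Γ) (x : X) (n : N),
      TensorProduct.assoc k Γ Γ (X ⊗[k] N) ((p * q) ⊗ₜ (x ⊗ₜ n)) =
      (diagMul k Γ X N).lTensor Γ (diagMul k Γ (Γ ⊗[k] X) (Γ ⊗[k] N)
        (TensorProduct.assoc k Γ Γ X (p ⊗ₜ x) ⊗ₜ TensorProduct.assoc k Γ Γ N (q ⊗ₜ n))) := by
    intro p q x n
    induction p with
    | zero => simp
    | add p p' hp hp' =>
      simp only [add_mul, TensorProduct.add_tmul, map_add, hp, hp']
    | tmul a a' =>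
      induction q with
      | zero => simp
      | add p p' hp hp' =>
        simp only [mul_add, TensorProduct.add_tmul, TensorProduct.tmul_add, map_add, hp, hp']
      | tmul b b' => simp [diagMul_tmul]
  induction u with
  | zero => simp
  | add u u' hu hu' => simp only [TensorProduct.add_tmul, map_add, hu, hu']
  | tmul a x =>
    induction v with
    | zero => simp
    | add u u' hu hu' => simp only [TensorProduct.tmul_add, map_add, hu, hu']
    | tmul b n =>
      rw [diagMul_tmul, LinearMap.rTensor_tmul, LinearMap.rTensor_tmul, LinearMap.rTensor_tmul,
        Bialgebra.comul_mul, key]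

theorem diagMul_counit {X N : Type*} [AddCommGroup X]
    [Module k X] [AddCommGroup N] [Module k N] (u : Γ ⊗[k] X) (v : Γ ⊗[k] N) :
    TensorProduct.lid k (X ⊗[k] N)
      ((Coalgebra.counit (R := k) (A := Γ)).rTensor _ (diagMul k Γ X N (u ⊗ₜ v))) =
    TensorProduct.lid k X ((Coalgebra.counit (R := k) (A := Γ)).rTensor _ u) ⊗ₜ
      TensorProduct.lid k N ((Coalgebra.counit (R := k) (A := Γ)).rTensor _ v) := by
  induction u with
  | zero => simp
  | add u u' hu hu' => simp only [TensorProduct.add_tmul, map_add, hu, hu']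
  | tmul a x =>
    induction v with
    | zero => simp
    | add u u' hu hu' => simp only [TensorProduct.tmul_add, map_add, hu, hu']
    | tmul b n => simp [diagMul_tmul, TensorProduct.smul_tmul', TensorProduct.tmul_smul, smul_smul, mul_comm]

/-- The tensor product of two comodules with the diagonal coaction
`x ⊗ n ↦ ∑ x' n' ⊗ (x'' ⊗ n'')`. -/
def Comod.tensor (X : Comod.{0} k Γ) (N : Comod.{v} k Γ) : Comod.{v} k Γ where
  carrier := X.carrier ⊗[k] N.carrier
  coact := diagMul k Γ X.carrier N.carrier ∘ₗ TensorProduct.map X.coact N.coact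
  coassoc m := by
    have key : ∀ (u : Γ ⊗[k] X.carrier) (v : Γ ⊗[k] N.carrier),
        (diagMul k Γ X.carrier N.carrier ∘ₗ TensorProduct.map X.coact N.coact).lTensor Γ
          (diagMul k Γ X.carrier N.carrier (u ⊗ₜ v)) =
        (diagMul k Γ X.carrier N.carrier).lTensor Γ (diagMul k Γ _ _
          (X.coact.lTensor Γ u ⊗ₜ N.coact.lTensor Γ v)) := by
      intro u v
      induction u with
      | zero => simp
      | add u u' hu hu' => simp only [TensorProduct.add_tmul, map_add, hu, hu']
      | tmul a x =>
        induction v with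
        | zero => simp
        | add u u' hu hu' => simp only [TensorProduct.tmul_add, map_add, hu, hu']
        | tmul b n => simp [diagMul_tmul]
    induction m with
    | zero => simp
    | add u u' hu hu' => simp only [map_add, hu, hu']
    | tmul x n =>
      simp only [LinearMap.comp_apply, TensorProduct.map_tmul]
      rw [diagMul_comul, X.coassoc, N.coassoc]
      exact (key _ _).symm
  counit m := by
    induction m with
    | zero => simp
    | add u u' hu hu' => simp only [map_add, hu, hu']
    | tmul x n =>
      simp only [LinearMap.comp_apply, TensorProduct.map_tmul]
      rw [diagMul_counit, X.counit, N.counit]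

/-- The comodule over `D` obtained from a `Γ`-comodule by corestriction along `q : Γ → D`. -/
def Comod.corestrict (q : Γ →ₐc[k] D) (N : Comod.{v} k Γ) : Comod.{v} k D where
  carrier := N.carrier
  coact := (q : Γ →ₗ[k] D).rTensor N.carrier ∘ₗ N.coact
  coassoc m := by
    have h1 : ∀ z : Γ ⊗[k] N.carrier, TensorProduct.assoc k D D N.carrier
        ((Coalgebra.comul (R := k) (A := D)).rTensor _ ((q : Γ →ₗ[k] D).rTensor _ z)) =
        TensorProduct.map (q : Γ →ₗ[k] D) ((q : Γ →ₗ[k] D).rTensor N.carrier)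
          (TensorProduct.assoc k Γ Γ N.carrier
            ((Coalgebra.comul (R := k) (A := Γ)).rTensor _ z)) := by
      intro z
      induction z with
      | zero => simp
      | add u u' hu hu' => simp only [map_add, hu, hu']
      | tmul a n =>
        have h2 : ∀ w : Γ ⊗[k] Γ, TensorProduct.assoc k D D N.carrier
            ((TensorProduct.map (q : Γ →ₗ[k] D) (q : Γ →ₗ[k] D) w) ⊗ₜ n) =
            TensorProduct.map (q : Γ →ₗ[k] D) ((q : Γ →ₗ[k] D).rTensor N.carrier)
              (TensorProduct.assoc k Γ Γ N.carrier (w ⊗ₜ n)) := by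
          intro w
          induction w with
          | zero => simp
          | add u u' hu hu' => simp only [map_add, TensorProduct.add_tmul, hu, hu']
          | tmul a b => simp
        rw [LinearMap.rTensor_tmul, LinearMap.rTensor_tmul, LinearMap.rTensor_tmul, ← h2]
        congr 2
        exact (CoalgHomClass.map_comp_comul_apply q a).symm
    have h3 : ∀ z : Γ ⊗[k] N.carrier,
        ((q : Γ →ₗ[k] D).rTensor N.carrier ∘ₗ N.coact).lTensor D
          ((q : Γ →ₗ[k] D).rTensor N.carrier z) =
        TensorProduct.map (q : Γ →ₗ[k] D) ((q : Γ →ₗ[k] D).rTensor N.carrier)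
          (N.coact.lTensor Γ z) := by
      intro z
      induction z with
      | zero => simp
      | add u u' hu hu' => simp only [map_add, hu, hu']
      | tmul a n => simp
    simp only [LinearMap.comp_apply]
    rw [h1, N.coassoc]
    exact (h3 _).symm
  counit m := by
    have h1 : ∀ z : Γ ⊗[k] N.carrier, TensorProduct.lid k N.carrier
        ((Coalgebra.counit (R := k) (A := D)).rTensor _ ((q : Γ →ₗ[k] D).rTensor _ z)) =
        TensorProduct.lid k N.carrier ((Coalgebra.counit (R := k) (A := Γ)).rTensor _ z) := by
      intro z
      induction z with
      | zero => simp
      | add u u' hu hu' => simp only [map_add, hu, hu']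
      | tmul a n => simp
    simp only [LinearMap.comp_apply]
    rw [h1, N.counit]

/-! ### The comodules `B = Γ □_D k` and its coaugmentation coideal -/

/-- `B = Γ □_D k`, the elements `b` of `Γ` with `∑ b' ⊗ q(b'') = b ⊗ 1`. -/
def cotensor (q : Γ →ₐc[k] D) : Submodule k Γ :=
  LinearMap.ker ((q : Γ →ₗ[k] D).lTensor Γ ∘ₗ Coalgebra.comul (R := k) (A := Γ) -
    (TensorProduct.mk k Γ D).flip 1)

theorem mem_cotensor (q : Γ →ₐc[k] D) (b : Γ) : b ∈ cotensor q ↔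
    (q : Γ →ₗ[k] D).lTensor Γ (Coalgebra.comul (R := k) b) = b ⊗ₜ[k] (1 : D) := by
  simp [cotensor, sub_eq_zero]

theorem one_mem_cotensor (q : Γ →ₐc[k] D) : (1 : Γ) ∈ cotensor q := by
  rw [mem_cotensor, Bialgebra.comul_one, Algebra.TensorProduct.one_def, LinearMap.lTensor_tmul]
  congr 1
  exact map_one q

theorem comul_mem_cotensor (q : Γ →ₐc[k] D) (b : cotensor q) :
    Coalgebra.comul (R := k) (b : Γ) ∈
      LinearMap.range ((cotensor q).subtype.lTensor Γ) := by
  have hex := Module.Flat.lTensor_exact (R := k) Γ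
    (f := (cotensor q).subtype) (g := (q : Γ →ₗ[k] D).lTensor Γ ∘ₗ
      Coalgebra.comul (R := k) (A := Γ) - (TensorProduct.mk k Γ D).flip 1)
    (LinearMap.exact_subtype_ker_map _)
  refine (hex _).1 ?_
  have h1 : ∀ z : Γ ⊗[k] Γ, (((q : Γ →ₗ[k] D).lTensor Γ ∘ₗ
      Coalgebra.comul (R := k) (A := Γ)).lTensor Γ) z =
      ((q : Γ →ₗ[k] D).lTensor Γ).lTensor Γ ((Coalgebra.comul (R := k) (A := Γ)).lTensor Γ z) := by
    intro z; rw [LinearMap.lTensor_comp]; rfl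
  have h2 : ∀ z : (Γ ⊗[k] Γ) ⊗[k] Γ, ((q : Γ →ₗ[k] D).lTensor Γ).lTensor Γ
      (TensorProduct.assoc k Γ Γ Γ z) =
      TensorProduct.assoc k Γ Γ D ((q : Γ →ₗ[k] D).lTensor _ z) := by
    intro z
    induction z with
    | zero => simp
    | add u u' hu hu' => simp only [map_add, hu, hu']
    | tmul w c =>
      induction w with
      | zero => simp
      | add u u' hu hu' => simp only [map_add, TensorProduct.add_tmul, hu, hu']
      | tmul a b => simp
  have h3 : ∀ z : Γ ⊗[k] Γ, ((TensorProduct.mk k Γ D).flip 1).lTensor Γ z =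
      TensorProduct.assoc k Γ Γ D (z ⊗ₜ 1) := by
    intro z
    induction z with
    | zero => simp
    | add u u' hu hu' => simp only [map_add, TensorProduct.add_tmul, hu, hu']
    | tmul a b => simp
  have h4 : (q : Γ →ₗ[k] D).lTensor (Γ ⊗[k] Γ) ((Coalgebra.comul (R := k) (A := Γ)).rTensor Γ
      (Coalgebra.comul (R := k) (b : Γ))) = (Coalgebra.comul (R := k) (b : Γ)) ⊗ₜ 1 := by
    have h6 : ∀ z : Γ ⊗[k] Γ, (q : Γ →ₗ[k] D).lTensor (Γ ⊗[k] Γ)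
        ((Coalgebra.comul (R := k) (A := Γ)).rTensor Γ z) =
        (Coalgebra.comul (R := k) (A := Γ)).rTensor D ((q : Γ →ₗ[k] D).lTensor Γ z) := by
      intro z
      induction z with
      | zero => simp
      | add u u' hu hu' => simp only [map_add, hu, hu']
      | tmul a b => simp
    rw [h6, (mem_cotensor q b).1 b.2, LinearMap.rTensor_tmul]
  rw [LinearMap.lTensor_sub, LinearMap.sub_apply, h1, ← Coalgebra.coassoc_apply, h2, h3, h4,
    sub_self]

theorem cotensor_injective (q : Γ →ₐc[k] D) :
    Function.Injective ((cotensor q).subtype.lTensor Γ) :=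
  Module.Flat.lTensor_preserves_injective_linearMap _ (cotensor q).injective_subtype

/-- The left coaction on `B`, the restriction of the coproduct of `Γ`. -/
def cotensorCoact (q : Γ →ₐc[k] D) : cotensor q →ₗ[k] Γ ⊗[k] cotensor q :=
  (LinearEquiv.ofInjective _ (cotensor_injective q)).symm.toLinearMap ∘ₗ
    LinearMap.codRestrict _ (Coalgebra.comul (R := k) (A := Γ) ∘ₗ (cotensor q).subtype)
      (comul_mem_cotensor q)

theorem cotensorCoact_spec (q : Γ →ₐc[k] D) (b : cotensor q) :
    (cotensor q).subtype.lTensor Γ (cotensorCoact q b) = Coalgebra.comul (R := k) (b : Γ) := by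
  have := LinearEquiv.ofInjective_symm_apply (f := (cotensor q).subtype.lTensor Γ)
    (h := cotensor_injective q)
    (LinearMap.codRestrict _ (Coalgebra.comul (R := k) (A := Γ) ∘ₗ (cotensor q).subtype)
      (comul_mem_cotensor q) b)
  exact this

/-- `B = Γ □_D k` as a left `Γ`-comodule. -/
def comodB (q : Γ →ₐc[k] D) : Comod.{0} k Γ where
  carrier := cotensor q
  coact := cotensorCoact q
  coassoc b := by
    have hinj : Function.Injective (((cotensor q).subtype.lTensor Γ).lTensor Γ) :=
      Module.Flat.lTensor_preserves_injective_linearMap _ (cotensor_injective q)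
    apply hinj
    have h2 : ∀ z : (Γ ⊗[k] Γ) ⊗[k] (cotensor q), ((cotensor q).subtype.lTensor Γ).lTensor Γ
        (TensorProduct.assoc k Γ Γ _ z) =
        TensorProduct.assoc k Γ Γ Γ ((cotensor q).subtype.lTensor _ z) := by
      intro z
      induction z with
      | zero => simp
      | add u u' hu hu' => simp only [map_add, hu, hu']
      | tmul w c =>
        induction w with
        | zero => simp
        | add u u' hu hu' => simp only [map_add, TensorProduct.add_tmul, hu, hu']
        | tmul a b => simp
    have h3 : (cotensor q).subtype.lTensor Γ ∘ₗ cotensorCoact q =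
        Coalgebra.comul (R := k) (A := Γ) ∘ₗ (cotensor q).subtype :=
      LinearMap.ext (cotensorCoact_spec q)
    have h4 : ∀ z : Γ ⊗[k] cotensor q, (cotensor q).subtype.lTensor (Γ ⊗[k] Γ)
        ((Coalgebra.comul (R := k) (A := Γ)).rTensor _ z) =
        (Coalgebra.comul (R := k) (A := Γ)).rTensor _ ((cotensor q).subtype.lTensor Γ z) := by
      intro z
      induction z with
      | zero => simp
      | add u u' hu hu' => simp only [map_add, hu, hu']
      | tmul a b => simp
    rw [h2, h4, cotensorCoact_spec, Coalgebra.coassoc_apply, ← LinearMap.lTensor_comp_apply, h3,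
      LinearMap.lTensor_comp_apply, cotensorCoact_spec]
  counit b := by
    apply (cotensor q).injective_subtype
    have h1 : ∀ z : Γ ⊗[k] cotensor q, (cotensor q).subtype (TensorProduct.lid k _
        ((Coalgebra.counit (R := k) (A := Γ)).rTensor _ z)) =
        TensorProduct.lid k Γ ((Coalgebra.counit (R := k) (A := Γ)).rTensor _
          ((cotensor q).subtype.lTensor Γ z)) := by
      intro z
      induction z with
      | zero => simp
      | add u u' hu hu' => simp only [map_add, hu, hu']
      | tmul a n => simp
    rw [h1, cotensorCoact_spec, Coalgebra.rTensor_counit_comul]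
    simp

theorem cotensorCoact_one (q : Γ →ₐc[k] D) :
    cotensorCoact q ⟨1, one_mem_cotensor q⟩ = 1 ⊗ₜ ⟨1, one_mem_cotensor q⟩ := by
  apply cotensor_injective q
  rw [cotensorCoact_spec, LinearMap.lTensor_tmul]
  exact Bialgebra.comul_one

/-- The line `k · 1` in `B`. -/
def unitLine (q : Γ →ₐc[k] D) : Submodule k (cotensor q) :=
  Submodule.span k {⟨1, one_mem_cotensor q⟩}

/-- The coaction on `B / k`. -/
def barCoact (q : Γ →ₐc[k] D) :
    (cotensor q ⧸ unitLine q) →ₗ[k] Γ ⊗[k] (cotensor q ⧸ unitLine q) :=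
  (unitLine q).liftQ ((unitLine q).mkQ.lTensor Γ ∘ₗ cotensorCoact q)
    (Submodule.span_le.2 (by
      rintro _ rfl
      have : (unitLine q).mkQ ⟨1, one_mem_cotensor q⟩ = 0 := by
        rw [Submodule.mkQ_apply, Submodule.Quotient.mk_eq_zero]
        exact Submodule.mem_span_singleton_self _
      change (unitLine q).mkQ.lTensor Γ (cotensorCoact q ⟨1, one_mem_cotensor q⟩) = 0
      rw [cotensorCoact_one, LinearMap.lTensor_tmul, this, TensorProduct.tmul_zero]))

theorem barCoact_mk (q : Γ →ₐc[k] D) (b : cotensor q) :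
    barCoact q ((unitLine q).mkQ b) = (unitLine q).mkQ.lTensor Γ (cotensorCoact q b) := rfl

/-- The coaugmentation coideal `coker (k → B)` as a left `Γ`-comodule. -/
def comodBbar (q : Γ →ₐc[k] D) : Comod.{0} k Γ where
  carrier := cotensor q ⧸ unitLine q
  coact := barCoact q
  coassoc b := by
    obtain ⟨b, rfl⟩ := (unitLine q).mkQ_surjective b
    have h2 : ∀ z : (Γ ⊗[k] Γ) ⊗[k] (cotensor q), ((unitLine q).mkQ.lTensor Γ).lTensor Γ
        (TensorProduct.assoc k Γ Γ _ z) =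
        TensorProduct.assoc k Γ Γ _ ((unitLine q).mkQ.lTensor _ z) := by
      intro z
      induction z with
      | zero => simp
      | add u u' hu hu' => simp only [map_add, hu, hu']
      | tmul w c =>
        induction w with
        | zero => simp
        | add u u' hu hu' => simp only [map_add, TensorProduct.add_tmul, hu, hu']
        | tmul a b => simp
    have h3 : (unitLine q).mkQ.lTensor Γ ∘ₗ cotensorCoact q = barCoact q ∘ₗ (unitLine q).mkQ :=
      rfl
    have h4 : ∀ z : Γ ⊗[k] cotensor q, (unitLine q).mkQ.lTensor (Γ ⊗[k] Γ)
        ((Coalgebra.comul (R := k) (A := Γ)).rTensor _ z) =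
        (Coalgebra.comul (R := k) (A := Γ)).rTensor _ ((unitLine q).mkQ.lTensor Γ z) := by
      intro z
      induction z with
      | zero => simp
      | add u u' hu hu' => simp only [map_add, hu, hu']
      | tmul a b => simp
    have h5 : TensorProduct.assoc k Γ Γ (cotensor q)
        ((Coalgebra.comul (R := k) (A := Γ)).rTensor _ (cotensorCoact q b)) =
        (cotensorCoact q).lTensor Γ (cotensorCoact q b) := (comodB q).coassoc b
    rw [barCoact_mk, ← h4, ← h2, h5, ← LinearMap.lTensor_comp_apply, h3,
      LinearMap.lTensor_comp_apply]
  counit b := by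
    obtain ⟨b, rfl⟩ := (unitLine q).mkQ_surjective b
    have h1 : ∀ z : Γ ⊗[k] cotensor q, TensorProduct.lid k _
        ((Coalgebra.counit (R := k) (A := Γ)).rTensor _ ((unitLine q).mkQ.lTensor Γ z)) =
        (unitLine q).mkQ (TensorProduct.lid k _
          ((Coalgebra.counit (R := k) (A := Γ)).rTensor _ z)) := by
      intro z
      induction z with
      | zero => simp
      | add u u' hu hu' => simp only [map_add, hu, hu']
      | tmul a n => simp
    rw [barCoact_mk, h1]
    exact congrArg _ ((comodB q).counit b)

end Comodules

section CobarComplex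

universe v

variable {k Γ D : Type} [Field k] [CommRing Γ] [Bialgebra k Γ] [CommRing D] [Bialgebra k D]

/-- For `del : V → Γ ⊗ V`, the map
`[a] x ↦ ∑ [a'|a''] x - [a] del x` from `Γ ⊗ V` to `Γ ⊗ (Γ ⊗ V)`. -/
def nextDel {V : Type v} [AddCommGroup V] [Module k V] (del : V →ₗ[k] Γ ⊗[k] V) :
    Γ ⊗[k] V →ₗ[k] Γ ⊗[k] (Γ ⊗[k] V) :=
  (TensorProduct.assoc k Γ Γ V).toLinearMap ∘ₗ (Coalgebra.comul (R := k) (A := Γ)).rTensor V -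
    del.lTensor Γ

theorem nextDel_tmul {V : Type v} [AddCommGroup V] [Module k V] (del : V →ₗ[k] Γ ⊗[k] V)
    (a : Γ) (x : V) : nextDel del (a ⊗ₜ x) =
      TensorProduct.assoc k Γ Γ V (Coalgebra.comul (R := k) a ⊗ₜ x) - a ⊗ₜ del x := by
  simp [nextDel]

theorem nextDel_nextDel {V : Type v} [AddCommGroup V] [Module k V] (del : V →ₗ[k] Γ ⊗[k] V)
    (h : ∀ x, nextDel del (del x) = 0) (z : Γ ⊗[k] V) :
    nextDel (nextDel del) (nextDel del z) = 0 := by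
  induction z with
  | zero => simp
  | add u u' hu hu' => simp only [map_add, hu, hu', add_zero]
  | tmul a x =>
    have h2 : ∀ w : Γ ⊗[k] Γ, nextDel (nextDel del) (TensorProduct.assoc k Γ Γ V (w ⊗ₜ x)) =
        TensorProduct.assoc k Γ Γ (Γ ⊗[k] V) (TensorProduct.assoc k (Γ ⊗[k] Γ) Γ V
          (((Coalgebra.comul (R := k) (A := Γ)).rTensor Γ w) ⊗ₜ x)) -
        (TensorProduct.assoc k Γ Γ V).toLinearMap.lTensor Γ
          (TensorProduct.assoc k Γ (Γ ⊗[k] Γ) V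
            (((Coalgebra.comul (R := k) (A := Γ)).lTensor Γ w) ⊗ₜ x)) +
        TensorProduct.assoc k Γ Γ (Γ ⊗[k] V) (w ⊗ₜ del x) := by
      intro w
      induction w with
      | zero => simp
      | add u u' hu hu' =>
        simp only [TensorProduct.add_tmul, map_add, hu, hu']
        abel
      | tmul b c =>
        simp only [TensorProduct.assoc_tmul, nextDel_tmul, LinearMap.rTensor_tmul,
          LinearMap.lTensor_tmul, TensorProduct.tmul_sub, LinearEquiv.coe_coe]
        abel
    have h3 : ∀ w : (Γ ⊗[k] Γ) ⊗[k] Γ,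
        TensorProduct.assoc k Γ Γ (Γ ⊗[k] V) (TensorProduct.assoc k (Γ ⊗[k] Γ) Γ V (w ⊗ₜ x)) =
        (TensorProduct.assoc k Γ Γ V).toLinearMap.lTensor Γ
          (TensorProduct.assoc k Γ (Γ ⊗[k] Γ) V (TensorProduct.assoc k Γ Γ Γ w ⊗ₜ x)) := by
      intro w
      induction w with
      | zero => simp
      | add u u' hu hu' => simp only [TensorProduct.add_tmul, map_add, hu, hu']
      | tmul b c =>
        induction b with
        | zero => simp
        | add u u' hu hu' => simp only [TensorProduct.add_tmul, map_add, hu, hu']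
        | tmul b b' => simp
    have h4 : nextDel (nextDel del) (a ⊗ₜ del x) =
        TensorProduct.assoc k Γ Γ (Γ ⊗[k] V) (Coalgebra.comul (R := k) a ⊗ₜ del x) := by
      rw [nextDel_tmul, h, TensorProduct.tmul_zero, sub_zero]
    rw [nextDel_tmul, map_sub, h2, h4, h3, Coalgebra.coassoc_apply]
    abel

theorem map_nextDel {V W : Type v} [AddCommGroup V] [Module k V] [AddCommGroup W] [Module k W]
    (φ : Γ →ₐc[k] D) (del : V →ₗ[k] Γ ⊗[k] V) (del' : W →ₗ[k] D ⊗[k] W) (f : V →ₗ[k] W)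
    (h : ∀ x, TensorProduct.map (φ : Γ →ₗ[k] D) f (del x) = del' (f x)) (z : Γ ⊗[k] V) :
    TensorProduct.map (φ : Γ →ₗ[k] D) (TensorProduct.map (φ : Γ →ₗ[k] D) f) (nextDel del z) =
      nextDel del' (TensorProduct.map (φ : Γ →ₗ[k] D) f z) := by
  induction z with
  | zero => simp
  | add u u' hu hu' => simp only [map_add, hu, hu']
  | tmul a x =>
    have h1 : ∀ w : Γ ⊗[k] Γ,
        TensorProduct.map (φ : Γ →ₗ[k] D) (TensorProduct.map (φ : Γ →ₗ[k] D) f)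
          (TensorProduct.assoc k Γ Γ V (w ⊗ₜ x)) =
        TensorProduct.assoc k D D W
          (TensorProduct.map (φ : Γ →ₗ[k] D) (φ : Γ →ₗ[k] D) w ⊗ₜ f x) := by
      intro w
      induction w with
      | zero => simp
      | add u u' hu hu' => simp only [TensorProduct.add_tmul, map_add, hu, hu']
      | tmul a b => simp
    have h2 : TensorProduct.map (φ : Γ →ₗ[k] D) (φ : Γ →ₗ[k] D) (Coalgebra.comul (R := k) a) =
        Coalgebra.comul (R := k) (φ a) := CoalgHomClass.map_comp_comul_apply φ a
    rw [nextDel_tmul, map_sub, h1, h2, TensorProduct.map_tmul, TensorProduct.map_tmul, h,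
      nextDel_tmul]
    rfl

/-- One stage of the cobar complex: the cochains `V` in some degree `t`, and the map
`del : V → Γ ⊗ V`,
`[a₁|⋯|a_t] n ↦ ∑ᵢ (-1)^(i-1) [a₁|⋯|aᵢ'|aᵢ''|⋯|a_t] n + (-1)^t [a₁|⋯|a_t|n'] n''`. -/
structure CobarStage (k Γ : Type) [Field k] [CommRing Γ] [Bialgebra k Γ] where
  /-- the cochains -/
  V : Type v
  [addCommGroup : AddCommGroup V]
  [module : Module k V]
  /-- the map `del` -/
  del : V →ₗ[k] Γ ⊗[k] V
  del_del : ∀ x, nextDel del (del x) = 0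

attribute [instance] CobarStage.addCommGroup CobarStage.module

/-- The cobar cochains of `N` in degree `t`, that is `Γ ⊗ ⋯ ⊗ Γ ⊗ N` with `t` factors `Γ`. -/
def cobarStage (N : Comod.{v} k Γ) : ℕ → CobarStage.{v} k Γ
  | 0 => ⟨N.carrier, N.coact, fun x => sub_eq_zero.2 (N.coassoc x)⟩
  | t + 1 => ⟨Γ ⊗[k] (cobarStage N t).V, nextDel (cobarStage N t).del,
      nextDel_nextDel _ (cobarStage N t).del_del⟩

/-- The map `x ↦ [a] x` on cobar cochains. -/
def cobarCons (N : Comod.{v} k Γ) (t : ℕ) (a : Γ) :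
    (cobarStage N t).V →ₗ[k] (cobarStage N (t + 1)).V :=
  (TensorProduct.mk k Γ (cobarStage N t).V a : (cobarStage N t).V →ₗ[k] Γ ⊗[k] (cobarStage N t).V)

/-- The map `del` of `CobarStage`, from cochains of degree `t` to cochains of degree `t + 1`. -/
def cobarDel (N : Comod.{v} k Γ) (t : ℕ) :
    (cobarStage N t).V →ₗ[k] (cobarStage N (t + 1)).V :=
  (cobarStage N t).del

/-- The cobar differential
`d [a₁|⋯|a_t] n = [1|a₁|⋯|a_t] n + ∑ᵢ (-1)^i [⋯|aᵢ'|aᵢ''|⋯] n + (-1)^(t+1) [a₁|⋯|a_t|n'] n''`. -/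
def cobarD (N : Comod.{v} k Γ) (t : ℕ) :
    (cobarStage N t).V →ₗ[k] (cobarStage N (t + 1)).V :=
  cobarCons N t 1 - cobarDel N t

theorem cobarD_cons (N : Comod.{v} k Γ) (t : ℕ) (a : Γ) (x : (cobarStage N t).V) :
    cobarD N (t + 1) (cobarCons N t a x) = ((1 : Γ) ⊗ₜ[k] (a ⊗ₜ[k] x) -
      (TensorProduct.assoc k Γ Γ (cobarStage N t).V (Coalgebra.comul (R := k) a ⊗ₜ x) -
        a ⊗ₜ[k] (cobarStage N t).del x) : Γ ⊗[k] (Γ ⊗[k] (cobarStage N t).V)) := by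
  rw [← nextDel_tmul]
  rfl

theorem cobarD_cobarD (N : Comod.{v} k Γ) (t : ℕ) (x : (cobarStage N t).V) :
    cobarD N (t + 1) (cobarD N t x) = 0 := by
  have h1 : cobarD N t x = cobarCons N t 1 x - cobarDel N t x := rfl
  have h2 : cobarD N (t + 1) (cobarDel N t x) = cobarCons N (t + 1) 1 (cobarDel N t x) := by
    have h3 : cobarD N (t + 1) (cobarDel N t x) =
      cobarCons N (t + 1) 1 (cobarDel N t x) - cobarDel N (t + 1) (cobarDel N t x) := rfl
    have h4 : cobarDel N (t + 1) (cobarDel N t x) = 0 := (cobarStage N t).del_del x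
    rw [h3, h4, sub_zero]
  have h5 : cobarD N (t + 1) (cobarCons N t 1 x) = cobarCons N (t + 1) 1 (cobarDel N t x) := by
    rw [cobarD_cons, Bialgebra.comul_one, Algebra.TensorProduct.one_def, TensorProduct.assoc_tmul,
      sub_sub_cancel]
    rfl
  rw [h1, map_sub, h2, h5, sub_self]

/-- A primitive element of `Γ`. -/
structure Prim (k Γ : Type) [Field k] [CommRing Γ] [Bialgebra k Γ] where
  /-- the element -/
  val : Γ
  comul_val : Coalgebra.comul (R := k) val = val ⊗ₜ[k] 1 + 1 ⊗ₜ[k] val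

/-- The image of a primitive element under a map of bialgebras. -/
def Prim.map (q : Γ →ₐc[k] D) (ξ : Prim k Γ) : Prim k D where
  val := q ξ.val
  comul_val := by
    rw [← CoalgHomClass.map_comp_comul_apply, ξ.comul_val]
    simp

theorem Prim.comul_sq (ξ : Prim k Γ) : Coalgebra.comul (R := k) (ξ.val ^ 2) =
    (ξ.val ^ 2) ⊗ₜ[k] 1 + (ξ.val ⊗ₜ[k] ξ.val + ξ.val ⊗ₜ[k] ξ.val) + 1 ⊗ₜ[k] (ξ.val ^ 2) := by
  rw [pow_two, Bialgebra.comul_mul, ξ.comul_val]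
  simp only [add_mul, mul_add, Algebra.TensorProduct.tmul_mul_tmul, mul_one, one_mul]
  abel

/-- Multiplication by the cocycle `[ξ|ξ²] + [ξ²|ξ]` on cobar cochains. -/
def cobarB (ξ : Prim k Γ) (N : Comod.{v} k Γ) (t : ℕ) :
    (cobarStage N t).V →ₗ[k] (cobarStage N (t + 2)).V :=
  cobarCons N (t + 1) ξ.val ∘ₗ cobarCons N t (ξ.val ^ 2) +
    cobarCons N (t + 1) (ξ.val ^ 2) ∘ₗ cobarCons N t ξ.val

theorem cobarD_cobarB (ξ : Prim k Γ) (N : Comod.{v} k Γ) (t : ℕ) (x : (cobarStage N t).V) :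
    cobarD N (t + 2) (cobarB ξ N t x) = cobarB ξ N (t + 1) (cobarD N t x) := by
  have key : ∀ a b : Γ, cobarD N (t + 2) (cobarCons N (t + 1) a (cobarCons N t b x)) =
      ((1 : Γ) ⊗ₜ[k] (a ⊗ₜ[k] (b ⊗ₜ[k] x)) -
      (TensorProduct.assoc k Γ Γ (Γ ⊗[k] (cobarStage N t).V)
        (Coalgebra.comul (R := k) a ⊗ₜ (b ⊗ₜ[k] x)) -
        a ⊗ₜ[k] (TensorProduct.assoc k Γ Γ (cobarStage N t).V (Coalgebra.comul (R := k) b ⊗ₜ x) -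
          b ⊗ₜ[k] (cobarStage N t).del x)) :
          Γ ⊗[k] (Γ ⊗[k] (Γ ⊗[k] (cobarStage N t).V))) := by
    intro a b
    rw [cobarD_cons, ← nextDel_tmul]
    rfl
  have h1 : cobarB ξ N (t + 1) (cobarD N t x) =
      (ξ.val ⊗ₜ[k] ((ξ.val ^ 2) ⊗ₜ[k] ((1 : Γ) ⊗ₜ[k] x - (cobarStage N t).del x)) +
        (ξ.val ^ 2) ⊗ₜ[k] (ξ.val ⊗ₜ[k] ((1 : Γ) ⊗ₜ[k] x - (cobarStage N t).del x)) :
          Γ ⊗[k] (Γ ⊗[k] (Γ ⊗[k] (cobarStage N t).V))) := rfl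
  have h2 : cobarB ξ N t x = cobarCons N (t + 1) ξ.val (cobarCons N t (ξ.val ^ 2) x) +
    cobarCons N (t + 1) (ξ.val ^ 2) (cobarCons N t ξ.val x) := rfl
  rw [h1, h2, map_add, key, key, ξ.comul_sq, ξ.comul_val]
  change (_ : Γ ⊗[k] (Γ ⊗[k] (Γ ⊗[k] (cobarStage N t).V))) + _ = _
  simp only [TensorProduct.add_tmul, TensorProduct.tmul_add, TensorProduct.tmul_sub, map_add,
    TensorProduct.assoc_tmul]
  abel

/-- The map induced on cobar cochains by a map of comodules. -/
def cobarMapAux {φ : Γ →ₐc[k] D} {N : Comod.{v} k Γ} {N' : Comod.{v} k D}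
    (f : Comod.Hom φ N N') : ∀ t, { g : (cobarStage N t).V →ₗ[k] (cobarStage N' t).V //
      ∀ x, TensorProduct.map (φ : Γ →ₗ[k] D) g ((cobarStage N t).del x) =
        (cobarStage N' t).del (g x) }
  | 0 => ⟨f.lin, f.comm⟩
  | t + 1 => ⟨TensorProduct.map (φ : Γ →ₗ[k] D) (cobarMapAux f t).1,
      map_nextDel φ _ _ _ (cobarMapAux f t).2⟩

/-- The map `[a₁|⋯|a_t] n ↦ [φ a₁|⋯|φ a_t] f n` on cobar cochains. -/
def cobarMap {φ : Γ →ₐc[k] D} {N : Comod.{v} k Γ} {N' : Comod.{v} k D}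
    (f : Comod.Hom φ N N') (t : ℕ) : (cobarStage N t).V →ₗ[k] (cobarStage N' t).V :=
  (cobarMapAux f t).1

theorem cobarMap_cons {φ : Γ →ₐc[k] D} {N : Comod.{v} k Γ} {N' : Comod.{v} k D}
    (f : Comod.Hom φ N N') (t : ℕ) (a : Γ) (x : (cobarStage N t).V) :
    cobarMap f (t + 1) (cobarCons N t a x) = cobarCons N' t (φ a) (cobarMap f t x) := rfl

theorem cobarMap_cobarD {φ : Γ →ₐc[k] D} {N : Comod.{v} k Γ} {N' : Comod.{v} k D}
    (f : Comod.Hom φ N N') (t : ℕ) (x : (cobarStage N t).V) :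
    cobarMap f (t + 1) (cobarD N t x) = cobarD N' t (cobarMap f t x) := by
  have h1 : cobarD N t x = cobarCons N t 1 x - cobarDel N t x := rfl
  have h2 : cobarD N' t (cobarMap f t x) = cobarCons N' t 1 (cobarMap f t x) -
    cobarDel N' t (cobarMap f t x) := rfl
  have h3 : cobarMap f (t + 1) (cobarDel N t x) = cobarDel N' t (cobarMap f t x) := (cobarMapAux f t).2 x
  rw [h1, map_sub, cobarMap_cons, h3, h2, map_one]

theorem cobarMap_cobarB {φ : Γ →ₐc[k] D} {N : Comod.{v} k Γ} {N' : Comod.{v} k D}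
    (f : Comod.Hom φ N N') (ξ : Prim k Γ) (ζ : Prim k D) (h : φ ξ.val = ζ.val) (t : ℕ)
    (x : (cobarStage N t).V) :
    cobarMap f (t + 2) (cobarB ξ N t x) = cobarB ζ N' t (cobarMap f t x) := by
  have h2 : cobarB ξ N t x = cobarCons N (t + 1) ξ.val (cobarCons N t (ξ.val ^ 2) x) +
    cobarCons N (t + 1) (ξ.val ^ 2) (cobarCons N t ξ.val x) := rfl
  have h3 : ∀ y, cobarB ζ N' t y =
    cobarCons N' (t + 1) ζ.val (cobarCons N' t (ζ.val ^ 2) y) +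
    cobarCons N' (t + 1) (ζ.val ^ 2) (cobarCons N' t ζ.val y) := fun _ => rfl
  rw [h2, h3, map_add, cobarMap_cons, cobarMap_cons, cobarMap_cons, cobarMap_cons, map_pow, h]

end CobarComplex

section Total

universe v

variable {k Γ D : Type} [Field k] [CommRing Γ] [Bialgebra k Γ] [CommRing D] [Bialgebra k D]

/-- The cobar complex `⨁ₜ Γ^{⊗ t} ⊗ N` of a comodule `N`. It is a module over `k[X]`, where `X` acts
as multiplication by the cocycle `[ξ|ξ²] + [ξ²|ξ]`. -/
def Cobar (_ξ : Prim k Γ) (N : Comod.{v} k Γ) : Type v := ⨁ t : ℕ, (cobarStage N t).V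

namespace Cobar

variable (ξ : Prim k Γ) (N N' N'' : Comod.{v} k Γ)

instance : AddCommGroup (Cobar ξ N) :=
  inferInstanceAs (AddCommGroup (⨁ t : ℕ, (cobarStage N t).V))

instance : Module k (Cobar ξ N) := inferInstanceAs (Module k (⨁ t : ℕ, (cobarStage N t).V))

/-- The inclusion of the cochains of degree `t`. -/
def of (t : ℕ) : (cobarStage N t).V →ₗ[k] Cobar ξ N :=
  DirectSum.lof k ℕ (fun t => (cobarStage N t).V) t

variable {ξ N} in
theorem induction {p : Cobar ξ N → Prop} (h0 : p 0) (hof : ∀ t x, p (of ξ N t x))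
    (hadd : ∀ x y, p x → p y → p (x + y)) (x : Cobar ξ N) : p x :=
  DirectSum.induction_on x h0 hof hadd

/-- A linear map out of the cobar complex, given degreewise. -/
def desc {V : Type*} [AddCommGroup V] [Module k V] (f : ∀ t, (cobarStage N t).V →ₗ[k] V) :
    Cobar ξ N →ₗ[k] V :=
  DirectSum.toModule k ℕ V f

theorem desc_of {V : Type*} [AddCommGroup V] [Module k V] (f : ∀ t, (cobarStage N t).V →ₗ[k] V)
    (t : ℕ) (x : (cobarStage N t).V) : desc ξ N f (of ξ N t x) = f t x :=
  DirectSum.toModule_lof k (M := fun t => (cobarStage N t).V) t x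

/-- Left multiplication by `[ξ|ξ²] + [ξ²|ξ]`. -/
def b : Cobar ξ N →ₗ[k] Cobar ξ N := desc ξ N fun t => of ξ N (t + 2) ∘ₗ cobarB ξ N t

instance : Module k[X] (Cobar ξ N) :=
  Module.compHom (Cobar ξ N) (Polynomial.aeval (R := k) (b ξ N)).toRingHom

theorem smul_def (p : k[X]) (x : Cobar ξ N) : p • x = Polynomial.aeval (b ξ N) p x := rfl

theorem X_smul (x : Cobar ξ N) : (Polynomial.X : k[X]) • x = b ξ N x := by
  rw [smul_def, Polynomial.aeval_X]

/-- A `k`-linear map which commutes with the multiplication by `[ξ|ξ²] + [ξ²|ξ]` is linear over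
`k[X]`. -/
def upgrade {ξ : Prim k Γ} {N : Comod.{v} k Γ} {ζ : Prim k D} {L : Comod.{v} k D}
    (f : Cobar ξ N →ₗ[k] Cobar ζ L) (hf : ∀ x, f (b ξ N x) = b ζ L (f x)) :
    Cobar ξ N →ₗ[k[X]] Cobar ζ L where
  toFun := f
  map_add' := map_add f
  map_smul' p x := by
    change f (p • x) = p • f x
    induction p using Polynomial.induction_on' with
    | add p q hp hq => rw [add_smul, map_add, hp, hq, add_smul]
    | monomial n a =>
      have h : ∀ (n : ℕ) (y : Cobar ξ N), f ((b ξ N ^ n) y) = (b ζ L ^ n) (f y) := by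
        intro n
        induction n with
        | zero => intro y; rfl
        | succ n ih => intro y; rw [pow_succ, pow_succ, Module.End.mul_apply, ih, hf]; rfl
      rw [smul_def, smul_def, Polynomial.aeval_monomial, Polynomial.aeval_monomial,
        Module.End.mul_apply, Module.End.mul_apply, ← h]
      exact map_smul f a _

/-- The cobar differential as a `k`-linear map. -/
def dk : Cobar ξ N →ₗ[k] Cobar ξ N := desc ξ N fun t => of ξ N (t + 1) ∘ₗ cobarD N t

/-- The cobar differential. -/
def d : Cobar ξ N →ₗ[k[X]] Cobar ξ N :=
  upgrade (dk ξ N) (by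
    intro x
    induction x using induction with
    | h0 => simp
    | hof t x =>
      simp only [dk, b, desc_of, LinearMap.comp_apply]
      rw [cobarD_cobarB]
    | hadd x y hx hy => simp only [map_add, hx, hy])

theorem d_of (t : ℕ) (x : (cobarStage N t).V) :
    d ξ N (of ξ N t x) = of ξ N (t + 1) (cobarD N t x) :=
  desc_of ξ N _ t x

theorem d_d (x : Cobar ξ N) : d ξ N (d ξ N x) = 0 := by
  induction x using induction with
  | h0 => simp
  | hof t x => rw [d_of, d_of, cobarD_cobarD, map_zero]
  | hadd x y hx hy => simp only [map_add, hx, hy, add_zero]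

/-- The map of cobar complexes induced by a map of comodules, as a `k`-linear map. -/
def mapk {φ : Γ →ₐc[k] D} {N : Comod.{v} k Γ} {L : Comod.{v} k D} (ζ : Prim k D)
    (f : Comod.Hom φ N L) : Cobar ξ N →ₗ[k] Cobar ζ L :=
  desc ξ N fun t => of ζ L t ∘ₗ cobarMap f t

/-- The map of cobar complexes induced by a map of comodules along a map `φ` of bialgebras with
`φ ξ = ζ`. -/
def map {φ : Γ →ₐc[k] D} {N : Comod.{v} k Γ} {L : Comod.{v} k D} (ζ : Prim k D)
    (h : φ ξ.val = ζ.val) (f : Comod.Hom φ N L) : Cobar ξ N →ₗ[k[X]] Cobar ζ L :=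
  upgrade (mapk ξ ζ f) (by
    intro x
    induction x using induction with
    | h0 => simp
    | hof t x =>
      simp only [mapk, b, desc_of, LinearMap.comp_apply]
      rw [cobarMap_cobarB f ξ ζ h]
    | hadd x y hx hy => simp only [map_add, hx, hy])

theorem map_of {φ : Γ →ₐc[k] D} {N : Comod.{v} k Γ} {L : Comod.{v} k D} (ζ : Prim k D)
    (h : φ ξ.val = ζ.val) (f : Comod.Hom φ N L) (t : ℕ) (x : (cobarStage N t).V) :
    map ξ ζ h f (of ξ N t x) = of ζ L t (cobarMap f t x) :=
  desc_of ξ N _ t x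

theorem map_d {φ : Γ →ₐc[k] D} {N : Comod.{v} k Γ} {L : Comod.{v} k D} (ζ : Prim k D)
    (h : φ ξ.val = ζ.val) (f : Comod.Hom φ N L) (x : Cobar ξ N) :
    map ξ ζ h f (d ξ N x) = d ζ L (map ξ ζ h f x) := by
  induction x using induction with
  | h0 => simp
  | hof t x => rw [d_of, map_of, map_of, d_of, cobarMap_cobarD]
  | hadd x y hx hy => simp only [map_add, hx, hy]

/-- The map of cobar complexes induced by a map of `Γ`-comodules. -/
def mapId {N N' : Comod.{v} k Γ} (f : Comod.Hom (BialgHom.id k Γ) N N') :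
    Cobar ξ N →ₗ[k[X]] Cobar ξ N' :=
  map ξ ξ rfl f

theorem mapId_of {N N' : Comod.{v} k Γ} (f : Comod.Hom (BialgHom.id k Γ) N N')
    (t : ℕ) (x : (cobarStage N t).V) : mapId ξ f (of ξ N t x) = of ξ N' t (cobarMap f t x) :=
  map_of ξ ξ rfl f t x

theorem mapId_d {N N' : Comod.{v} k Γ} (f : Comod.Hom (BialgHom.id k Γ) N N') (x : Cobar ξ N) :
    mapId ξ f (d ξ N x) = d ξ N' (mapId ξ f x) :=
  map_d ξ ξ rfl f x

section Exact

variable {N N' N''}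

theorem cobarMap_injective (f : Comod.Hom (BialgHom.id k Γ) N N')
    (hf : Function.Injective f.lin) : ∀ t, Function.Injective (cobarMap f t)
  | 0 => hf
  | t + 1 => Module.Flat.lTensor_preserves_injective_linearMap (M := Γ) _
      (cobarMap_injective f hf t)

theorem cobarMap_surjective (f : Comod.Hom (BialgHom.id k Γ) N N')
    (hf : Function.Surjective f.lin) : ∀ t, Function.Surjective (cobarMap f t)
  | 0 => hf
  | t + 1 => LinearMap.lTensor_surjective Γ (cobarMap_surjective f hf t)

theorem cobarMap_exact (f : Comod.Hom (BialgHom.id k Γ) N N')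
    (g : Comod.Hom (BialgHom.id k Γ) N' N'')
    (h : Function.Exact f.lin g.lin) : ∀ t, Function.Exact (cobarMap f t) (cobarMap g t)
  | 0 => h
  | t + 1 => Module.Flat.lTensor_exact Γ (cobarMap_exact f g h t)

theorem mapId_eq_lmap (f : Comod.Hom (BialgHom.id k Γ) N N') (x : ⨁ t : ℕ, (cobarStage N t).V) :
    (mapId ξ f x : ⨁ t : ℕ, (cobarStage N' t).V) = DirectSum.lmap (cobarMap f) x := by
  induction x using DirectSum.induction_on with
  | zero => exact (map_zero (mapId ξ f)).trans (map_zero _).symm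
  | of t x =>
    refine (mapId_of ξ f t x).trans ?_
    exact (DirectSum.lmap_lof _ _ _).symm
  | add x y hx hy =>
    refine (map_add (mapId ξ f) x y).trans ?_
    rw [map_add, ← hx, ← hy]
    rfl

theorem mapId_injective (f : Comod.Hom (BialgHom.id k Γ) N N') (hf : Function.Injective f.lin) :
    Function.Injective (mapId ξ f) := by
  intro x y hxy
  have h := (mapId_eq_lmap ξ f x).symm.trans (hxy.trans (mapId_eq_lmap ξ f y))
  exact (DirectSum.lmap_injective _).2 (cobarMap_injective f hf) h

theorem mapId_surjective (f : Comod.Hom (BialgHom.id k Γ) N N')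
    (hf : Function.Surjective f.lin) : Function.Surjective (mapId ξ f) := by
  intro y
  obtain ⟨x, hx⟩ := (DirectSum.lmap_surjective _).2 (cobarMap_surjective f hf) y
  exact ⟨x, (mapId_eq_lmap ξ f x).trans hx⟩

theorem mapId_exact (f : Comod.Hom (BialgHom.id k Γ) N N')
    (g : Comod.Hom (BialgHom.id k Γ) N' N'') (h : Function.Exact f.lin g.lin) :
    Function.Exact (mapId ξ f) (mapId ξ g) := by
  have hex := cobarMap_exact f g h
  intro y
  constructor
  · intro hy
    have hy' : y ∈ LinearMap.ker (DirectSum.lmap (cobarMap g)) :=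
      (mapId_eq_lmap ξ g y).symm.trans hy
    rw [DirectSum.ker_lmap] at hy'
    have : y ∈ LinearMap.range (DirectSum.lmap (cobarMap f)) := by
      rw [DirectSum.range_lmap]
      exact fun t ht => ((hex t) _).1 (hy' t ht)
    obtain ⟨x, hx⟩ := this
    exact ⟨x, (mapId_eq_lmap ξ f x).trans hx⟩
  · rintro ⟨x, rfl⟩
    induction x using induction with
    | h0 => simp
    | hof t x => rw [mapId_of, mapId_of, (hex t).apply_apply_eq_zero, map_zero]
    | hadd x y hx hy => rw [map_add, map_add, hx, hy, add_zero]

end Exact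

end Cobar

end Total

section ExactCouples

universe v

variable {R : Type} [CommRing R]

/-- The cohomology `ker d / im d` of a module with a differential. -/
abbrev Coh {A : Type v} [AddCommGroup A] [Module R A] (d : A →ₗ[R] A) : Type v :=
  LinearMap.ker d ⧸ (LinearMap.range d).submoduleOf (LinearMap.ker d)

namespace Coh

variable {A B C : Type v} [AddCommGroup A] [Module R A] [AddCommGroup B] [Module R B]
  [AddCommGroup C] [Module R C] {dA : A →ₗ[R] A} {dB : B →ₗ[R] B} {dC : C →ₗ[R] C}

/-- The class of a cocycle. -/
def mk (dA : A →ₗ[R] A) : LinearMap.ker dA →ₗ[R] Coh dA :=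
  ((LinearMap.range dA).submoduleOf (LinearMap.ker dA)).mkQ

theorem mk_surjective : Function.Surjective (mk dA) := Submodule.mkQ_surjective _

theorem mk_eq_zero (x : LinearMap.ker dA) : mk dA x = 0 ↔ ∃ y, dA y = x := by
  rw [mk, Submodule.mkQ_apply, Submodule.Quotient.mk_eq_zero]
  exact Iff.rfl

/-- The map on cohomology induced by a map commuting with the differentials. -/
def map (f : A →ₗ[R] B) (hf : ∀ x, f (dA x) = dB (f x)) : Coh dA →ₗ[R] Coh dB :=
  Submodule.mapQ _ _
    (f.restrict (p := LinearMap.ker dA) (q := LinearMap.ker dB) (fun x hx => by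
      rw [LinearMap.mem_ker] at hx ⊢
      rw [← hf, hx, map_zero]))
    (by
      rintro ⟨x, hx⟩ ⟨y, rfl⟩
      exact ⟨f y, (hf y).symm⟩)

theorem map_mk (f : A →ₗ[R] B) (hf : ∀ x, f (dA x) = dB (f x)) (x : LinearMap.ker dA)
    (hx : f x ∈ LinearMap.ker dB) : map f hf (mk dA x) = mk dB ⟨f x, hx⟩ := rfl

section Conn

variable (f : A →ₗ[R] B) (g : B →ₗ[R] C) (hf : ∀ x, f (dA x) = dB (f x))
  (hg : ∀ x, g (dB x) = dC (g x)) (hfi : Function.Injective f) (hgs : Function.Surjective g)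
  (hex : Function.Exact f g) (hB : ∀ x, dB (dB x) = 0)

/-- The elements of `B` whose image in `C` is a cocycle. -/
def liftCocycles (dB : B →ₗ[R] B) (g : B →ₗ[R] C) : Submodule R B :=
  LinearMap.ker (g ∘ₗ dB)

/-- The cocycle of `A` which is mapped to `d b`. -/
def connAux : liftCocycles dB g →ₗ[R] LinearMap.ker dA :=
  LinearMap.codRestrict _
    ((LinearEquiv.ofInjective f hfi).symm.toLinearMap ∘ₗ
      LinearMap.codRestrict (LinearMap.range f) (dB ∘ₗ (liftCocycles dB g).subtype)
        (fun b => (hex _).1 b.2))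
    (fun b => by
      rw [LinearMap.mem_ker]
      apply hfi
      have h := LinearEquiv.ofInjective_symm_apply (f := f) (h := hfi)
        (LinearMap.codRestrict (LinearMap.range f) (dB ∘ₗ (liftCocycles dB g).subtype)
          (fun b => (hex _).1 b.2) b)
      rw [map_zero, hf]
      refine (congrArg dB h).trans ?_
      exact hB b)

theorem connAux_spec (b : liftCocycles dB g) :
    f (connAux f g hf hfi hex hB b) = dB b :=
  LinearEquiv.ofInjective_symm_apply (f := f) (h := hfi)
    (LinearMap.codRestrict (LinearMap.range f) (dB ∘ₗ (liftCocycles dB g).subtype)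
      (fun b => (hex _).1 b.2) b)

/-- The class in the cohomology of `C` of the image of `b`. -/
def connProj : liftCocycles dB g →ₗ[R] Coh dC :=
  mk dC ∘ₗ LinearMap.codRestrict _ (g ∘ₗ (liftCocycles dB g).subtype) (fun b => by
    rw [LinearMap.mem_ker]
    exact (hg b).symm.trans b.2)

theorem connProj_surjective (hgs : Function.Surjective g) :
    Function.Surjective (connProj g hg) := by
  intro c
  obtain ⟨⟨c, hc⟩, rfl⟩ := mk_surjective c
  obtain ⟨b, rfl⟩ := hgs c
  exact ⟨⟨b, (hg b).trans hc⟩, rfl⟩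

theorem connProj_ker (hgs : Function.Surjective g) : LinearMap.ker (connProj g hg) ≤
    LinearMap.ker (mk dA ∘ₗ connAux f g hf hfi hex hB) := by
  intro b hb
  rw [LinearMap.mem_ker] at hb ⊢
  obtain ⟨c, hc⟩ := (mk_eq_zero _).1 hb
  obtain ⟨b', rfl⟩ := hgs c
  have hc' : dC (g b') = g b := hc
  have h1 : g ((b : B) - dB b') = 0 := by rw [map_sub, hg, hc', sub_self]
  obtain ⟨a, ha⟩ := (hex _).1 h1
  refine (mk_eq_zero _).2 ⟨a, hfi ?_⟩
  rw [connAux_spec, hf, ha, map_sub, hB, sub_zero]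

/-- The connecting homomorphism of a short exact sequence `0 → A → B → C → 0`: the class of `g b`
is mapped to the class of the cocycle `a` with `f a = d b`. -/
def conn (hgs : Function.Surjective g) : Coh dC →ₗ[R] Coh dA :=
  (LinearMap.ker (connProj g hg)).liftQ (mk dA ∘ₗ connAux f g hf hfi hex hB)
      (connProj_ker f g hf hg hfi hex hB hgs) ∘ₗ
    ((connProj g hg).quotKerEquivOfSurjective (connProj_surjective g hg hgs)).symm.toLinearMap

theorem conn_connProj (hgs : Function.Surjective g) (b : liftCocycles dB g) :
    conn f g hf hg hfi hex hB hgs (connProj g hg b) = mk dA (connAux f g hf hfi hex hB b) := by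
  have h : ((connProj g hg).quotKerEquivOfSurjective (connProj_surjective g hg hgs)).symm
      (connProj g hg b) = (LinearMap.ker (connProj g hg)).mkQ b := by
    rw [LinearEquiv.symm_apply_eq]
    rfl
  rw [conn, LinearMap.comp_apply, LinearEquiv.coe_coe, h]
  rfl

theorem conn_mk (hgs : Function.Surjective g) (b : B) (a : LinearMap.ker dA)
    (c : LinearMap.ker dC) (hc : g b = c) (ha : f a = dB b) :
    conn f g hf hg hfi hex hB hgs (mk dC c) = mk dA a := by
  have hb : b ∈ liftCocycles dB g := by
    change g (dB b) = 0
    rw [hg, hc]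
    exact c.2
  have h1 : mk dC c = connProj g hg ⟨b, hb⟩ := congrArg (mk dC) (Subtype.ext hc.symm)
  rw [h1, conn_connProj]
  refine congrArg (mk dA) (Subtype.ext (hfi ?_))
  rw [connAux_spec, ha]

theorem exact_conn_map (hgs : Function.Surjective g) :
    Function.Exact (conn f g hf hg hfi hex hB hgs) (map f hf) := by
  intro x
  constructor
  · obtain ⟨a, rfl⟩ := mk_surjective x
    intro h
    have hfa : f a ∈ LinearMap.ker dB := by
      rw [LinearMap.mem_ker, ← hf, LinearMap.mem_ker.1 a.2, map_zero]
    rw [map_mk f hf a hfa] at h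
    obtain ⟨b, hb⟩ := (mk_eq_zero _).1 h
    have hb' : dB b = f a := hb
    have hc : g b ∈ LinearMap.ker dC := by
      rw [LinearMap.mem_ker, ← hg, hb', hex.apply_apply_eq_zero]
    exact ⟨mk dC ⟨g b, hc⟩, conn_mk f g hf hg hfi hex hB hgs b a _ rfl hb'.symm⟩
  · rintro ⟨y, rfl⟩
    obtain ⟨b, rfl⟩ := connProj_surjective g hg hgs y
    rw [conn_connProj, map_mk f hf _ (by rw [connAux_spec]; exact hB b)]
    exact (mk_eq_zero _).2 ⟨b, (connAux_spec f g hf hfi hex hB b).symm⟩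

theorem exact_map_map (hgs : Function.Surjective g) (hfi : Function.Injective f)
    (hex : Function.Exact f g) (hB : ∀ x, dB (dB x) = 0) :
    Function.Exact (map f hf) (map g hg) := by
  intro y
  obtain ⟨b, rfl⟩ := mk_surjective y
  have hgb : g b ∈ LinearMap.ker dC := by
    rw [LinearMap.mem_ker, ← hg, LinearMap.mem_ker.1 b.2, map_zero]
  rw [map_mk g hg b hgb]
  constructor
  · intro h
    obtain ⟨c, hc⟩ := (mk_eq_zero _).1 h
    obtain ⟨b', rfl⟩ := hgs c
    have hc' : dC (g b') = g b := hc
    have h1 : g ((b : B) - dB b') = 0 := by rw [map_sub, hg, hc', sub_self]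
    obtain ⟨a, ha⟩ := (hex _).1 h1
    have hda : a ∈ LinearMap.ker dA := by
      rw [LinearMap.mem_ker]
      apply hfi
      rw [hf, ha, map_sub, hB, LinearMap.mem_ker.1 b.2, sub_zero, map_zero]
    refine ⟨mk dA ⟨a, hda⟩, ?_⟩
    have hfa : f a ∈ LinearMap.ker dB := by
      rw [LinearMap.mem_ker, ← hf, LinearMap.mem_ker.1 hda, map_zero]
    rw [map_mk f hf _ hfa, ← sub_eq_zero, ← map_sub]
    refine (mk_eq_zero _).2 ⟨-b', ?_⟩
    change dB (-b') = f a - b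
    rw [ha, map_neg]
    abel
  · rintro ⟨x, hx⟩
    obtain ⟨a, rfl⟩ := mk_surjective x
    have hfa : f a ∈ LinearMap.ker dB := by
      rw [LinearMap.mem_ker, ← hf, LinearMap.mem_ker.1 a.2, map_zero]
    rw [map_mk f hf _ hfa, ← sub_eq_zero, ← map_sub] at hx
    obtain ⟨b', hb'⟩ := (mk_eq_zero _).1 hx
    have hb'' : dB b' = f a - b := hb'
    refine (mk_eq_zero _).2 ⟨-(g b'), ?_⟩
    change dC (-(g b')) = g b
    rw [map_neg, ← hg, hb'', map_sub, hex.apply_apply_eq_zero, zero_sub, neg_neg]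

theorem exact_map_conn (hgs : Function.Surjective g) :
    Function.Exact (map g hg) (conn f g hf hg hfi hex hB hgs) := by
  intro z
  constructor
  · obtain ⟨b, rfl⟩ := connProj_surjective g hg hgs z
    rw [conn_connProj]
    intro h
    obtain ⟨a, ha⟩ := (mk_eq_zero _).1 h
    have h1 : f (dA a) = dB b := by rw [ha, connAux_spec]
    have h2 : (b : B) - f a ∈ LinearMap.ker dB := by
      rw [LinearMap.mem_ker, map_sub, ← hf, h1, sub_self]
    refine ⟨mk dB ⟨(b : B) - f a, h2⟩, ?_⟩
    refine congrArg (mk dC) (Subtype.ext ?_)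
    change g ((b : B) - f a) = g b
    rw [map_sub, hex.apply_apply_eq_zero, sub_zero]
  · rintro ⟨y, rfl⟩
    obtain ⟨b, rfl⟩ := mk_surjective y
    have hgb : g b ∈ LinearMap.ker dC := by
      rw [LinearMap.mem_ker, ← hg, LinearMap.mem_ker.1 b.2, map_zero]
    rw [map_mk g hg b hgb,
      conn_mk f g hf hg hfi hex hB hgs b 0 ⟨g b, hgb⟩ rfl
        (by rw [LinearMap.mem_ker.1 b.2]; exact map_zero f), map_zero]

end Conn

end Coh

end ExactCouples

section SpectralSequence

universe v

/-- An unrolled exact couple, indexed by filtrations `s ≥ 0`: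
`⋯ → D (s+1) --i--> D s → ⋯ → D 0`, with `j : D s → E s` and `κ : E s → D (s+1)`, such that
`D (s+1) --i--> D s --j--> E s --κ--> D (s+1) --i--> D s` is exact. -/
structure ExactCouple (R : Type) [CommRing R] where
  D : ℕ → Type v
  E : ℕ → Type v
  [groupD : ∀ s, AddCommGroup (D s)]
  [groupE : ∀ s, AddCommGroup (E s)]
  [moduleD : ∀ s, Module R (D s)]
  [moduleE : ∀ s, Module R (E s)]
  i : ∀ s, D (s + 1) →ₗ[R] D s
  j : ∀ s, D s →ₗ[R] E s
  κ : ∀ s, E s →ₗ[R] D (s + 1)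
  exact_i_j : ∀ s, Function.Exact (i s) (j s)
  exact_j_κ : ∀ s, Function.Exact (j s) (κ s)
  exact_κ_i : ∀ s, Function.Exact (κ s) (i s)

attribute [instance] ExactCouple.groupD ExactCouple.groupE ExactCouple.moduleD ExactCouple.moduleE

namespace ExactCouple

variable {R : Type} [CommRing R] (C : ExactCouple.{v} R)

/-- The composite `D s → D 0`. -/
def toZero : ∀ s, C.D s →ₗ[R] C.D 0
  | 0 => LinearMap.id
  | s + 1 => toZero s ∘ₗ C.i s

/-- The `m`-fold composite `i ∘ ⋯ ∘ i : D (s+m+1) → D (s+1)`. -/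
def shift (s : ℕ) : ∀ m, C.D (s + m + 1) →ₗ[R] C.D (s + 1)
  | 0 => LinearMap.id
  | m + 1 => shift s m ∘ₗ C.i (s + m + 1)

/-- The kernel of the `m`-fold composite `i ∘ ⋯ ∘ i` from `D s` to `D (s-m)`, where the sequence is
continued by `D s = D 0` and `i = id` for `s < 0` (so that `E s = 0` there). -/
def kerIter : ∀ s, ℕ → Submodule R (C.D s)
  | _, 0 => ⊥
  | 0, _ + 1 => ⊥
  | s + 1, m + 1 => (kerIter s m).comap (C.i s)

theorem ker_shift (s : ℕ) : ∀ m, LinearMap.ker (C.shift s m) ≤ C.kerIter (s + m + 1) m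
  | 0 => by
    rw [shift, LinearMap.ker_id]
    exact bot_le
  | m + 1 => fun _ hx => ker_shift s m hx

/-- The cycles `Z_{m+1}` in `E s`, the elements `z` for which `κ z` lifts to `D (s+m+1)`. -/
def Z (m s : ℕ) : Submodule R (C.E s) := (LinearMap.range (C.shift s m)).comap (C.κ s)

/-- The boundaries `B_{m+1}` in `E s`, the image under `j` of the kernel of `D s → D (s-m)`. -/
def B (m s : ℕ) : Submodule R (C.E s) := (C.kerIter s m).map (C.j s)

/-- The page `E_{m+1}` in filtration `s`. -/
abbrev page (m s : ℕ) : Type v := C.Z m s ⧸ (C.B m s).submoduleOf (C.Z m s)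

/-- The map `D s → E_{m+1}` induced by `j`. -/
def jPage (m s : ℕ) : C.D s →ₗ[R] C.page m s :=
  ((C.B m s).submoduleOf (C.Z m s)).mkQ ∘ₗ LinearMap.codRestrict (C.Z m s) (C.j s) (fun y => by
    change C.κ s (C.j s y) ∈ LinearMap.range (C.shift s m)
    rw [(C.exact_j_κ s).apply_apply_eq_zero]
    exact zero_mem _)

theorem jPage_ker (m s : ℕ) :
    LinearMap.ker (C.shift s m) ≤ LinearMap.ker (C.jPage m (s + m + 1)) := fun y hy =>
  (Submodule.Quotient.mk_eq_zero _).2 ⟨y, C.ker_shift s m hy, rfl⟩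

/-- The map `z ↦ j y` where `y` in `D (s+m+1)` is a lift of `κ z`. -/
def dAux (m s : ℕ) : C.Z m s →ₗ[R] C.page m (s + m + 1) :=
  (LinearMap.ker (C.shift s m)).liftQ (C.jPage m (s + m + 1)) (C.jPage_ker m s) ∘ₗ
    (C.shift s m).quotKerEquivRange.symm.toLinearMap ∘ₗ
    LinearMap.codRestrict (LinearMap.range (C.shift s m)) (C.κ s ∘ₗ (C.Z m s).subtype)
      (fun z => z.2)

theorem dAux_apply (m s : ℕ) (z : C.Z m s) (y : C.D (s + m + 1))
    (h : C.shift s m y = C.κ s z) : C.dAux m s z = C.jPage m (s + m + 1) y := by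
  have h1 : LinearMap.codRestrict (LinearMap.range (C.shift s m)) (C.κ s ∘ₗ (C.Z m s).subtype)
      (fun z => z.2) z = (C.shift s m).quotKerEquivRange
        ((LinearMap.ker (C.shift s m)).mkQ y) := Subtype.ext h.symm
  rw [dAux, LinearMap.comp_apply, LinearMap.comp_apply, h1, LinearEquiv.coe_coe,
    LinearEquiv.symm_apply_apply]
  rfl

/-- The differential `d_{m+1}` on the page `E_{m+1}`, the class of `z` being mapped to the class of
`j y` where `y` in `D (s+m+1)` is a lift of `κ z`. -/
def d (m s : ℕ) : C.page m s →ₗ[R] C.page m (s + m + 1) :=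
  ((C.B m s).submoduleOf (C.Z m s)).liftQ (C.dAux m s) (by
    rintro z ⟨y, -, hy⟩
    have hy' : C.j s y = z := hy
    rw [LinearMap.mem_ker, C.dAux_apply m s z 0, map_zero]
    rw [map_zero, ← hy', (C.exact_j_κ s).apply_apply_eq_zero])

/-! ### Localization at an element `x` of the ground ring -/

variable (x : R)

/-- The localization `x⁻¹ A` of an `R`-module. -/
abbrev Loc (A : Type v) [AddCommGroup A] [Module R A] : Type v :=
  LocalizedModule (Submonoid.powers x) A

/-- The localization of a linear map. -/
def locMap {A A' : Type v} [AddCommGroup A] [Module R A] [AddCommGroup A'] [Module R A']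
    (f : A →ₗ[R] A') : Loc x A →ₗ[R] Loc x A' :=
  IsLocalizedModule.map (Submonoid.powers x) (LocalizedModule.mkLinearMap (Submonoid.powers x) A)
    (LocalizedModule.mkLinearMap (Submonoid.powers x) A') f

theorem locMap_mk {A A' : Type v} [AddCommGroup A] [Module R A] [AddCommGroup A'] [Module R A']
    (f : A →ₗ[R] A') (a : A) (c : Submonoid.powers x) :
    locMap x f (LocalizedModule.mk a c) = LocalizedModule.mk (f a) c := by
  rw [locMap, IsLocalizedModule.mk_eq_mk', IsLocalizedModule.map_mk',
    IsLocalizedModule.mk_eq_mk']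

/-- The localized differential on the localized page `x⁻¹ E_{m+1}`. -/
def locd (m s : ℕ) : Loc x (C.page m s) →ₗ[R] Loc x (C.page m (s + m + 1)) := locMap x (C.d m s)

/-- The localization of a submodule, as a submodule of the localized module. -/
def locSub {A : Type v} [AddCommGroup A] [Module R A] (N : Submodule R A) :
    Submodule R (Loc x A) :=
  N.localized₀ (Submonoid.powers x) (LocalizedModule.mkLinearMap (Submonoid.powers x) A)

/-- The permanent cycles of the localized spectral sequence, in `x⁻¹ E s`. -/
def locZInf (s : ℕ) : Submodule R (Loc x (C.E s)) := ⨅ m, locSub x (C.Z m s)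

/-- The boundaries of the localized spectral sequence, in `x⁻¹ E s`. -/
def locBInf (s : ℕ) : Submodule R (Loc x (C.E s)) := ⨆ m, locSub x (C.B m s)

/-- The page `E_∞` of the localized spectral sequence. -/
abbrev locEInf (s : ℕ) : Type v := C.locZInf x s ⧸ (C.locBInf x s).submoduleOf (C.locZInf x s)

/-- The filtration of `x⁻¹ D 0` by the images of the `x⁻¹ D s`. -/
def locF (s : ℕ) : Submodule R (Loc x (C.D 0)) := LinearMap.range (locMap x (C.toZero s))

/-- The associated graded of the filtration `locF`. -/
abbrev locGr (s : ℕ) : Type v := C.locF x s ⧸ (C.locF x (s + 1)).submoduleOf (C.locF x s)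

/-- The map `x⁻¹ D s → F s → F s / F (s+1)`. -/
def toLocGr (s : ℕ) : Loc x (C.D s) →ₗ[R] C.locGr x s :=
  ((C.locF x (s + 1)).submoduleOf (C.locF x s)).mkQ ∘ₗ (locMap x (C.toZero s)).rangeRestrict

theorem locMap_j_mem (s : ℕ) (y : Loc x (C.D s)) : locMap x (C.j s) y ∈ C.locZInf x s := by
  induction y using LocalizedModule.induction_on with
  | h a c =>
    rw [locMap_mk, locZInf, Submodule.mem_iInf]
    intro m
    refine ⟨C.j s a, ?_, c, (IsLocalizedModule.mk_eq_mk' c (C.j s a)).symm⟩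
    change C.κ s (C.j s a) ∈ LinearMap.range (C.shift s m)
    rw [(C.exact_j_κ s).apply_apply_eq_zero]
    exact zero_mem _

/-- The map `x⁻¹ D s → E_∞` induced by `j`. -/
def toLocEInf (s : ℕ) : Loc x (C.D s) →ₗ[R] C.locEInf x s :=
  ((C.locBInf x s).submoduleOf (C.locZInf x s)).mkQ ∘ₗ
    LinearMap.codRestrict (C.locZInf x s) (locMap x (C.j s)) (C.locMap_j_mem x s)

/-- The homogeneous elements of bidegree `(t, u)` of the localization `x⁻¹ A`, for an element `x` of
bidegree `(2, 12)`; `deg t u` are the homogeneous elements of `A`. -/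
def locDeg {A : Type v} [AddCommGroup A] [Module R A] (deg : ℕ → ℕ → Set A) (t u : ℤ) :
    Set (Loc x A) :=
  {y | ∃ (m t' u' : ℕ) (a : A), a ∈ deg t' u' ∧ (t' : ℤ) = t + 2 * m ∧ (u' : ℤ) = u + 12 * m ∧
    y = LocalizedModule.mk a ⟨x ^ m, Submonoid.pow_mem _ (Submonoid.mem_powers x) m⟩}

/-- The homogeneous elements of the page `E_{m+1}`, where `deg` are those of `E s`. -/
def pageDeg (m : ℕ) {s : ℕ} (deg : ℕ → ℕ → Set (C.E s)) (t u : ℕ) : Set (C.page m s) :=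
  {y | ∃ z : C.Z m s, (z : C.E s) ∈ deg t u ∧ ((C.B m s).submoduleOf (C.Z m s)).mkQ z = y}

/-- The homogeneous elements of `locEInf`, where `deg` are those of `E s`. -/
def locEInfDeg {s : ℕ} (deg : ℕ → ℕ → Set (C.E s)) (t u : ℤ) : Set (C.locEInf x s) :=
  {y | ∃ z : C.locZInf x s, (z : Loc x (C.E s)) ∈ locDeg x deg t u ∧
    ((C.locBInf x s).submoduleOf (C.locZInf x s)).mkQ z = y}

/-- The homogeneous elements of `locGr`, where `deg` are those of `D 0`. -/
def locGrDeg (s : ℕ) (deg : ℕ → ℕ → Set (C.D 0)) (n u : ℤ) : Set (C.locGr x s) :=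
  {y | ∃ z : C.locF x s, (z : Loc x (C.D 0)) ∈ locDeg x deg n u ∧
    ((C.locF x (s + 1)).submoduleOf (C.locF x s)).mkQ z = y}

/-- The localized spectral sequence, whose pages are the localizations `x⁻¹ E_r`, converges to
`x⁻¹ D 0`, in the strongest sense: the filtration of `x⁻¹ D 0` is exhaustive and finite in each
degree; in each degree, only finitely many of the localized differentials are nonzero; and the
map `[toZero y] ↦ [j y]` is an isomorphism, compatible with the gradings, from the associated graded
of `x⁻¹ D 0` to the `E_∞` page of the localized spectral sequence.
Here `degE s` and `degD` are the homogeneous elements of `E s` and `D 0`, and an element of degree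
`(s, t, u)` in the spectral sequence contributes to degree `(s + t, u)` of `x⁻¹ D 0`. -/
structure LocConverges (degE : ∀ s, ℕ → ℕ → Set (C.E s)) (degD : ℕ → ℕ → Set (C.D 0)) :
    Prop where
  exhaustive : C.locF x 0 = ⊤
  finite : ∀ n u : ℤ, ∃ s₀, ∀ s ≥ s₀, ∀ y ∈ C.locF x s, y ∈ locDeg x degD n u → y = 0
  stabilizes : ∀ (s : ℕ) (t u : ℤ), ∃ m₀, ∀ m ≥ m₀, ∀ y ∈ locDeg x (C.pageDeg m (degE s)) t u,
    C.locd x m s y = 0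
  abutment : ∀ s, ∃ φ : C.locGr x s ≃ₗ[R] C.locEInf x s,
    (∀ y : Loc x (C.D s), φ (C.toLocGr x s y) = C.toLocEInf x s y) ∧
    ∀ t u : ℤ, φ '' C.locGrDeg x s degD (s + t) u = C.locEInfDeg x (degE s) t u

end ExactCouple
end SpectralSequence

section Resolution

universe v

variable {k Γ D : Type} [Field k] [CommRing Γ] [Bialgebra k Γ] [CommRing D] [Bialgebra k D]

/-- The map of comodules `N → B ⊗ N`, `n ↦ 1 ⊗ n`. -/
def unitHom (q : Γ →ₐc[k] D) (N : Comod.{v} k Γ) :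
    Comod.Hom (BialgHom.id k Γ) N ((comodB q).tensor N) where
  lin := (TensorProduct.mk k (cotensor q) N.carrier ⟨1, one_mem_cotensor q⟩ :
    N.carrier →ₗ[k] cotensor q ⊗[k] N.carrier)
  comm n := by
    change _ = diagMul k Γ (cotensor q) N.carrier
      (TensorProduct.map (cotensorCoact q) N.coact (⟨1, one_mem_cotensor q⟩ ⊗ₜ n))
    rw [TensorProduct.map_tmul, cotensorCoact_one]
    generalize N.coact n = z
    induction z with
    | zero =>
      simp only [TensorProduct.tmul_zero, map_zero]
      rfl
    | add u u' hu hu' =>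
      simp only [TensorProduct.tmul_add, map_add, hu, hu']
      rfl
    | tmul a n =>
      rw [diagMul_tmul, one_mul]
      rfl

/-- The map of comodules `B ⊗ N → (B / k) ⊗ N`. -/
def projHom (q : Γ →ₐc[k] D) (N : Comod.{v} k Γ) :
    Comod.Hom (BialgHom.id k Γ) ((comodB q).tensor N) ((comodBbar q).tensor N) where
  lin := ((unitLine q).mkQ.rTensor N.carrier :
    cotensor q ⊗[k] N.carrier →ₗ[k] (cotensor q ⧸ unitLine q) ⊗[k] N.carrier)
  comm m := by
    have key : ∀ (u : Γ ⊗[k] cotensor q) (v : Γ ⊗[k] N.carrier),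
        TensorProduct.map (BialgHom.id k Γ : Γ →ₗ[k] Γ) ((unitLine q).mkQ.rTensor N.carrier)
          (diagMul k Γ (cotensor q) N.carrier (u ⊗ₜ v)) =
        diagMul k Γ _ N.carrier ((unitLine q).mkQ.lTensor Γ u ⊗ₜ v) := by
      intro u v
      induction u with
      | zero => simp
      | add u u' hu hu' => simp only [TensorProduct.add_tmul, map_add, hu, hu']
      | tmul a x =>
        induction v with
        | zero => simp
        | add u u' hu hu' => simp only [TensorProduct.tmul_add, map_add, hu, hu']
        | tmul b n =>
          rw [diagMul_tmul, LinearMap.lTensor_tmul, diagMul_tmul]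
          rfl
    change TensorProduct.map _ _ (diagMul k Γ (cotensor q) N.carrier
      (TensorProduct.map (cotensorCoact q) N.coact m)) =
      diagMul k Γ (cotensor q ⧸ unitLine q) N.carrier
        (TensorProduct.map (barCoact q) N.coact ((unitLine q).mkQ.rTensor N.carrier m))
    change (cotensor q) ⊗[k] N.carrier at m
    induction m with
    | zero => simp
    | add u u' hu hu' => simp only [map_add, hu, hu']
    | tmul b n =>
      rw [TensorProduct.map_tmul, key, LinearMap.rTensor_tmul, TensorProduct.map_tmul, barCoact_mk]

theorem map_cotensor (q : Γ →ₐc[k] D) (b : cotensor q) :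
    q (b : Γ) = algebraMap k D (Coalgebra.counit (R := k) (b : Γ)) := by
  have h := congrArg (fun z => TensorProduct.lid k D
    ((Coalgebra.counit (R := k) (A := Γ)).rTensor D z)) ((mem_cotensor q b).1 b.2)
  have h1 : ∀ z : Γ ⊗[k] Γ, TensorProduct.lid k D
      ((Coalgebra.counit (R := k) (A := Γ)).rTensor D ((q : Γ →ₗ[k] D).lTensor Γ z)) =
      q (TensorProduct.lid k Γ ((Coalgebra.counit (R := k) (A := Γ)).rTensor Γ z)) := by
    intro z
    induction z with
    | zero => simp
    | add u u' hu hu' => simp only [map_add, hu, hu']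
    | tmul a b => simp
  simp only [h1, Coalgebra.rTensor_counit_comul, LinearMap.rTensor_tmul, TensorProduct.lid_tmul,
    one_smul] at h
  rw [h, Algebra.algebraMap_eq_smul_one]

/-- The map `B ⊗ N → N`, `b ⊗ n ↦ ε(b) n`, which is compatible with the coactions along `q`. -/
def counitHom (q : Γ →ₐc[k] D) (N : Comod.{v} k Γ) :
    Comod.Hom q ((comodB q).tensor N) (N.corestrict q) where
  lin := ((TensorProduct.lid k N.carrier).toLinearMap ∘ₗ
    ((Coalgebra.counit (R := k) (A := Γ)) ∘ₗ (cotensor q).subtype).rTensor N.carrier :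
      cotensor q ⊗[k] N.carrier →ₗ[k] N.carrier)
  comm m := by
    have key : ∀ (u : Γ ⊗[k] cotensor q) (v : Γ ⊗[k] N.carrier),
        TensorProduct.map (q : Γ →ₗ[k] D) ((TensorProduct.lid k N.carrier).toLinearMap ∘ₗ
          ((Coalgebra.counit (R := k) (A := Γ)) ∘ₗ (cotensor q).subtype).rTensor N.carrier)
          (diagMul k Γ (cotensor q) N.carrier (u ⊗ₜ v)) =
        (LinearMap.mul k D (q (TensorProduct.rid k Γ ((Coalgebra.counit (R := k) (A := Γ)).lTensor Γ
          ((cotensor q).subtype.lTensor Γ u))))).rTensor N.carrier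
          ((q : Γ →ₗ[k] D).rTensor N.carrier v) := by
      intro u v
      induction u with
      | zero => simp
      | add u u' hu hu' =>
        simp only [TensorProduct.add_tmul, map_add, hu, hu',
          LinearMap.rTensor_add, LinearMap.add_apply]
      | tmul a x =>
        induction v with
        | zero => simp
        | add u u' hu hu' => simp only [TensorProduct.tmul_add, map_add, hu, hu']
        | tmul b n =>
          rw [diagMul_tmul]
          simp [TensorProduct.tmul_smul, TensorProduct.smul_tmul']
    change TensorProduct.map _ _ (diagMul k Γ (cotensor q) N.carrier
      (TensorProduct.map (cotensorCoact q) N.coact m)) =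
      (q : Γ →ₗ[k] D).rTensor N.carrier (N.coact (((TensorProduct.lid k N.carrier).toLinearMap ∘ₗ
    ((Coalgebra.counit (R := k) (A := Γ)) ∘ₗ (cotensor q).subtype).rTensor N.carrier) m))
    change (cotensor q) ⊗[k] N.carrier at m
    induction m with
    | zero => simp
    | add u u' hu hu' => simp only [map_add, hu, hu']
    | tmul b n =>
      rw [TensorProduct.map_tmul, key, cotensorCoact_spec, Coalgebra.lTensor_counit_comul,
        TensorProduct.rid_tmul, one_smul, map_cotensor]
      simp only [LinearMap.comp_apply, LinearMap.rTensor_tmul, LinearEquiv.coe_coe,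
        TensorProduct.lid_tmul, map_smul, Submodule.subtype_apply]
      generalize N.coact n = z
      induction z with
      | zero => simp
      | add u u' hu hu' => simp only [map_add, smul_add, hu, hu']
      | tmul a n => simp [TensorProduct.smul_tmul', Algebra.smul_def]

theorem unitHom_injective (q : Γ →ₐc[k] D) (N : Comod.{v} k Γ) :
    Function.Injective (unitHom q N).lin := by
  have h : (counitHom q N).lin ∘ₗ (unitHom q N).lin = LinearMap.id := by
    ext n
    change Coalgebra.counit (R := k) (1 : Γ) • n = n
    rw [Bialgebra.counit_one, one_smul]
  exact Function.LeftInverse.injective (g := (counitHom q N).lin) (fun n => LinearMap.congr_fun h n)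

theorem projHom_surjective (q : Γ →ₐc[k] D) (N : Comod.{v} k Γ) :
    Function.Surjective (projHom q N).lin :=
  LinearMap.rTensor_surjective N.carrier (unitLine q).mkQ_surjective

theorem rTensor_mkQ_exact {A N : Type*} [AddCommGroup A] [Module k A] [AddCommGroup N] [Module k N]
    (U : Submodule k A) : Function.Exact (U.subtype.rTensor N) (U.mkQ.rTensor N) :=
  rTensor_exact N (LinearMap.exact_subtype_mkQ U) U.mkQ_surjective

theorem unitHom_projHom_exact (q : Γ →ₐc[k] D) (N : Comod.{v} k Γ) :
    Function.Exact (unitHom q N).lin (projHom q N).lin := by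
  have h2 := rTensor_mkQ_exact (N := N.carrier) (unitLine q)
  intro y
  refine (h2 y).trans ⟨?_, ?_⟩
  · rintro ⟨x, rfl⟩
    induction x with
    | zero => exact ⟨0, (map_zero (unitHom q N).lin).trans (map_zero _).symm⟩
    | add u u' hu hu' =>
      obtain ⟨v, hv⟩ := hu
      obtain ⟨v', hv'⟩ := hu'
      exact ⟨v + v', by rw [map_add, map_add, hv, hv']; rfl⟩
    | tmul a n =>
      obtain ⟨a, ha⟩ := a
      obtain ⟨c, rfl⟩ := Submodule.mem_span_singleton.1 ha
      refine ⟨c • n, ?_⟩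
      exact (TensorProduct.smul_tmul c (⟨1, one_mem_cotensor q⟩ : cotensor q) n).symm
  · rintro ⟨n, rfl⟩
    exact ⟨⟨_, Submodule.mem_span_singleton_self _⟩ ⊗ₜ n, rfl⟩

/-- The comodules `(B / k)^{⊗ s} ⊗ M`. -/
def barPow (q : Γ →ₐc[k] D) (M : Comod.{v} k Γ) : ℕ → Comod.{v} k Γ
  | 0 => M
  | s + 1 => (comodBbar q).tensor (barPow q M s)

/-- `Ext_Γ(k, N)`, the cohomology of the cobar complex, as a module over `k[X]`, where `X` acts as
multiplication by the class of `[ξ|ξ²] + [ξ²|ξ]`. -/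
abbrev ExtMod (ξ : Prim k Γ) (N : Comod.{v} k Γ) : Type v := Coh (Cobar.d ξ N)

/-- The map `Ext_Γ(k, N) → Ext_D(k, N')` induced by a map `N → N'` along `φ : Γ → D`. -/
def ExtMod.map {φ : Γ →ₐc[k] D} (ξ : Prim k Γ) (ζ : Prim k D) (h : φ ξ.val = ζ.val)
    {N : Comod.{v} k Γ} {N' : Comod.{v} k D} (f : Comod.Hom φ N N') :
    ExtMod ξ N →ₗ[k[X]] Coh (Cobar.d ζ N') :=
  Coh.map (Cobar.map ξ ζ h f) (Cobar.map_d ξ ζ h f)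

/-- The exact couple of the `B`-based Adams spectral sequence of `M`. It is obtained from the short
exact sequences `0 → N_s → B ⊗ N_s → N_{s+1} → 0` with `N_s = (B / k)^{⊗ s} ⊗ M`, so that
`D s = Ext_Γ(k, N_s)` and `E s = Ext_Γ(k, B ⊗ N_s)`. -/
def adamsCouple (q : Γ →ₐc[k] D) (ξ : Prim k Γ) (M : Comod.{v} k Γ) : ExactCouple.{v} k[X] where
  D s := ExtMod ξ (barPow q M s)
  E s := ExtMod ξ ((comodB q).tensor (barPow q M s))
  i s := Coh.conn (Cobar.mapId ξ (unitHom q (barPow q M s)))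
    (Cobar.mapId ξ (projHom q (barPow q M s)))
    (Cobar.mapId_d ξ _) (Cobar.mapId_d ξ _)
    (Cobar.mapId_injective ξ _ (unitHom_injective q _))
    (Cobar.mapId_exact ξ _ _ (unitHom_projHom_exact q _))
    (Cobar.d_d ξ _)
    (Cobar.mapId_surjective ξ _ (projHom_surjective q _))
  j s := ExtMod.map ξ ξ rfl (unitHom q (barPow q M s))
  κ s := ExtMod.map ξ ξ rfl (projHom q (barPow q M s))
  exact_i_j _ := Coh.exact_conn_map _ _ _ _ _ _ _ _
  exact_j_κ _ := Coh.exact_map_map _ _ _ _ (Cobar.mapId_surjective ξ _ (projHom_surjective q _))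
    (Cobar.mapId_injective ξ _ (unitHom_injective q _))
    (Cobar.mapId_exact ξ _ _ (unitHom_projHom_exact q _)) (Cobar.d_d ξ _)
  exact_κ_i _ := Coh.exact_map_conn _ _ _ _ _ _ _ _

/-- The change-of-rings map `E_1 = Ext_Γ(k, B ⊗ N_s) → Ext_D(k, N_s)` for `N_s = (B/k)^{⊗ s} ⊗ M`,
induced by `q : Γ → D` and `ε : B → k`. -/
def changeOfRings (q : Γ →ₐc[k] D) (ξ : Prim k Γ) (M : Comod.{v} k Γ) (s : ℕ) :
    (adamsCouple q ξ M).E s →ₗ[k[X]] ExtMod (ξ.map q) ((barPow q M s).corestrict q) :=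
  ExtMod.map ξ (ξ.map q) rfl (counitHom q (barPow q M s))

end Resolution

section Degrees

universe v

variable {k Γ D : Type} [Field k] [CommRing Γ] [Bialgebra k Γ] [CommRing D] [Bialgebra k D]

/-- The homogeneous part of degree `u` of a tensor product of graded vector spaces. -/
def tensorDeg {A A' : Type*} [AddCommGroup A] [Module k A] [AddCommGroup A'] [Module k A']
    (𝒜 : ℕ → Submodule k A) (𝒜' : ℕ → Submodule k A') (u : ℕ) : Submodule k (A ⊗[k] A') :=
  ⨆ p ∈ Finset.HasAntidiagonal.antidiagonal u,
    Submodule.map₂ (TensorProduct.mk k A A') (𝒜 p.1) (𝒜' p.2)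

/-- The grading of `B` by internal degree, where `𝒢` is the grading of `Γ`. -/
def bDeg (q : Γ →ₐc[k] D) (𝒢 : ℕ → Submodule k Γ) (u : ℕ) : Submodule k (cotensor q) :=
  (𝒢 u).comap (cotensor q).subtype

/-- The grading of `B / k` by internal degree. -/
def bbarDeg (q : Γ →ₐc[k] D) (𝒢 : ℕ → Submodule k Γ) (u : ℕ) :
    Submodule k (cotensor q ⧸ unitLine q) :=
  (bDeg q 𝒢 u).map (unitLine q).mkQ

/-- The grading of `(B / k)^{⊗ s} ⊗ M` by internal degree. -/
def barPowDeg (q : Γ →ₐc[k] D) (𝒢 : ℕ → Submodule k Γ) (M : Comod.{v} k Γ)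
    (ℳ : ℕ → Submodule k M.carrier) : ∀ s, ℕ → Submodule k (barPow q M s).carrier
  | 0 => ℳ
  | s + 1 => tensorDeg (bbarDeg q 𝒢) (barPowDeg q 𝒢 M ℳ s)

/-- The grading of the cobar cochains of degree `t` by internal degree. -/
def cobarDeg (𝒢 : ℕ → Submodule k Γ) (N : Comod.{v} k Γ) (𝒩 : ℕ → Submodule k N.carrier) :
    ∀ t, ℕ → Submodule k (cobarStage N t).V
  | 0 => 𝒩
  | t + 1 => tensorDeg 𝒢 (cobarDeg 𝒢 N 𝒩 t)

/-- The homogeneous elements of `Ext_Γ^{t,u}(k, N)`, where `t` is the homological degree and `u` is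
the internal degree. -/
def extDeg (ξ : Prim k Γ) (𝒢 : ℕ → Submodule k Γ) (N : Comod.{v} k Γ)
    (𝒩 : ℕ → Submodule k N.carrier) (t u : ℕ) : Set (ExtMod ξ N) :=
  {y | ∃ z : LinearMap.ker (Cobar.d ξ N), (∃ x ∈ cobarDeg 𝒢 N 𝒩 t u, Cobar.of ξ N t x = z) ∧
    Coh.mk (Cobar.d ξ N) z = y}

/-- The homogeneous elements of degree `(s, t, u)` of the `E_1` page of the `B`-based Adams spectral
sequence. -/
def adamsDegE (q : Γ →ₐc[k] D) (ξ : Prim k Γ) (𝒢 : ℕ → Submodule k Γ) (M : Comod.{v} k Γ)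
    (ℳ : ℕ → Submodule k M.carrier) (s : ℕ) : ℕ → ℕ → Set ((adamsCouple q ξ M).E s) :=
  extDeg ξ 𝒢 ((comodB q).tensor (barPow q M s)) (tensorDeg (bDeg q 𝒢) (barPowDeg q 𝒢 M ℳ s))

/-- The homogeneous elements of `Ext_Γ(k, M)`. -/
def adamsDegD (q : Γ →ₐc[k] D) (ξ : Prim k Γ) (𝒢 : ℕ → Submodule k Γ) (M : Comod.{v} k Γ)
    (ℳ : ℕ → Submodule k M.carrier) : ℕ → ℕ → Set ((adamsCouple q ξ M).D 0) :=
  extDeg ξ 𝒢 M ℳ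

end Degrees

namespace RedPow

theorem xi_one_primitive : Coalgebra.comul (R := ZMod 3) (xi 1) =
    xi 1 ⊗ₜ[ZMod 3] 1 + 1 ⊗ₜ[ZMod 3] xi 1 := by
  change comulHom (xi 1) = _
  rw [comulHom_xi]
  have h : xi 0 = 1 := rfl
  simp only [zero_add, Finset.Nat.antidiagonal_succ, Finset.Nat.antidiagonal_zero,
    Finset.map_singleton, Finset.sum_cons, Finset.sum_singleton, Function.Embedding.prodMap,
    Function.Embedding.coeFn_mk, Prod.map, Function.Embedding.refl_apply, Nat.succ_eq_add_one, h,
    pow_zero, pow_one, one_pow]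
  exact add_comm _ _

variable {Γ : Type} [CommRing Γ] [Bialgebra (ZMod 3) Γ]

/-- The image of `ξ₁` in a quotient of `P`, a primitive element. -/
def xiOne (π : RedPow →ₐc[ZMod 3] Γ) : Prim (ZMod 3) Γ :=
  Prim.map π ⟨xi 1, xi_one_primitive⟩

/-- The homogeneous part of internal degree `u` of a quotient of `P`. -/
def quotDeg (π : RedPow →ₐc[ZMod 3] Γ) (u : ℕ) : Submodule (ZMod 3) Γ :=
  (homog u).map (π : RedPow →ₗ[ZMod 3] Γ)

end RedPow

end LocExt

end

open LocExt

/-!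
The theorem rests on two facts about the comodules `N_s = (B / k)^{⊗ s} ⊗ M`: change of rings, which
identifies `Ext_Γ(k, B ⊗ N_s)` with `Ext_D(k, N_s)`, and a vanishing line for the latter. Both hold
before localization, and everything about the localized spectral sequence follows from them.

*Change of rings* (`coh_counitHom`). In degree `0` the shear `b ⊗ n ↦ b n' ⊗ n''` identifies the
invariants of `B ⊗ N` with the `D`-invariants of `N`. Higher degrees follow by dimension shifting
along `0 → N → Γ ⊗ N → Γ/k ⊗ N → 0`: the comodule `B ⊗ Γ ⊗ N` is relatively injective over `Γ`
(`relInj_tensor_cofree`), and `Γ ⊗ N` is so over `D` (`relInj_corestrict`), because the linear map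
`D → Γ` with `x ^ i ↦ ξ₁ ^ i` for `i < 3` is unital and colinear over `D`. Relatively injective
comodules are acyclic (`RelInj.exists_cobarD`).

*The vanishing line* (`TruncD.mem_cobarBd`). Over `D = 𝔽₃[x]/(x³)` every comodule `N` has the
periodic resolution `0 → N → D ⊗ N → D ⊗ N → N → 0`, with maps `1 ⊗ -`, `d/dx` and the coefficient
of `x²`, of total degree `12` over two homological steps. If `N` is concentrated in degrees at least
`c`, then `Ext_D^{t,u}(k, N)` is zero for `u < c + 6 t - 2`. In degrees below `12` the algebra `P`
is spanned by `1`, `ξ₁`, `ξ₁²`, and no nonzero multiple of `ξ₁` or `ξ₁²` lies in `B`, so that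
`B / k` starts in degree `12` (`bbarProj_eq_zero`) and `N_s` in degree `12 s`. This gives the
vanishing plane.

*Convergence* (`ExactCouple.IsGradedVanishing.locConverges`). By induction on `t` along the exact
sequences `Ext^{t-1}(k, N_{s+1}) → Ext^t(k, N_s) → Ext^t(k, B ⊗ N_s)` also `Ext_Γ^{t,u}(k, N_s)` is
zero for `u < 12 s + 6 t - 2` (`adamsProjD_eq_zero`). The connecting homomorphisms lower `s` by one
and raise `t` by one, which changes `12 s + 6 t` by `-6`; hence a class of fixed degree which lifts
through sufficiently many of them is zero. The class `b₁₀` has degree `(2, 12)`, parallel to the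
vanishing line, so that the same bounds hold for the numerators of fractions, whatever the
denominators. The rest is the usual analysis of the spectral sequence of an exact couple.
-/

noncomputable section

namespace LocExt

/-! ### Gradings and localized modules -/

/-- The operators `p i` are the projections to the homogeneous components of a grading. Gradings are
encoded by their projections rather than by submodules, since projections pass to tensor products,
to subquotients and to cohomology as operators, and a map is graded if it commutes with them. -/
structure IsGrading {ι V : Type*} [DecidableEq ι] [AddCommGroup V] (p : ι → V → V) : Prop where
  proj : ∀ i j x, p i (p j x) = if i = j then p j x else 0
  total : ∀ x, ∃ s : Finset ι, ∀ t, s ⊆ t → ∑ i ∈ t, p i x = x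

namespace IsGrading

variable {ι V : Type*} [DecidableEq ι] [AddCommGroup V] {p : ι → V → V}

theorem idem (h : IsGrading p) (i : ι) (x : V) : p i (p i x) = p i x := by
  rw [h.proj, if_pos rfl]

end IsGrading

namespace ExactCouple

variable {R : Type} [CommRing R] (x : R)

section Loc

universe v

variable {A A' A'' : Type v} [AddCommGroup A] [Module R A] [AddCommGroup A'] [Module R A']
  [AddCommGroup A''] [Module R A'']

/-- The power `x ^ m` as an admissible denominator. -/
def den (m : ℕ) : Submonoid.powers x := ⟨x ^ m, Submonoid.pow_mem _ (Submonoid.mem_powers x) m⟩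

theorem exists_mk_den (y : Loc x A) : ∃ (a : A) (m : ℕ), y = LocalizedModule.mk a (den x m) := by
  induction y using LocalizedModule.induction_on with
  | h a c =>
    obtain ⟨_, m, rfl⟩ := c
    exact ⟨a, m, rfl⟩

theorem mk_den_eq {a a' : A} {m m' : ℕ} :
    (LocalizedModule.mk a (den x m) : Loc x A) = LocalizedModule.mk a' (den x m') ↔
      ∃ r, x ^ (r + m') • a = x ^ (r + m) • a' := by
  rw [LocalizedModule.mk_eq]
  constructor
  · rintro ⟨⟨_, r, rfl⟩, h⟩
    refine ⟨r, ?_⟩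
    rw [pow_add, pow_add, mul_smul, mul_smul]
    exact h
  · rintro ⟨r, h⟩
    refine ⟨den x r, ?_⟩
    rw [pow_add, pow_add, mul_smul, mul_smul] at h
    exact h

theorem mk_den_eq_zero {a : A} {m : ℕ} :
    (LocalizedModule.mk a (den x m) : Loc x A) = 0 ↔ ∃ r, x ^ r • a = 0 := by
  rw [← LocalizedModule.zero_mk (den x 0), mk_den_eq]
  simp

theorem mk_den_add {a : A} {m : ℕ} (r : ℕ) :
    (LocalizedModule.mk a (den x m) : Loc x A) = LocalizedModule.mk (x ^ r • a) (den x (r + m)) :=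
  (mk_den_eq x).2 ⟨0, by rw [smul_smul, ← pow_add]; congr 2; omega⟩

theorem locMap_bijective {f : A →ₗ[R] A'} (hf : Function.Bijective f) :
    Function.Bijective (locMap x f) :=
  ⟨IsLocalizedModule.map_injective _ _ _ f hf.1, IsLocalizedModule.map_surjective _ _ _ f hf.2⟩

theorem locMap_exact {f : A →ₗ[R] A'} {g : A' →ₗ[R] A''} (h : Function.Exact f g) :
    Function.Exact (locMap x f) (locMap x g) :=
  IsLocalizedModule.map_exact _ _ _ _ f g h

theorem locMap_comp (f : A →ₗ[R] A') (g : A' →ₗ[R] A'') (y : Loc x A) :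
    locMap x (g ∘ₗ f) y = locMap x g (locMap x f y) := by
  obtain ⟨a, m, rfl⟩ := exists_mk_den x y
  simp only [locMap_mk, LinearMap.comp_apply]

theorem mem_locSub {N : Submodule R A} {a : A} {m : ℕ} :
    (LocalizedModule.mk a (den x m) : Loc x A) ∈ locSub x N ↔ ∃ r, x ^ r • a ∈ N := by
  constructor
  · rintro ⟨z, hz, ⟨_, l, rfl⟩, h⟩
    have h' : (LocalizedModule.mk z (den x l) : Loc x A) = LocalizedModule.mk a (den x m) := by
      rw [← h]
      exact IsLocalizedModule.mk_eq_mk' _ _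
    obtain ⟨r, hr⟩ := (mk_den_eq x).1 h'
    exact ⟨r + l, hr ▸ N.smul_mem _ hz⟩
  · rintro ⟨r, hr⟩
    rw [mk_den_add x r]
    exact ⟨_, hr, den x (r + m), (IsLocalizedModule.mk_eq_mk' _ _).symm⟩

theorem locMap_image_locDeg {f : A →ₗ[R] A'} {deg : ℕ → ℕ → Set A} {deg' : ℕ → ℕ → Set A'}
    (h : ∀ t u, f '' deg t u = deg' t u) (t u : ℤ) :
    locMap x f '' locDeg x deg t u = locDeg x deg' t u := by
  ext y
  constructor
  · rintro ⟨_, ⟨m, t', u', a, ha, h1, h2, rfl⟩, rfl⟩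
    exact ⟨m, t', u', f a, (h t' u').subset ⟨a, ha, rfl⟩, h1, h2, locMap_mk x f _ _⟩
  · rintro ⟨m, t', u', a, ha, h1, h2, rfl⟩
    obtain ⟨a, ha', rfl⟩ := (h t' u').superset ha
    exact ⟨LocalizedModule.mk a (den x m), ⟨m, t', u', a, ha', h1, h2, rfl⟩, locMap_mk x f _ _⟩

/-- The projections `p` form a grading of `A` by pairs of integers, for which `x` has degree
`(2, 12)`. -/
structure IsBigrading (p : ℤ × ℤ → A →+ A) : Prop extends IsGrading fun d => ⇑(p d) where
  smul : ∀ t u a, x • p (t, u) a = p (t + 2, u + 12) (x • a)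

/-- The homogeneous elements of bidegree `(t, u)`. -/
def homDeg (p : ℤ × ℤ → A →+ A) (t u : ℕ) : Set A := {a | p (t, u) a = a}

variable {x} {p : ℤ × ℤ → A →+ A}

theorem IsBigrading.pow_smul (h : IsBigrading x p) (m : ℕ) (t u : ℤ) (a : A) :
    x ^ m • p (t, u) a = p (t + 2 * m, u + 12 * m) (x ^ m • a) := by
  induction m with
  | zero => simp
  | succ m ih =>
    rw [pow_succ', mul_smul, ih, h.smul, mul_smul]
    congr 3 <;> (push_cast; ring)

theorem IsBigrading.mem_locDeg (h : IsBigrading x p) {t u : ℤ} {y : Loc x A} :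
    y ∈ locDeg x (homDeg p) t u ↔ ∃ (m : ℕ) (a : A), p (t + 2 * m, u + 12 * m) a = a ∧
      y = LocalizedModule.mk a (den x m) := by
  constructor
  · rintro ⟨m, t', u', a, ha, h1, h2, rfl⟩
    refine ⟨m, a, ?_, rfl⟩
    rw [← h1, ← h2]
    exact ha
  · rintro ⟨m, a, ha, rfl⟩
    -- enlarging the denominator makes both degrees nonnegative
    obtain ⟨r, hr1, hr2⟩ : ∃ r : ℕ, 0 ≤ t + 2 * m + 2 * r ∧ 0 ≤ u + 12 * m + 12 * r :=
      ⟨(t + 2 * m).natAbs + (u + 12 * m).natAbs, by omega, by omega⟩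
    refine ⟨r + m, (t + 2 * m + 2 * r).toNat, (u + 12 * m + 12 * r).toNat, x ^ r • a, ?_, ?_, ?_,
      mk_den_add x r⟩
    · change p (_, _) _ = _
      rw [Int.toNat_of_nonneg hr1, Int.toNat_of_nonneg hr2, ← h.pow_smul, ha]
    · rw [Int.toNat_of_nonneg hr1]; push_cast; ring
    · rw [Int.toNat_of_nonneg hr2]; push_cast; ring

/-- A homogeneous element in the image of a homogeneous map has a homogeneous preimage. -/
theorem IsBigrading.exists_mem_locDeg {p' : ℤ × ℤ → A' →+ A'} (h : IsBigrading x p)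
    (h' : IsBigrading x p') {f : A →ₗ[R] A'} {n : ℤ}
    (hf : ∀ t u a, f (p (t, u) a) = p' (t + n, u) (f a)) {t u : ℤ} {y : Loc x A}
    (hy : locMap x f y ∈ locDeg x (homDeg p') (t + n) u) :
    ∃ z ∈ locDeg x (homDeg p) t u, locMap x f z = locMap x f y := by
  obtain ⟨m, b, hb, hyb⟩ := h'.mem_locDeg.1 hy
  obtain ⟨a, l, rfl⟩ := exists_mk_den x y
  rw [locMap_mk] at hyb ⊢
  obtain ⟨r, hr⟩ := (mk_den_eq x).1 hyb
  refine ⟨LocalizedModule.mk (p (t + 2 * ↑(r + l + m), u + 12 * ↑(r + l + m)) (x ^ (r + m) • a))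
    (den x (r + l + m)), h.mem_locDeg.2 ⟨_, _, h.idem _ _, rfl⟩, ?_⟩
  have h1 : f (p (t + 2 * ↑(r + l + m), u + 12 * ↑(r + l + m)) (x ^ (r + m) • a)) =
      x ^ (r + l) • b := by
    rw [hf, map_smul, hr]
    conv_rhs => rw [← hb]
    rw [h'.pow_smul]
    congr 3 <;> (push_cast; ring)
  rw [locMap_mk, h1, hyb, ← mk_den_add x (r + l)]

theorem IsBigrading.locMap_mem_locDeg {p' : ℤ × ℤ → A' →+ A'} (h : IsBigrading x p)
    (h' : IsBigrading x p') {f : A →ₗ[R] A'} {n : ℤ}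
    (hf : ∀ t u a, f (p (t, u) a) = p' (t + n, u) (f a)) {t u : ℤ} {y : Loc x A}
    (hy : y ∈ locDeg x (homDeg p) t u) : locMap x f y ∈ locDeg x (homDeg p') (t + n) u := by
  obtain ⟨m, a, ha, rfl⟩ := h.mem_locDeg.1 hy
  refine h'.mem_locDeg.2 ⟨m, f a, ?_, locMap_mk x f _ _⟩
  conv_rhs => rw [← ha, hf]
  congr 3
  ring

end Loc

/-! ### The localized spectral sequence of an exact couple -/

universe v

variable {x} (C : ExactCouple.{v} R)

theorem kerIter_le_ker_toZero : ∀ s m, C.kerIter s m ≤ LinearMap.ker (C.toZero s)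
  | s, 0 => by cases s <;> exact bot_le
  | 0, _ + 1 => bot_le
  | s + 1, m + 1 => fun _ hy => kerIter_le_ker_toZero s m hy

theorem ker_toZero_le_kerIter : ∀ s, LinearMap.ker (C.toZero s) ≤ C.kerIter s s
  | 0 => fun _ hy => hy
  | s + 1 => fun _ hy => ker_toZero_le_kerIter s hy

/-- The boundaries of the localized spectral sequence are the images under `j` of the elements of
`D s` which become zero in `D 0`. -/
theorem mem_locBInf {s : ℕ} {z : Loc x (C.E s)} : z ∈ C.locBInf x s ↔
    ∃ y, locMap x (C.toZero s) y = 0 ∧ locMap x (C.j s) y = z := by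
  constructor
  · intro hz
    have hle : C.locBInf x s ≤
        (LinearMap.ker (locMap x (C.toZero s))).map (locMap x (C.j s)) := by
      refine iSup_le fun m z hz => ?_
      obtain ⟨e, l, rfl⟩ := exists_mk_den x z
      obtain ⟨r, y, hy, hr⟩ := (mem_locSub x).1 hz
      refine ⟨LocalizedModule.mk y (den x (r + l)), ?_, ?_⟩
      · change locMap x (C.toZero s) _ = 0
        rw [locMap_mk, show C.toZero s y = 0 from C.kerIter_le_ker_toZero s m hy,
          LocalizedModule.zero_mk]
      · rw [locMap_mk, hr, ← mk_den_add]
    obtain ⟨y, hy, rfl⟩ := hle hz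
    exact ⟨y, hy, rfl⟩
  · rintro ⟨y, hy, rfl⟩
    obtain ⟨a, l, rfl⟩ := exists_mk_den x y
    rw [locMap_mk] at hy ⊢
    obtain ⟨r, hr⟩ := (mk_den_eq_zero x).1 hy
    refine Submodule.mem_iSup_of_mem s ((mem_locSub x).2 ⟨r, x ^ r • a, ?_, map_smul _ _ _⟩)
    exact C.ker_toZero_le_kerIter s (by rw [LinearMap.mem_ker, map_smul, hr])

/-- An element of `D s` maps into the next filtration step of `D 0` exactly if its image under `j`
is a boundary. -/
theorem toLocGr_eq_zero_iff (s : ℕ) (y : Loc x (C.D s)) :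
    C.toLocGr x s y = 0 ↔ C.toLocEInf x s y = 0 := by
  have h1 : C.toLocGr x s y = 0 ↔ locMap x (C.toZero s) y ∈ C.locF x (s + 1) := by
    exact Submodule.Quotient.mk_eq_zero (p := (C.locF x (s + 1)).submoduleOf (C.locF x s))
      (x := ⟨locMap x (C.toZero s) y, y, rfl⟩)
  have h2 : C.toLocEInf x s y = 0 ↔ locMap x (C.j s) y ∈ C.locBInf x s := by
    exact Submodule.Quotient.mk_eq_zero (p := (C.locBInf x s).submoduleOf (C.locZInf x s))
      (x := ⟨locMap x (C.j s) y, C.locMap_j_mem x s y⟩)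
  rw [h1, h2, mem_locBInf]
  constructor
  · rintro ⟨w, hw⟩
    refine ⟨y - locMap x (C.i s) w, ?_, ?_⟩
    · rw [map_sub, ← hw, toZero, locMap_comp, sub_self]
    · rw [map_sub, (locMap_exact x (C.exact_i_j s)).apply_apply_eq_zero, sub_zero]
  · rintro ⟨w, hw, hwy⟩
    obtain ⟨v, hv⟩ := (locMap_exact x (C.exact_i_j s) (y - w)).1 (by rw [map_sub, hwy, sub_self])
    refine ⟨v, ?_⟩
    rw [toZero, locMap_comp, hv, map_sub, hw, sub_zero]

/-- The exact couple `C` carries gradings for which `i` has degree `(1, 0)`, the maps `j` and `κ`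
have degree `(0, 0)`, and multiplication by `x` has degree `(2, 12)`, and `D s` vanishes in the
degrees `(t, u)` with `u < 12 s + 6 t - 2`. -/
structure IsGradedVanishing (x : R) (pD : ∀ s, ℤ × ℤ → C.D s →+ C.D s)
    (pE : ∀ s, ℤ × ℤ → C.E s →+ C.E s) : Prop where
  bigradingD : ∀ s, IsBigrading x (pD s)
  bigradingE : ∀ s, IsBigrading x (pE s)
  i_comm : ∀ (s : ℕ) (t u : ℤ) (y : C.D (s + 1)),
    C.i s (pD (s + 1) (t, u) y) = pD s (t + 1, u) (C.i s y)
  j_comm : ∀ s d y, C.j s (pD s d y) = pE s d (C.j s y)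
  κ_comm : ∀ s d y, C.κ s (pE s d y) = pD (s + 1) d (C.κ s y)
  vanish : ∀ (s : ℕ) (t u : ℤ) (y : C.D s), u < 12 * (s : ℤ) + 6 * t - 2 → pD s (t, u) y = 0

namespace IsGradedVanishing

variable {C} {pD : ∀ s, ℤ × ℤ → C.D s →+ C.D s} {pE : ∀ s, ℤ × ℤ → C.E s →+ C.E s}
  (h : C.IsGradedVanishing x pD pE)

include h

theorem toZero_comm (s : ℕ) (t u : ℤ) (y : C.D s) :
    C.toZero s (pD s (t, u) y) = pD 0 (t + s, u) (C.toZero s y) := by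
  induction s generalizing t with
  | zero => simp [toZero]
  | succ s ih =>
    simp only [toZero, LinearMap.comp_apply]
    rw [h.i_comm, ih]
    congr 3
    push_cast
    ring

theorem shift_comm (s m : ℕ) (t u : ℤ) (y : C.D (s + m + 1)) :
    C.shift s m (pD (s + m + 1) (t, u) y) = pD (s + 1) (t + m, u) (C.shift s m y) := by
  induction m generalizing t with
  | zero => simp [shift]
  | succ m ih =>
    change C.shift s m (C.i (s + m + 1) (pD (s + m + 1 + 1) (t, u) y)) =
      pD (s + 1) _ (C.shift s m (C.i (s + m + 1) y))
    rw [h.i_comm, ih]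
    congr 3
    push_cast
    ring

theorem eq_zero_of_mem_locDeg {s : ℕ} {t u : ℤ} (hu : u < 12 * (s : ℤ) + 6 * t - 2)
    {y : Loc x (C.D s)} (hy : y ∈ locDeg x (homDeg (pD s)) t u) : y = 0 := by
  obtain ⟨m, a, ha, rfl⟩ := (h.bigradingD s).mem_locDeg.1 hy
  rw [← ha, h.vanish _ _ _ _ (by omega), LocalizedModule.zero_mk]

/-- An element on which all localized differentials are defined comes from `D s`: the degree of a
lift of its image in `D (s + 1)` to `D (s + m + 1)` lies in the range where `D (s + m + 1)`
vanishes if `m` is large. -/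
theorem locZInf_le {s : ℕ} {z : Loc x (C.E s)} (hz : z ∈ C.locZInf x s) :
    ∃ y, locMap x (C.j s) y = z := by
  refine (locMap_exact x (C.exact_j_κ s) z).1 ?_
  obtain ⟨e, l, rfl⟩ := exists_mk_den x z
  rw [locMap_mk]
  have key : ∀ d, ∃ r, x ^ r • pD (s + 1) d (C.κ s e) = 0 := by
    rintro ⟨t, u⟩
    have hm := (Submodule.mem_iInf _).1 hz (u - 6 * t).natAbs
    obtain ⟨r, hr⟩ := (mem_locSub x).1 hm
    obtain ⟨c, hc⟩ := hr
    refine ⟨r, ?_⟩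
    rw [(h.bigradingD _).pow_smul, ← map_smul, ← hc]
    rw [← sub_add_cancel (t + 2 * (r : ℤ)) ((u - 6 * t).natAbs : ℤ), ← h.shift_comm,
      h.vanish, map_zero]
    omega
  -- the elements annihilated by a power of `x` form a submodule, so that it suffices to consider
  -- the homogeneous components
  have hker : ∀ a : C.D (s + 1),
      a ∈ LinearMap.ker (LocalizedModule.mkLinearMap (Submonoid.powers x) (C.D (s + 1))) ↔
        ∃ r, x ^ r • a = 0 := by
    intro a
    rw [LinearMap.mem_ker, ← mk_den_eq_zero x (m := 0)]
    have : den x 0 = 1 := Subtype.ext (pow_zero x)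
    rw [this]
    rfl
  rw [mk_den_eq_zero, ← hker]
  obtain ⟨f, hf⟩ := (h.bigradingD (s + 1)).total (C.κ s e)
  rw [← hf f subset_rfl]
  exact Submodule.sum_mem _ fun d _ => (hker _).2 (key d)

/-- Convergence: for fixed `(t, u)` and large `m` the group `D (s + m)` vanishes in degree
`(t - m, u)`, so that the filtration is finite in each degree and a class which lifts `m` times is
zero. Localization does not affect this, since multiplication by `x` moves `(t, u)` to
`(t + 2, u + 12)`, parallel to the vanishing line. -/
theorem locConverges :
    C.LocConverges x (fun s => homDeg (pE s)) (homDeg (pD 0)) where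
  exhaustive := by
    rw [eq_top_iff]
    intro y _
    refine ⟨y, ?_⟩
    obtain ⟨a, m, rfl⟩ := exists_mk_den x y
    exact locMap_mk x _ _ _
  finite n u := by
    refine ⟨(u - 6 * n + 2).natAbs + 1, ?_⟩
    rintro s hs _ ⟨y, rfl⟩ hy
    rw [← sub_add_cancel n (s : ℤ)] at hy
    obtain ⟨z, hz, hzy⟩ := (h.bigradingD s).exists_mem_locDeg (h.bigradingD 0)
      (h.toZero_comm s) hy
    rw [← hzy, h.eq_zero_of_mem_locDeg (by omega) hz, map_zero]
  stabilizes s t u := by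
    refine ⟨(u - 6 * t).natAbs, ?_⟩
    rintro m hm _ ⟨l, t', u', _, ⟨⟨z, hz⟩, hzd, rfl⟩, ht, hu, rfl⟩
    obtain ⟨y, hy⟩ := hz
    have hzd' : pE s (t', u') z = z := hzd
    have h0 : C.κ s z = 0 := by
      rw [← hzd', h.κ_comm, ← hy, ← sub_add_cancel (t' : ℤ) (m : ℤ), ← h.shift_comm, h.vanish,
        map_zero]
      push_cast
      omega
    rw [locd, locMap_mk]
    have h1 : C.d m s (((C.B m s).submoduleOf (C.Z m s)).mkQ ⟨z, ⟨y, hy⟩⟩) = 0 := by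
      change C.dAux m s ⟨z, ⟨y, hy⟩⟩ = 0
      rw [C.dAux_apply m s _ 0 (by rw [map_zero]; exact h0.symm), map_zero]
    rw [h1, LocalizedModule.zero_mk]
  abutment s := by
    have hs1 : Function.Surjective (C.toLocGr x s) :=
      (Submodule.mkQ_surjective _).comp (LinearMap.surjective_rangeRestrict _)
    have hs2 : Function.Surjective (C.toLocEInf x s) := by
      intro w
      obtain ⟨⟨z, hz⟩, rfl⟩ := Submodule.mkQ_surjective _ w
      obtain ⟨y, rfl⟩ := h.locZInf_le hz
      exact ⟨y, rfl⟩
    have hk : LinearMap.ker (C.toLocGr x s) = LinearMap.ker (C.toLocEInf x s) :=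
      Submodule.ext fun y => C.toLocGr_eq_zero_iff s y
    let φ : C.locGr x s ≃ₗ[R] C.locEInf x s :=
      ((C.toLocGr x s).quotKerEquivOfSurjective hs1).symm ≪≫ₗ
        Submodule.quotEquivOfEq _ _ hk ≪≫ₗ (C.toLocEInf x s).quotKerEquivOfSurjective hs2
    have hφ : ∀ y, φ (C.toLocGr x s y) = C.toLocEInf x s y := by
      intro y
      have h1 : ((C.toLocGr x s).quotKerEquivOfSurjective hs1).symm (C.toLocGr x s y) =
          (LinearMap.ker (C.toLocGr x s)).mkQ y := by
        rw [LinearEquiv.symm_apply_eq]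
        rfl
      simp only [φ, LinearEquiv.trans_apply, h1]
      rfl
    have hj : ∀ t u a, C.j s (pD s (t, u) a) = pE s (t + 0, u) (C.j s a) := by
      intro t u a
      rw [add_zero, h.j_comm]
    refine ⟨φ, hφ, fun t u => ?_⟩
    ext w
    constructor
    · rintro ⟨_, ⟨⟨_, ⟨y, rfl⟩⟩, hd, rfl⟩, rfl⟩
      obtain ⟨z, hz, hzy⟩ := (h.bigradingD s).exists_mem_locDeg (h.bigradingD 0)
        (h.toZero_comm s) (add_comm (s : ℤ) t ▸ hd)
      refine ⟨⟨locMap x (C.j s) z, C.locMap_j_mem x s z⟩, ?_, ?_⟩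
      · have := (h.bigradingD s).locMap_mem_locDeg (h.bigradingE s) hj hz
        rwa [add_zero] at this
      · refine (hφ z).symm.trans (congrArg φ ?_)
        exact congrArg ((C.locF x (s + 1)).submoduleOf (C.locF x s)).mkQ (Subtype.ext hzy)
    · rintro ⟨⟨z, hz⟩, hd, rfl⟩
      obtain ⟨y, rfl⟩ := h.locZInf_le hz
      obtain ⟨y', hy', hyy⟩ := (h.bigradingD s).exists_mem_locDeg (h.bigradingE s) hj
        (t := t) (u := u) (by rw [add_zero]; exact hd)
      refine ⟨C.toLocGr x s y', ⟨⟨_, ⟨y', rfl⟩⟩, ?_, rfl⟩, ?_⟩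
      · have := (h.bigradingD s).locMap_mem_locDeg (h.bigradingD 0) (h.toZero_comm s) hy'
        rwa [add_comm] at this
      · rw [hφ]
        exact congrArg ((C.locBInf x s).submoduleOf (C.locZInf x s)).mkQ (Subtype.ext hyy)

end IsGradedVanishing
end ExactCouple

/-! ### Relatively injective comodules -/

section RelativeInjectivity

universe v

variable {k Γ D : Type} [Field k] [CommRing Γ] [Bialgebra k Γ] [CommRing D] [Bialgebra k D]

theorem Comod.Hom.comm_id {N N' : Comod.{v} k Γ} (f : Comod.Hom (BialgHom.id k Γ) N N')
    (n : N.carrier) : f.lin.lTensor Γ (N.coact n) = N'.coact (f.lin n) := f.comm n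

/-- A comodule is relatively injective if its coaction has a colinear retraction from the extended
comodule. -/
def RelInj (N : Comod.{v} k Γ) : Prop :=
  ∃ r : Γ ⊗[k] N.carrier →ₗ[k] N.carrier, (∀ n, r (N.coact n) = n) ∧
    ∀ z, N.coact (r z) = r.lTensor Γ (TensorProduct.assoc k Γ Γ N.carrier
      ((Coalgebra.comul (R := k) (A := Γ)).rTensor _ z))

/-- Relative injectivity passes to retracts. -/
theorem RelInj.of_retract {N N' : Comod.{v} k Γ} (h : RelInj N')
    (i : Comod.Hom (BialgHom.id k Γ) N N') (p : Comod.Hom (BialgHom.id k Γ) N' N)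
    (hpi : ∀ n, p.lin (i.lin n) = n) : RelInj N := by
  obtain ⟨r, h1, h2⟩ := h
  refine ⟨p.lin ∘ₗ r ∘ₗ i.lin.lTensor Γ, fun n => ?_, fun z => ?_⟩
  · rw [LinearMap.comp_apply, LinearMap.comp_apply, i.comm_id, h1, hpi]
  · rw [LinearMap.comp_apply, LinearMap.comp_apply, ← p.comm_id, h2, LinearMap.lTensor_comp,
      LinearMap.lTensor_comp]
    simp only [LinearMap.comp_apply]
    congr 2
    induction z with
    | zero => simp
    | add u u' hu hu' => simp only [map_add, hu, hu']
    | tmul a n =>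
      simp only [LinearMap.lTensor_tmul, LinearMap.rTensor_tmul]
      generalize Coalgebra.comul (R := k) a = w
      induction w with
      | zero => simp
      | add u u' hu hu' => simp only [TensorProduct.add_tmul, map_add, hu, hu']
      | tmul b c => simp

/-- The inductive step for `cobarContr_del`: a contraction of one stage of the cobar complex extends
to the next stage, with the opposite sign. -/
theorem lTensor_nextDel {V : Type v} [AddCommGroup V] [Module k V] (del : V →ₗ[k] Γ ⊗[k] V)
    (c : Γ ⊗[k] V →ₗ[k] V) (s : k)
    (h : ∀ w, c.lTensor Γ (nextDel del w) = del (c w) - s • w) (z : Γ ⊗[k] (Γ ⊗[k] V)) :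
    (c.lTensor Γ).lTensor Γ (nextDel (nextDel del) z) =
      nextDel del (c.lTensor Γ z) + s • z := by
  induction z with
  | zero => simp
  | add u u' hu hu' =>
    simp only [map_add, hu, hu', smul_add]
    abel
  | tmul a y =>
    have h3 : ∀ w : Γ ⊗[k] Γ, (c.lTensor Γ).lTensor Γ (TensorProduct.assoc k Γ Γ _ (w ⊗ₜ y)) =
        TensorProduct.assoc k Γ Γ _ (w ⊗ₜ c y) := by
      intro w
      induction w with
      | zero => simp
      | add u u' hu hu' => simp only [TensorProduct.add_tmul, map_add, hu, hu']
      | tmul b e => simp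
    rw [nextDel_tmul, map_sub, LinearMap.lTensor_tmul, LinearMap.lTensor_tmul, nextDel_tmul, h, h3]
    simp only [TensorProduct.tmul_sub, TensorProduct.tmul_smul]
    abel

/-- The contraction `[a₁|⋯|a_{t+1}] n ↦ [a₁|⋯|a_t] r(a_{t+1} ⊗ n)` of the cobar complex. -/
def cobarContr (N : Comod.{v} k Γ) (r : Γ ⊗[k] N.carrier →ₗ[k] N.carrier) :
    ∀ t, (cobarStage N (t + 1)).V →ₗ[k] (cobarStage N t).V
  | 0 => r
  | t + 1 => (cobarContr N r t).lTensor Γ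

theorem cobarContr_del (N : Comod.{v} k Γ) (r : Γ ⊗[k] N.carrier →ₗ[k] N.carrier)
    (h1 : ∀ n, r (N.coact n) = n)
    (h2 : ∀ z, N.coact (r z) = r.lTensor Γ (TensorProduct.assoc k Γ Γ N.carrier
      ((Coalgebra.comul (R := k) (A := Γ)).rTensor _ z))) (t : ℕ)
    (z : (cobarStage N (t + 1)).V) :
    cobarContr N r (t + 1) (cobarDel N (t + 1) z) =
      cobarDel N t (cobarContr N r t z) - (-1 : k) ^ t • z := by
  induction t with
  | zero =>
    change Γ ⊗[k] N.carrier at z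
    have h3 : ∀ z : Γ ⊗[k] N.carrier, r.lTensor Γ (N.coact.lTensor Γ z) = z := by
      intro z
      rw [← LinearMap.lTensor_comp_apply, show r ∘ₗ N.coact = LinearMap.id from LinearMap.ext h1,
        LinearMap.lTensor_id, LinearMap.id_apply]
    change r.lTensor Γ (nextDel N.coact z) = N.coact (r z) - (-1 : k) ^ 0 • z
    rw [h2, pow_zero, one_smul, nextDel, LinearMap.sub_apply, map_sub, h3]
    rfl
  | succ t ih =>
    refine (lTensor_nextDel (cobarStage N t).del (cobarContr N r t) _ ih z).trans ?_
    rw [pow_succ, mul_neg, mul_one, neg_smul, sub_neg_eq_add]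
    rfl

/-- The higher cohomology of a relatively injective comodule vanishes. -/
theorem RelInj.exists_cobarD {N : Comod.{v} k Γ} (h : RelInj N) {t : ℕ}
    {z : (cobarStage N (t + 1)).V} (hz : cobarD N (t + 1) z = 0) : ∃ y, cobarD N t y = z := by
  obtain ⟨r, h1, h2⟩ := h
  have key : cobarContr N r (t + 1) (cobarD N (t + 1) z) =
      cobarD N t (cobarContr N r t z) + (-1 : k) ^ t • z := by
    have h3 : cobarD N (t + 1) z = cobarCons N (t + 1) 1 z - cobarDel N (t + 1) z := rfl
    have h4 : cobarContr N r (t + 1) (cobarCons N (t + 1) 1 z) =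
      cobarCons N t 1 (cobarContr N r t z) := rfl
    have h5 : cobarD N t (cobarContr N r t z) = cobarCons N t 1 (cobarContr N r t z) -
      cobarDel N t (cobarContr N r t z) := rfl
    rw [h3, map_sub, h4, cobarContr_del N r h1 h2, h5]
    abel
  rw [hz, map_zero] at key
  refine ⟨-((-1 : k) ^ t • cobarContr N r t z), ?_⟩
  rw [map_neg, map_smul, eq_neg_of_add_eq_zero_left key.symm, smul_neg, neg_neg, smul_smul,
    ← mul_pow, neg_one_mul, neg_neg, one_pow, one_smul]

/-! ### The shear isomorphism -/

/-- The `Γ`-linear extension `a ⊗ x ↦ a c(x)` of a map `c : X → Γ ⊗ Y`. -/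
def shear {X Y : Type*} [AddCommGroup X] [Module k X] [AddCommGroup Y] [Module k Y]
    (c : X →ₗ[k] Γ ⊗[k] Y) : Γ ⊗[k] X →ₗ[k] Γ ⊗[k] Y :=
  (LinearMap.mul' k Γ).rTensor Y ∘ₗ (TensorProduct.assoc k Γ Γ Y).symm.toLinearMap ∘ₗ c.lTensor Γ

section

variable {X Y Z : Type*} [AddCommGroup X] [Module k X] [AddCommGroup Y] [Module k Y]
  [AddCommGroup Z] [Module k Z]

theorem shear_tmul (c : X →ₗ[k] Γ ⊗[k] Y) (a : Γ) (x : X) :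
    shear c (a ⊗ₜ x) = (LinearMap.mulLeft k a).rTensor Y (c x) := by
  simp only [shear, LinearMap.comp_apply, LinearMap.lTensor_tmul, LinearEquiv.coe_coe]
  generalize c x = z
  induction z with
  | zero => simp
  | add u u' hu hu' => simp only [TensorProduct.tmul_add, map_add, hu, hu']
  | tmul b y => simp

theorem shear_one_tmul (c : X →ₗ[k] Γ ⊗[k] Y) (x : X) : shear c (1 ⊗ₜ x) = c x := by
  rw [shear_tmul, LinearMap.mulLeft_one, LinearMap.rTensor_id, LinearMap.id_apply]

theorem shear_mulLeft (c : X →ₗ[k] Γ ⊗[k] Y) (a : Γ) (z : Γ ⊗[k] X) :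
    shear c ((LinearMap.mulLeft k a).rTensor X z) =
      (LinearMap.mulLeft k a).rTensor Y (shear c z) := by
  induction z with
  | zero => simp
  | add u u' hu hu' => simp only [map_add, hu, hu']
  | tmul b x =>
    rw [LinearMap.rTensor_tmul, LinearMap.mulLeft_apply, shear_tmul, shear_tmul,
      LinearMap.mulLeft_mul, LinearMap.rTensor_comp_apply]

/-- Composites of shears are determined on `1 ⊗ X`. -/
theorem shear_shear (c : X →ₗ[k] Γ ⊗[k] Y) (c' : Y →ₗ[k] Γ ⊗[k] X)
    (h : ∀ x, shear c' (c x) = 1 ⊗ₜ x) (z : Γ ⊗[k] X) : shear c' (shear c z) = z := by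
  induction z with
  | zero => simp
  | add u u' hu hu' => simp only [map_add, hu, hu']
  | tmul b x => rw [shear_tmul, shear_mulLeft, h]; simp

end

section Antipode

variable {H : Type} [CommRing H] [HopfAlgebra k H] (X : Comod.{v} k H)

/-- The map `x ↦ ∑ S(a) ⊗ y`, where `∑ a ⊗ y` is the coaction on `x` and `S` is the antipode. Its
shear is inverse to the shear of the coaction. -/
def antiCoact : X.carrier →ₗ[k] H ⊗[k] X.carrier :=
  (HopfAlgebra.antipode k (A := H)).rTensor X.carrier ∘ₗ X.coact

theorem shear_coact_antiCoact (x : X.carrier) : shear X.coact (antiCoact X x) = 1 ⊗ₜ x := by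
  have h1 : ∀ z : H ⊗[k] X.carrier,
      shear X.coact ((HopfAlgebra.antipode k (A := H)).rTensor X.carrier z) =
      (LinearMap.mul' k H ∘ₗ (HopfAlgebra.antipode k (A := H)).rTensor H).rTensor X.carrier
        ((TensorProduct.assoc k H H X.carrier).symm (X.coact.lTensor H z)) := by
    intro z
    induction z with
    | zero => simp
    | add u u' hu hu' => simp only [map_add, hu, hu']
    | tmul a x =>
      rw [LinearMap.rTensor_tmul, shear_tmul, LinearMap.lTensor_tmul]
      generalize X.coact x = w
      induction w with
      | zero => simp
      | add u u' hu hu' => simp only [TensorProduct.tmul_add, map_add, hu, hu']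
      | tmul b y => simp
  rw [antiCoact, LinearMap.comp_apply, h1, ← X.coassoc, LinearEquiv.symm_apply_apply,
    ← LinearMap.rTensor_comp_apply, LinearMap.comp_assoc,
    HopfAlgebra.mul_antipode_rTensor_comul, LinearMap.rTensor_comp_apply]
  conv_rhs => rw [← X.counit x]
  generalize (Coalgebra.counit (R := k) (A := H)).rTensor X.carrier (X.coact x) = w
  induction w with
  | zero => simp
  | add u u' hu hu' => simp only [TensorProduct.tmul_add, map_add, hu, hu']
  | tmul b y => simp [Algebra.algebraMap_eq_smul_one, TensorProduct.smul_tmul]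

theorem shear_antiCoact_coact (x : X.carrier) : shear (antiCoact X) (X.coact x) = 1 ⊗ₜ x := by
  have h1 : ∀ z : H ⊗[k] X.carrier,
      shear (antiCoact X) z =
      (LinearMap.mul' k H ∘ₗ (HopfAlgebra.antipode k (A := H)).lTensor H).rTensor X.carrier
        ((TensorProduct.assoc k H H X.carrier).symm (X.coact.lTensor H z)) := by
    intro z
    induction z with
    | zero => simp
    | add u u' hu hu' => simp only [map_add, hu, hu']
    | tmul a x =>
      rw [shear_tmul, LinearMap.lTensor_tmul, antiCoact, LinearMap.comp_apply]
      generalize X.coact x = w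
      induction w with
      | zero => simp
      | add u u' hu hu' => simp only [TensorProduct.tmul_add, map_add, hu, hu']
      | tmul b y => simp
  rw [h1, ← X.coassoc, LinearEquiv.symm_apply_apply,
    ← LinearMap.rTensor_comp_apply, LinearMap.comp_assoc,
    HopfAlgebra.mul_antipode_lTensor_comul, LinearMap.rTensor_comp_apply]
  conv_rhs => rw [← X.counit x]
  generalize (Coalgebra.counit (R := k) (A := H)).rTensor X.carrier (X.coact x) = w
  induction w with
  | zero => simp
  | add u u' hu hu' => simp only [TensorProduct.tmul_add, map_add, hu, hu']
  | tmul b y => simp [Algebra.algebraMap_eq_smul_one, TensorProduct.smul_tmul]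

theorem shear_coact_injective : Function.Injective (shear X.coact) :=
  Function.LeftInverse.injective (shear_shear _ _ (shear_antiCoact_coact X))

end Antipode

/-- The regular comodule. -/
def Comod.reg (k Γ : Type) [Field k] [CommRing Γ] [Bialgebra k Γ] : Comod.{0} k Γ where
  carrier := Γ
  coact := Coalgebra.comul
  coassoc := Coalgebra.coassoc_apply
  counit a := by simp

/-- The shear map is colinear from the diagonal to the extended coaction. -/
theorem shear_coact_colinear (X : Comod.{v} k Γ) (z : Γ ⊗[k] X.carrier) :
    (shear X.coact).lTensor Γ (diagMul k Γ Γ X.carrier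
      (TensorProduct.map (Coalgebra.comul (R := k) (A := Γ)) X.coact z)) =
      TensorProduct.assoc k Γ Γ X.carrier
        ((Coalgebra.comul (R := k) (A := Γ)).rTensor _ (shear X.coact z)) := by
  have h1 : ∀ (w : Γ ⊗[k] Γ) (z : Γ ⊗[k] X.carrier),
      (shear X.coact).lTensor Γ (diagMul k Γ Γ X.carrier (w ⊗ₜ z)) =
      TensorProduct.assoc k Γ Γ X.carrier ((LinearMap.mulLeft k w).rTensor X.carrier
        ((TensorProduct.assoc k Γ Γ X.carrier).symm (X.coact.lTensor Γ z))) := by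
    intro w z
    induction w with
    | zero => simp
    | add u u' hu hu' =>
      have h3 : LinearMap.mulLeft k (u + u') = LinearMap.mulLeft k u + LinearMap.mulLeft k u' :=
        LinearMap.ext fun _ => add_mul _ _ _
      simp only [TensorProduct.add_tmul, map_add, hu, hu', h3, LinearMap.rTensor_add,
        LinearMap.add_apply]
    | tmul a b =>
      induction z with
      | zero => simp
      | add u u' hu hu' => simp only [TensorProduct.tmul_add, map_add, hu, hu']
      | tmul c x =>
        rw [diagMul_tmul, LinearMap.lTensor_tmul, shear_tmul, LinearMap.lTensor_tmul]
        generalize X.coact x = y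
        induction y with
        | zero => simp
        | add u u' hu hu' => simp only [TensorProduct.tmul_add, map_add, hu, hu']
        | tmul e m => simp
  have h2 : ∀ (a : Γ) (y : Γ ⊗[k] X.carrier),
      (LinearMap.mulLeft k (Coalgebra.comul (R := k) a)).rTensor X.carrier
        ((Coalgebra.comul (R := k) (A := Γ)).rTensor _ y) =
      (Coalgebra.comul (R := k) (A := Γ)).rTensor _ ((LinearMap.mulLeft k a).rTensor _ y) := by
    intro a y
    induction y with
    | zero => simp
    | add u u' hu hu' => simp only [map_add, hu, hu']
    | tmul e m => simp
  induction z with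
  | zero => simp
  | add u u' hu hu' => simp only [map_add, hu, hu']
  | tmul a x =>
    rw [TensorProduct.map_tmul, h1, ← X.coassoc, LinearEquiv.symm_apply_apply, h2, shear_tmul]

/-- The map `a ⊗ x ↦ ε(a) x`. -/
def counitLeft (k Γ : Type) [Field k] [CommRing Γ] [Bialgebra k Γ] (X : Type*) [AddCommGroup X]
    [Module k X] : Γ ⊗[k] X →ₗ[k] X :=
  (TensorProduct.lid k X).toLinearMap ∘ₗ (Coalgebra.counit (R := k) (A := Γ)).rTensor X

theorem counitLeft_tmul {X : Type*} [AddCommGroup X] [Module k X] (a : Γ) (x : X) :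
    counitLeft k Γ X (a ⊗ₜ x) = Coalgebra.counit (R := k) a • x := rfl

theorem counitLeft_shear (X : Comod.{v} k Γ) (z : Γ ⊗[k] X.carrier) :
    counitLeft k Γ X.carrier (shear X.coact z) = counitLeft k Γ X.carrier z := by
  induction z with
  | zero => simp
  | add u u' hu hu' => simp only [map_add, hu, hu']
  | tmul a x =>
    have h1 : ∀ y : Γ ⊗[k] X.carrier,
        counitLeft k Γ X.carrier ((LinearMap.mulLeft k a).rTensor X.carrier y) =
          Coalgebra.counit (R := k) a • counitLeft k Γ X.carrier y := by
      intro y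
      induction y with
      | zero => simp
      | add u u' hu hu' => simp only [map_add, smul_add, hu, hu']
      | tmul b m => simp [counitLeft_tmul, mul_smul]
    rw [shear_tmul, h1, counitLeft_tmul]
    exact congrArg _ (X.counit x)

theorem lTensor_counitLeft {X : Type*} [AddCommGroup X] [Module k X] (w : Γ ⊗[k] X) :
    (counitLeft k Γ X).lTensor Γ (TensorProduct.assoc k Γ Γ X
      ((Coalgebra.comul (R := k) (A := Γ)).rTensor X w)) = w := by
  induction w with
  | zero => simp
  | add u u' hu hu' => simp only [map_add, hu, hu']
  | tmul a x =>
    have h2 : ∀ w : Γ ⊗[k] Γ, (counitLeft k Γ X).lTensor Γ (TensorProduct.assoc k Γ Γ X (w ⊗ₜ x)) =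
        TensorProduct.rid k Γ ((Coalgebra.counit (R := k) (A := Γ)).lTensor Γ w) ⊗ₜ x := by
      intro w
      induction w with
      | zero => simp
      | add u u' hu hu' => simp only [TensorProduct.add_tmul, map_add, hu, hu']
      | tmul b c => simp [counitLeft_tmul, TensorProduct.smul_tmul]
    rw [LinearMap.rTensor_tmul, h2, Coalgebra.lTensor_counit_comul]
    simp

/-- A tensor product with the regular comodule is relatively injective, being isomorphic to an
extended comodule. -/
theorem relInj_reg_tensor {H : Type} [CommRing H] [HopfAlgebra k H] (X : Comod.{v} k H) :
    RelInj ((Comod.reg k H).tensor X) := by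
  let ε : H ⊗[k] X.carrier →ₗ[k] X.carrier := counitLeft k H X.carrier
  let r : H ⊗[k] (H ⊗[k] X.carrier) →ₗ[k] H ⊗[k] X.carrier := shear (antiCoact X) ∘ₗ ε.lTensor H
  have hr : ∀ z, shear X.coact (r z) = ε.lTensor H z := fun z =>
    shear_shear _ _ (shear_coact_antiCoact X) _
  refine ⟨r, fun z => ?_, fun z => ?_⟩
  · change H ⊗[k] X.carrier at z
    apply shear_coact_injective X
    refine (hr _).trans ?_
    change ε.lTensor H (diagMul k H H X.carrier
      (TensorProduct.map (Coalgebra.comul (R := k) (A := H)) X.coact z)) = _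
    have h1 : ε.lTensor H ∘ₗ (shear X.coact).lTensor H = ε.lTensor H := by
      rw [← LinearMap.lTensor_comp]
      exact congrArg _ (LinearMap.ext (counitLeft_shear X))
    rw [← h1, LinearMap.comp_apply, shear_coact_colinear]
    exact lTensor_counitLeft _
  · change H ⊗[k] (H ⊗[k] X.carrier) at z
    have hinj : Function.Injective ((shear X.coact).lTensor H) :=
      Module.Flat.lTensor_preserves_injective_linearMap _ (shear_coact_injective X)
    apply hinj
    refine (shear_coact_colinear X (r z)).trans ?_
    have h1 : (shear X.coact).lTensor H ∘ₗ r.lTensor H = (ε.lTensor H).lTensor H := by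
      rw [← LinearMap.lTensor_comp]
      exact congrArg _ (LinearMap.ext hr)
    rw [hr]
    refine Eq.trans ?_ (LinearMap.congr_fun h1 _).symm
    change _ = (ε.lTensor H).lTensor H (TensorProduct.assoc k H H (H ⊗[k] X.carrier)
      ((Coalgebra.comul (R := k) (A := H)).rTensor (H ⊗[k] X.carrier) z))
    induction z with
    | zero => simp
    | add u u' hu hu' => simp only [map_add, hu, hu']
    | tmul a x =>
      have h2 : ∀ w : H ⊗[k] H, TensorProduct.assoc k H H X.carrier (w ⊗ₜ ε x) =
          (ε.lTensor H).lTensor H (TensorProduct.assoc k H H (H ⊗[k] X.carrier) (w ⊗ₜ x)) := by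
        intro w
        induction w with
        | zero => simp
        | add u u' hu hu' => simp only [TensorProduct.add_tmul, map_add, hu, hu']
        | tmul b c => simp
      exact h2 _

end RelativeInjectivity

/-! ### Maps of comodules -/

section ComoduleMaps

universe v

variable {k Γ D : Type} [Field k] [CommRing Γ] [Bialgebra k Γ] [CommRing D] [Bialgebra k D]

theorem map_diagMul {X X' N N' : Type*} [AddCommGroup X] [Module k X] [AddCommGroup X']
    [Module k X'] [AddCommGroup N] [Module k N] [AddCommGroup N'] [Module k N'] (φ : Γ →ₐc[k] D)
    (f : X →ₗ[k] X') (g : N →ₗ[k] N') (u : Γ ⊗[k] X) (v : Γ ⊗[k] N) :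
    TensorProduct.map (φ : Γ →ₗ[k] D) (TensorProduct.map f g) (diagMul k Γ X N (u ⊗ₜ v)) =
      diagMul k D X' N' (TensorProduct.map (φ : Γ →ₗ[k] D) f u ⊗ₜ
        TensorProduct.map (φ : Γ →ₗ[k] D) g v) := by
  induction u with
  | zero => simp
  | add u u' hu hu' => simp only [TensorProduct.add_tmul, map_add, hu, hu']
  | tmul a x =>
    induction v with
    | zero => simp
    | add u u' hu hu' => simp only [TensorProduct.tmul_add, map_add, hu, hu']
    | tmul b n => simp [diagMul_tmul]

/-- The identity map of a comodule. -/
def Comod.Hom.id (N : Comod.{v} k Γ) : Comod.Hom (BialgHom.id k Γ) N N where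
  lin := LinearMap.id
  comm n := LinearMap.lTensor_id_apply Γ _ (N.coact n)

/-- The tensor product of two maps of comodules. -/
def Comod.Hom.tensor {φ : Γ →ₐc[k] D} {X : Comod.{0} k Γ} {X' : Comod.{0} k D} {N : Comod.{v} k Γ}
    {N' : Comod.{v} k D} (f : Comod.Hom φ X X') (g : Comod.Hom φ N N') :
    Comod.Hom φ (X.tensor N) (X'.tensor N') where
  lin := TensorProduct.map f.lin g.lin
  comm m := by
    change X.carrier ⊗[k] N.carrier at m
    change TensorProduct.map _ _ (diagMul k Γ X.carrier N.carrier
      (TensorProduct.map X.coact N.coact m)) = diagMul k D X'.carrier N'.carrier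
      (TensorProduct.map X'.coact N'.coact (TensorProduct.map f.lin g.lin m))
    induction m with
    | zero => simp
    | add u u' hu hu' => simp only [map_add, hu, hu']
    | tmul x n =>
      rw [TensorProduct.map_tmul, TensorProduct.map_tmul, TensorProduct.map_tmul, map_diagMul,
        f.comm, g.comm]

/-- A map of `Γ`-comodules as a map of comodules over a quotient of `Γ`. -/
def Comod.Hom.corestrict (q : Γ →ₐc[k] D) {N N' : Comod.{v} k Γ}
    (f : Comod.Hom (BialgHom.id k Γ) N N') :
    Comod.Hom (BialgHom.id k D) (N.corestrict q) (N'.corestrict q) where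
  lin := f.lin
  comm n := by
    change N.carrier at n
    change f.lin.lTensor D ((q : Γ →ₗ[k] D).rTensor N.carrier (N.coact n)) =
      (q : Γ →ₗ[k] D).rTensor N'.carrier (N'.coact (f.lin n))
    rw [← f.comm_id]
    generalize N.coact n = z
    induction z with
    | zero => simp
    | add u u' hu hu' => simp only [map_add, hu, hu']
    | tmul a n => simp

/-- The symmetry `X ⊗ (Y ⊗ N) → Y ⊗ (X ⊗ N)`. -/
def leftCommHom (X Y : Comod.{0} k Γ) (N : Comod.{v} k Γ) :
    Comod.Hom (BialgHom.id k Γ) (X.tensor (Y.tensor N)) (Y.tensor (X.tensor N)) where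
  lin := (TensorProduct.leftComm k X.carrier Y.carrier N.carrier).toLinearMap
  comm m := by
    change X.carrier ⊗[k] (Y.carrier ⊗[k] N.carrier) at m
    have key : ∀ (u : Γ ⊗[k] X.carrier) (v : Γ ⊗[k] Y.carrier) (w : Γ ⊗[k] N.carrier),
        (TensorProduct.leftComm k X.carrier Y.carrier N.carrier).toLinearMap.lTensor Γ
          (diagMul k Γ _ _ (u ⊗ₜ diagMul k Γ _ _ (v ⊗ₜ w))) =
        diagMul k Γ _ _ (v ⊗ₜ diagMul k Γ _ _ (u ⊗ₜ w)) := by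
      intro u v w
      induction u with
      | zero => simp
      | add u u' hu hu' =>
        simp only [TensorProduct.add_tmul, TensorProduct.tmul_add, map_add, hu, hu']
      | tmul a x =>
        induction v with
        | zero => simp
        | add u u' hu hu' =>
          simp only [TensorProduct.add_tmul, TensorProduct.tmul_add, map_add, hu, hu']
        | tmul b y =>
          induction w with
          | zero => simp
          | add u u' hu hu' => simp only [TensorProduct.tmul_add, map_add, hu, hu']
          | tmul c n => simp [diagMul_tmul, mul_left_comm]
    change (TensorProduct.leftComm k X.carrier Y.carrier N.carrier).toLinearMap.lTensor Γ
      (diagMul k Γ _ _ (TensorProduct.map X.coact (diagMul k Γ _ _ ∘ₗ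
        TensorProduct.map Y.coact N.coact) m)) =
      (diagMul k Γ _ _ (TensorProduct.map Y.coact (diagMul k Γ _ _ ∘ₗ
        TensorProduct.map X.coact N.coact)
          (TensorProduct.leftComm k X.carrier Y.carrier N.carrier m)))
    induction m with
    | zero => simp
    | add u u' hu hu' => simp only [map_add, hu, hu']
    | tmul x m =>
      induction m with
      | zero => simp
      | add u u' hu hu' => simp only [TensorProduct.tmul_add, map_add, hu, hu']
      | tmul y n => simpa using key (X.coact x) (Y.coact y) (N.coact n)

theorem cobarMap_comm {Γ₁ Γ₂ Γ₃ Γ₄ : Type} [CommRing Γ₁] [Bialgebra k Γ₁] [CommRing Γ₂]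
    [Bialgebra k Γ₂] [CommRing Γ₃] [Bialgebra k Γ₃] [CommRing Γ₄] [Bialgebra k Γ₄]
    {φ : Γ₁ →ₐc[k] Γ₂} {ψ : Γ₂ →ₐc[k] Γ₄} {φ' : Γ₁ →ₐc[k] Γ₃} {ψ' : Γ₃ →ₐc[k] Γ₄}
    {N₁ : Comod.{v} k Γ₁} {N₂ : Comod.{v} k Γ₂} {N₃ : Comod.{v} k Γ₃} {N₄ : Comod.{v} k Γ₄}
    (f : Comod.Hom φ N₁ N₂) (g : Comod.Hom ψ N₂ N₄) (f' : Comod.Hom φ' N₁ N₃)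
    (g' : Comod.Hom ψ' N₃ N₄) (hφ : ∀ a, ψ (φ a) = ψ' (φ' a))
    (h : ∀ n, g.lin (f.lin n) = g'.lin (f'.lin n)) (t : ℕ) (x : (cobarStage N₁ t).V) :
    cobarMap g t (cobarMap f t x) = cobarMap g' t (cobarMap f' t x) := by
  induction t with
  | zero => exact h x
  | succ t ih =>
    change Γ₁ ⊗[k] (cobarStage N₁ t).V at x
    change TensorProduct.map (ψ : Γ₂ →ₗ[k] Γ₄) (cobarMap g t)
        (TensorProduct.map (φ : Γ₁ →ₗ[k] Γ₂) (cobarMap f t) x) =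
      TensorProduct.map (ψ' : Γ₃ →ₗ[k] Γ₄) (cobarMap g' t)
        (TensorProduct.map (φ' : Γ₁ →ₗ[k] Γ₃) (cobarMap f' t) x)
    induction x with
    | zero => simp
    | add u u' hu hu' => simp only [map_add, hu, hu']
    | tmul a x =>
      simp only [TensorProduct.map_tmul, ih]
      congr 1
      exact hφ a

/-! ### Cofree comodules -/

/-- The inclusion of `B` in the regular comodule. -/
def cotensorHom (q : Γ →ₐc[k] D) : Comod.Hom (BialgHom.id k Γ) (comodB q) (Comod.reg k Γ) where
  lin := (cotensor q).subtype
  comm b := cotensorCoact_spec q b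

theorem mem_cotensor_counit (a : Γ) : a ∈ cotensor (Bialgebra.counitBialgHom k Γ) := by
  rw [mem_cotensor]
  exact Coalgebra.lTensor_counit_comul a

/-- The identification of `Γ` with `Γ □_k k`. -/
def toCofree (k Γ : Type) [Field k] [CommRing Γ] [Bialgebra k Γ] :
    Γ →ₗ[k] cotensor (Bialgebra.counitBialgHom k Γ) :=
  LinearMap.codRestrict _ LinearMap.id mem_cotensor_counit

theorem lTensor_toCofree_comul (a : Γ) :
    (toCofree k Γ).lTensor Γ (Coalgebra.comul (R := k) a) =
    cotensorCoact (Bialgebra.counitBialgHom k Γ) (toCofree k Γ a) := by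
  apply cotensor_injective (Bialgebra.counitBialgHom k Γ)
  rw [cotensorCoact_spec, ← LinearMap.lTensor_comp_apply]
  exact LinearMap.lTensor_id_apply Γ Γ (Coalgebra.comul (R := k) a)

/-- The identification of the regular comodule with `Γ □_k k`. -/
def regHom (k Γ : Type) [Field k] [CommRing Γ] [Bialgebra k Γ] : Comod.Hom (BialgHom.id k Γ)
    (Comod.reg k Γ) (comodB (Bialgebra.counitBialgHom k Γ)) where
  lin := toCofree k Γ
  comm := lTensor_toCofree_comul (k := k) (Γ := Γ)

/-- A tensor product with `Γ □_k k` is relatively injective, since `Γ □_k k` is isomorphic to the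
regular comodule. -/
theorem relInj_cofree {H : Type} [CommRing H] [HopfAlgebra k H] (N : Comod.{v} k H) :
    RelInj ((comodB (Bialgebra.counitBialgHom k H)).tensor N) :=
  (relInj_reg_tensor N).of_retract ((cotensorHom _).tensor (Comod.Hom.id N))
    ((regHom k H).tensor (Comod.Hom.id N)) (fun n => by
      change cotensor (Bialgebra.counitBialgHom k H) ⊗[k] N.carrier at n
      change TensorProduct.map _ _ (TensorProduct.map _ _ n) = n
      induction n with
      | zero => simp
      | add u u' hu hu' => simp only [map_add, hu, hu']
      | tmul a x => rfl)

/-- A comodule with a factor `Γ □_k k` in the middle is relatively injective, by the symmetry of the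
tensor product. -/
theorem relInj_tensor_cofree {H : Type} [CommRing H] [HopfAlgebra k H] (X : Comod.{0} k H)
    (N : Comod.{v} k H) :
    RelInj (X.tensor ((comodB (Bialgebra.counitBialgHom k H)).tensor N)) :=
  (relInj_cofree (X.tensor N)).of_retract (leftCommHom _ _ _) (leftCommHom _ _ _) (fun n => by
    change X.carrier ⊗[k] (cotensor (Bialgebra.counitBialgHom k H) ⊗[k] N.carrier) at n
    change TensorProduct.leftComm k _ _ _ (TensorProduct.leftComm k _ _ _ n) = n
    induction n with
    | zero => simp
    | add u u' hu hu' => simp only [map_add, hu, hu']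
    | tmul x m =>
      induction m with
      | zero => simp
      | add u u' hu hu' => simp only [TensorProduct.tmul_add, map_add, hu, hu']
      | tmul y n => simp)

/-- The map `y ↦ 1 ⊗ y` to the tensor product with the regular comodule. -/
def regUnitHom (N : Comod.{v} k Γ) :
    Comod.Hom (BialgHom.id k Γ) N ((Comod.reg k Γ).tensor N) where
  lin := TensorProduct.mk k Γ N.carrier 1
  comm n := by
    change (TensorProduct.mk k Γ N.carrier 1).lTensor Γ (N.coact n) =
      diagMul k Γ Γ N.carrier (Coalgebra.comul (R := k) (1 : Γ) ⊗ₜ N.coact n)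
    rw [Bialgebra.comul_one, Algebra.TensorProduct.one_def]
    generalize N.coact n = z
    induction z with
    | zero => simp
    | add u u' hu hu' => simp only [TensorProduct.tmul_add, map_add, hu, hu']
    | tmul a n => simp [diagMul_tmul]

/-- For a map `φ : D → Γ` which is colinear over `D`, the map `d ⊗ (a ⊗ n) ↦ φ(d) a ⊗ n` is
colinear over `D`. -/
def integralHom (q : Γ →ₐc[k] D) (φ : D →ₗ[k] Γ)
    (hφ : ∀ d, (q : Γ →ₗ[k] D).rTensor Γ (Coalgebra.comul (R := k) (φ d)) =
      φ.lTensor D (Coalgebra.comul (R := k) d)) (N : Comod.{v} k Γ) :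
    Comod.Hom (BialgHom.id k D)
      ((Comod.reg k D).tensor (((Comod.reg k Γ).tensor N).corestrict q))
      (((Comod.reg k Γ).tensor N).corestrict q) where
  lin := (shear (LinearMap.id : Γ ⊗[k] N.carrier →ₗ[k] _) ∘ₗ φ.rTensor (Γ ⊗[k] N.carrier) :
    D ⊗[k] (Γ ⊗[k] N.carrier) →ₗ[k] Γ ⊗[k] N.carrier)
  comm m := by
    change D ⊗[k] (Γ ⊗[k] N.carrier) at m
    let act : Γ ⊗[k] (Γ ⊗[k] N.carrier) →ₗ[k] Γ ⊗[k] N.carrier := shear LinearMap.id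
    change (act ∘ₗ φ.rTensor (Γ ⊗[k] N.carrier)).lTensor D (diagMul k D D (Γ ⊗[k] N.carrier)
      (TensorProduct.map (Coalgebra.comul (R := k) (A := D)) ((q : Γ →ₗ[k] D).rTensor _ ∘ₗ
        diagMul k Γ Γ N.carrier ∘ₗ TensorProduct.map (Coalgebra.comul (R := k) (A := Γ)) N.coact)
        m)) =
      (q : Γ →ₗ[k] D).rTensor _ (diagMul k Γ Γ N.carrier
        (TensorProduct.map (Coalgebra.comul (R := k) (A := Γ)) N.coact
          (act (φ.rTensor (Γ ⊗[k] N.carrier) m))))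
    have hact : ∀ (a b : Γ) (n : N.carrier), act (a ⊗ₜ (b ⊗ₜ n)) = (a * b) ⊗ₜ n := by
      intro a b n
      simp [act, shear_tmul]
    -- both sides are the action of `(q ⊗ 1) Δ(φ(d)) = (1 ⊗ φ) Δ(d)` in `D ⊗ Γ`
    have h1 : ∀ (w : D ⊗[k] D) (z : D ⊗[k] (Γ ⊗[k] N.carrier)),
        (act ∘ₗ φ.rTensor (Γ ⊗[k] N.carrier)).lTensor D (diagMul k D D (Γ ⊗[k] N.carrier)
          (w ⊗ₜ z)) = act.lTensor D (diagMul k D Γ (Γ ⊗[k] N.carrier) (φ.lTensor D w ⊗ₜ z)) := by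
      intro w z
      induction w with
      | zero => simp
      | add u u' hu hu' => simp only [TensorProduct.add_tmul, map_add, hu, hu']
      | tmul a x =>
        induction z with
        | zero => simp
        | add u u' hu hu' => simp only [TensorProduct.tmul_add, map_add, hu, hu']
        | tmul b n => simp [diagMul_tmul]
    have h2 : ∀ (w u : Γ ⊗[k] Γ) (v : Γ ⊗[k] N.carrier),
        (q : Γ →ₗ[k] D).rTensor _ (diagMul k Γ Γ N.carrier ((w * u) ⊗ₜ v)) =
        act.lTensor D (diagMul k D Γ (Γ ⊗[k] N.carrier) ((q : Γ →ₗ[k] D).rTensor Γ w ⊗ₜ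
          (q : Γ →ₗ[k] D).rTensor _ (diagMul k Γ Γ N.carrier (u ⊗ₜ v)))) := by
      intro w u v
      induction w with
      | zero => simp
      | add w w' hw hw' => simp only [add_mul, TensorProduct.add_tmul, map_add, hw, hw']
      | tmul a b =>
        induction u with
        | zero => simp
        | add w w' hw hw' =>
          simp only [mul_add, TensorProduct.add_tmul, TensorProduct.tmul_add, map_add, hw, hw']
        | tmul c e =>
          induction v with
          | zero => simp
          | add w w' hw hw' => simp only [TensorProduct.tmul_add, map_add, hw, hw']
          | tmul f n => simp [diagMul_tmul, hact, mul_assoc]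
    induction m with
    | zero => simp
    | add u u' hu hu' => simp only [map_add, hu, hu']
    | tmul d y =>
      induction y with
      | zero => simp
      | add u u' hu hu' => simp only [TensorProduct.tmul_add, map_add, hu, hu']
      | tmul a n =>
        simp only [TensorProduct.map_tmul, LinearMap.rTensor_tmul, LinearMap.comp_apply, hact]
        rw [Bialgebra.comul_mul, h2, hφ]
        exact h1 _ _

/-- If `D → Γ` is a unital colinear map, then the comodules `Γ ⊗ N` are relatively injective over
`D`. -/
theorem relInj_corestrict {Γ D : Type} [CommRing Γ] [Bialgebra k Γ] [CommRing D] [HopfAlgebra k D]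
    (q : Γ →ₐc[k] D) (φ : D →ₗ[k] Γ)
    (hφ : ∀ d, (q : Γ →ₗ[k] D).rTensor Γ (Coalgebra.comul (R := k) (φ d)) =
      φ.lTensor D (Coalgebra.comul (R := k) d)) (hφ1 : φ 1 = 1) (N : Comod.{v} k Γ) :
    RelInj (((comodB (Bialgebra.counitBialgHom k Γ)).tensor N).corestrict q) := by
  refine ((relInj_reg_tensor (((Comod.reg k Γ).tensor N).corestrict q)).of_retract
    (regUnitHom _) (integralHom q φ hφ N) (fun n => ?_)).of_retract
    (((cotensorHom _).tensor (Comod.Hom.id N)).corestrict q)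
    (((regHom k Γ).tensor (Comod.Hom.id N)).corestrict q) (fun n => ?_)
  · change Γ ⊗[k] N.carrier at n
    change shear LinearMap.id (φ.rTensor (Γ ⊗[k] N.carrier) (1 ⊗ₜ n)) = n
    rw [LinearMap.rTensor_tmul, hφ1, shear_one_tmul, LinearMap.id_apply]
  · change cotensor (Bialgebra.counitBialgHom k Γ) ⊗[k] N.carrier at n
    change TensorProduct.map _ _ (TensorProduct.map _ _ n) = n
    induction n with
    | zero => simp
    | add u u' hu hu' => simp only [map_add, hu, hu']
    | tmul a x => rfl

end ComoduleMaps

/-! ### Dimension shifting -/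

section ChangeOfRings

universe v

variable {k Γ D : Type} [Field k] [CommRing Γ] [Bialgebra k Γ] [CommRing D] [Bialgebra k D]

/-- The coboundaries in the cobar complex of `N`, in degree `t`. -/
def cobarBd (N : Comod.{v} k Γ) : ∀ t, Submodule k (cobarStage N t).V
  | 0 => ⊥
  | t + 1 => LinearMap.range (cobarD N t)

theorem cobarD_eq_zero_of_mem_cobarBd {N : Comod.{v} k Γ} {t : ℕ} {z : (cobarStage N t).V}
    (hz : z ∈ cobarBd N t) : cobarD N t z = 0 := by
  cases t with
  | zero => rw [(Submodule.mem_bot k).1 hz, map_zero]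
  | succ t =>
    obtain ⟨y, rfl⟩ := hz
    exact cobarD_cobarD N t y

theorem cobarMap_mem_cobarBd {φ : Γ →ₐc[k] D} {N : Comod.{v} k Γ} {N' : Comod.{v} k D}
    (f : Comod.Hom φ N N') {t : ℕ} {z : (cobarStage N t).V} (hz : z ∈ cobarBd N t) :
    cobarMap f t z ∈ cobarBd N' t := by
  cases t with
  | zero => rw [(Submodule.mem_bot k).1 hz, map_zero]; exact zero_mem _
  | succ t =>
    obtain ⟨y, rfl⟩ := hz
    exact ⟨cobarMap f t y, (cobarMap_cobarD f t y).symm⟩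

theorem exists_mem_cobarBd {N N' : Comod.{v} k Γ} (f : Comod.Hom (BialgHom.id k Γ) N N')
    (hf : Function.Surjective f.lin) {t : ℕ} {z : (cobarStage N' t).V} (hz : z ∈ cobarBd N' t) :
    ∃ y ∈ cobarBd N t, cobarMap f t y = z := by
  cases t with
  | zero => exact ⟨0, zero_mem _, by rw [(Submodule.mem_bot k).1 hz, map_zero]⟩
  | succ t =>
    obtain ⟨y, rfl⟩ := hz
    obtain ⟨x, rfl⟩ := Cobar.cobarMap_surjective f hf t y
    exact ⟨cobarD N t x, ⟨x, rfl⟩, cobarMap_cobarD f t x⟩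

/-- The map of cobar complexes induced by `f` is surjective on cohomology in degree `t`. -/
def CohSurj {φ : Γ →ₐc[k] D} {N : Comod.{v} k Γ} {N' : Comod.{v} k D} (f : Comod.Hom φ N N')
    (t : ℕ) : Prop :=
  ∀ z', cobarD N' t z' = 0 → ∃ z, cobarD N t z = 0 ∧ cobarMap f t z - z' ∈ cobarBd N' t

/-- The map of cobar complexes induced by `f` is injective on cohomology in degree `t`. -/
def CohInj {φ : Γ →ₐc[k] D} {N : Comod.{v} k Γ} {N' : Comod.{v} k D} (f : Comod.Hom φ N N')
    (t : ℕ) : Prop :=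
  ∀ z, cobarD N t z = 0 → cobarMap f t z ∈ cobarBd N' t → z ∈ cobarBd N t

theorem tensor_injective (X : Comod.{0} k Γ) {N N' : Comod.{v} k Γ}
    (f : Comod.Hom (BialgHom.id k Γ) N N') (hf : Function.Injective f.lin) :
    Function.Injective ((Comod.Hom.id X).tensor f).lin :=
  Module.Flat.lTensor_preserves_injective_linearMap (M := X.carrier) _ hf

theorem tensor_surjective (X : Comod.{0} k Γ) {N N' : Comod.{v} k Γ}
    (f : Comod.Hom (BialgHom.id k Γ) N N') (hf : Function.Surjective f.lin) :
    Function.Surjective ((Comod.Hom.id X).tensor f).lin :=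
  LinearMap.lTensor_surjective X.carrier hf

theorem tensor_exact (X : Comod.{0} k Γ) {N N' N'' : Comod.{v} k Γ}
    (f : Comod.Hom (BialgHom.id k Γ) N N') (g : Comod.Hom (BialgHom.id k Γ) N' N'')
    (h : Function.Exact f.lin g.lin) :
    Function.Exact ((Comod.Hom.id X).tensor f).lin ((Comod.Hom.id X).tensor g).lin :=
  Module.Flat.lTensor_exact X.carrier h

section FiveLemma

variable {q : Γ →ₐc[k] D} {N J L : Comod.{v} k Γ} {N' J' L' : Comod.{v} k D}
  {i : Comod.Hom (BialgHom.id k Γ) N J} {p : Comod.Hom (BialgHom.id k Γ) J L}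
  {i' : Comod.Hom (BialgHom.id k D) N' J'} {p' : Comod.Hom (BialgHom.id k D) J' L'}
  {f : Comod.Hom q N N'} {g : Comod.Hom q J J'} {h : Comod.Hom q L L'}

/-- Dimension shifting: if `J'` is acyclic, then surjectivity for the cokernel in degree `t` gives
surjectivity in degree `t + 1`. -/
theorem CohSurj.succ (hi : Function.Injective i.lin) (hp : Function.Surjective p.lin)
    (hip : Function.Exact i.lin p.lin) (hi' : Function.Injective i'.lin)
    (hp' : Function.Surjective p'.lin) (hip' : Function.Exact i'.lin p'.lin)
    (hfi : ∀ n, g.lin (i.lin n) = i'.lin (f.lin n)) (hgp : ∀ n, h.lin (p.lin n) = p'.lin (g.lin n))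
    (hJ' : RelInj J') {t : ℕ} (hL : CohSurj h t) : CohSurj f (t + 1) := by
  intro z' hz'
  obtain ⟨y', hy'⟩ := hJ'.exists_cobarD (t := t) (z := cobarMap i' (t + 1) z')
    (by rw [← cobarMap_cobarD, hz', map_zero])
  have hi'p' : ∀ t x, cobarMap p' t (cobarMap i' t x) = 0 := fun t x =>
    (Cobar.cobarMap_exact i' p' hip' t).apply_apply_eq_zero x
  obtain ⟨w, hw, hwb⟩ := hL (cobarMap p' t y') (by rw [← cobarMap_cobarD, hy', hi'p'])
  obtain ⟨v, hv, hvw⟩ := exists_mem_cobarBd p' hp' hwb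
  obtain ⟨w, rfl⟩ := Cobar.cobarMap_surjective p hp t w
  have hgp' : ∀ x, cobarMap h t (cobarMap p t x) = cobarMap p' t (cobarMap g t x) :=
    cobarMap_comm p h g p' (fun _ => rfl) hgp t
  have hfi' : ∀ x, cobarMap g (t + 1) (cobarMap i (t + 1) x) =
      cobarMap i' (t + 1) (cobarMap f (t + 1) x) :=
    cobarMap_comm i g f i' (fun _ => rfl) hfi (t + 1)
  obtain ⟨a, ha⟩ := (Cobar.cobarMap_exact i' p' hip' t (cobarMap g t w - y' - v)).1
    (by rw [map_sub, map_sub, ← hgp', hvw, sub_self])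
  obtain ⟨z, hz⟩ := (Cobar.cobarMap_exact i p hip (t + 1) (cobarD J t w)).1
    (by rw [cobarMap_cobarD, hw])
  refine ⟨z, ?_, a, ?_⟩
  · apply Cobar.cobarMap_injective i hi
    rw [cobarMap_cobarD, hz, cobarD_cobarD, map_zero]
  · apply Cobar.cobarMap_injective i' hi'
    rw [cobarMap_cobarD, ha, map_sub, map_sub, map_sub, hy', cobarD_eq_zero_of_mem_cobarBd hv,
      sub_zero, ← hfi', hz, cobarMap_cobarD]

/-- Dimension shifting for injectivity, if `J` is acyclic. In degree `0` the cohomology of `J` need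
not vanish, so that surjectivity for the middle term is needed too. -/
theorem CohInj.succ (hi : Function.Injective i.lin) (hp : Function.Surjective p.lin)
    (hip : Function.Exact i.lin p.lin) (hip' : Function.Exact i'.lin p'.lin)
    (hfi : ∀ n, g.lin (i.lin n) = i'.lin (f.lin n)) (hgp : ∀ n, h.lin (p.lin n) = p'.lin (g.lin n))
    (hJ : RelInj J) {t : ℕ} (hg : CohSurj g t) (hL : CohInj h t) : CohInj f (t + 1) := by
  rintro z hz ⟨a, ha⟩
  obtain ⟨y, hy⟩ := hJ.exists_cobarD (t := t) (z := cobarMap i (t + 1) z)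
    (by rw [← cobarMap_cobarD, hz, map_zero])
  have hi'p' : ∀ t x, cobarMap p' t (cobarMap i' t x) = 0 := fun t x =>
    (Cobar.cobarMap_exact i' p' hip' t).apply_apply_eq_zero x
  have hip0 : ∀ t x, cobarMap p t (cobarMap i t x) = 0 := fun t x =>
    (Cobar.cobarMap_exact i p hip t).apply_apply_eq_zero x
  have hgp' : ∀ x, cobarMap h t (cobarMap p t x) = cobarMap p' t (cobarMap g t x) :=
    cobarMap_comm p h g p' (fun _ => rfl) hgp t
  have hfi' : ∀ x, cobarMap g (t + 1) (cobarMap i (t + 1) x) =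
      cobarMap i' (t + 1) (cobarMap f (t + 1) x) :=
    cobarMap_comm i g f i' (fun _ => rfl) hfi (t + 1)
  obtain ⟨y₀, hy₀, hb⟩ := hg (cobarMap g t y - cobarMap i' t a)
    (by rw [map_sub, ← cobarMap_cobarD, ← cobarMap_cobarD, hy, hfi', ha, sub_self])
  have h1 : cobarMap p t (y - y₀) ∈ cobarBd L t := by
    refine hL _ ?_ ?_
    · rw [← cobarMap_cobarD, map_sub, hy, hy₀, sub_zero, hip0]
    · rw [hgp']
      have h2 := cobarMap_mem_cobarBd p' ((cobarBd _ _).neg_mem hb)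
      have h3 : cobarMap p' t (cobarMap g t (y - y₀)) =
          cobarMap p' t (-(cobarMap g t y₀ - (cobarMap g t y - cobarMap i' t a))) := by
        simp only [map_sub, map_neg, hi'p']
        abel
      rwa [h3]
  obtain ⟨w, hw, hwp⟩ := exists_mem_cobarBd p hp h1
  obtain ⟨c, hc⟩ := (Cobar.cobarMap_exact i p hip t (y - y₀ - w)).1
    (by rw [map_sub _ _ w, hwp, sub_self])
  refine ⟨c, ?_⟩
  apply Cobar.cobarMap_injective i hi
  rw [cobarMap_cobarD, hc, map_sub, map_sub, hy₀, hy, cobarD_eq_zero_of_mem_cobarBd hw, sub_zero,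
    sub_zero]

end FiveLemma

/-! ### The change-of-rings isomorphism -/

/-- The vector space `V` with the trivial coaction. -/
def Comod.triv (k Γ : Type) [Field k] [CommRing Γ] [Bialgebra k Γ] (V : Type) [AddCommGroup V]
    [Module k V] : Comod.{0} k Γ where
  carrier := V
  coact := TensorProduct.mk k Γ V 1
  coassoc v := by simp [Algebra.TensorProduct.one_def]
  counit v := by simp

theorem cobarD_zero_eq_zero (N : Comod.{v} k Γ) (n : N.carrier) :
    cobarD N 0 n = 0 ↔ N.coact n = 1 ⊗ₜ n := by
  rw [eq_comm (a := N.coact n), ← sub_eq_zero (a := (1 : Γ) ⊗ₜ[k] n)]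
  rfl

theorem cohSurj_zero {q : Γ →ₐc[k] D} {N : Comod.{v} k Γ} {N' : Comod.{v} k D}
    (f : Comod.Hom q N N')
    (h : ∀ n, N'.coact n = 1 ⊗ₜ n → ∃ m, N.coact m = 1 ⊗ₜ m ∧ f.lin m = n) : CohSurj f 0 := by
  intro n hn
  obtain ⟨m, hm, hmn⟩ := h n ((cobarD_zero_eq_zero N' n).1 hn)
  exact ⟨m, (cobarD_zero_eq_zero N m).2 hm, (Submodule.mem_bot k).2 (sub_eq_zero.2 hmn)⟩

section

variable {H : Type} [CommRing H] [HopfAlgebra k H] (q : H →ₐc[k] D) (N : Comod.{v} k H)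

/-- The shear `b ⊗ n ↦ b n' ⊗ n''` identifies `B ⊗ N` with a subcomodule of the extended comodule
`Γ ⊗ N`. -/
def shearB : cotensor q ⊗[k] N.carrier →ₗ[k] H ⊗[k] N.carrier :=
  shear N.coact ∘ₗ (cotensor q).subtype.rTensor N.carrier

theorem shearB_injective : Function.Injective (shearB q N) :=
  (shear_coact_injective N).comp
    (Module.Flat.rTensor_preserves_injective_linearMap _ (cotensor q).injective_subtype)

theorem assoc_comul_one_tmul {X : Type*} [AddCommGroup X] [Module k X] (x : X) :
    TensorProduct.assoc k Γ Γ X ((Coalgebra.comul (R := k) (A := Γ)).rTensor X (1 ⊗ₜ x)) =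
      1 ⊗ₜ (1 ⊗ₜ x) := by
  rw [LinearMap.rTensor_tmul, Bialgebra.comul_one, Algebra.TensorProduct.one_def,
    TensorProduct.assoc_tmul]

theorem counitHom_lin (m : cotensor q ⊗[k] N.carrier) :
    (counitHom q N).lin m =
      counitLeft k H N.carrier ((cotensor q).subtype.rTensor N.carrier m) := by
  exact congrArg (TensorProduct.lid k N.carrier) (LinearMap.rTensor_comp_apply N.carrier
    (Coalgebra.counit (R := k) (A := H)) (cotensor q).subtype m)

/-- The coaction of `B ⊗ N`, after the shear, is the coaction of the extended comodule. -/
theorem shearB_colinear (m : cotensor q ⊗[k] N.carrier) :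
    (shearB q N).lTensor H (((comodB q).tensor N).coact m) = TensorProduct.assoc k H H N.carrier
      ((Coalgebra.comul (R := k) (A := H)).rTensor _ (shearB q N m)) := by
  have h1 := ((cotensorHom q).tensor (Comod.Hom.id N)).comm_id m
  refine (LinearMap.lTensor_comp_apply H _ _ _).trans ?_
  refine (congrArg ((shear N.coact).lTensor H) h1).trans ?_
  exact shear_coact_colinear N _

/-- The invariants of `B ⊗ N` correspond to elements `1 ⊗ n` of `Γ ⊗ N`. -/
theorem shearB_of_invariant (m : cotensor q ⊗[k] N.carrier)
    (hm : ((comodB q).tensor N).coact m = 1 ⊗ₜ m) :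
    shearB q N m = 1 ⊗ₜ (counitHom q N).lin m := by
  have h1 := shearB_colinear q N m
  rw [hm] at h1
  rw [← lTensor_counitLeft (shearB q N m), ← h1]
  have h2 : (counitHom q N).lin m = counitLeft k H N.carrier (shearB q N m) := by
    rw [counitHom_lin, ← counitLeft_shear]
    rfl
  rw [h2]
  rfl

theorem cohInj_counitHom_zero : CohInj (counitHom q N) 0 := by
  intro m hm hm0
  have h1 := shearB_of_invariant q N m ((cobarD_zero_eq_zero _ m).1 hm)
  have h2 : (counitHom q N).lin m = 0 := hm0
  have h3 : shearB q N m = 0 :=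
    (h1.trans (congrArg (fun y => (1 : H) ⊗ₜ[k] y) h2)).trans (TensorProduct.tmul_zero _ _)
  exact shearB_injective q N (h3.trans (map_zero _).symm)

end

section

variable {H : Type} [CommRing H] [HopfAlgebra k H] {K : Type} [CommRing K] [HopfAlgebra k K]
  (q : H →ₐc[k] K) (N : Comod.{v} k H)

/-- The coaction of `D` on a comodule over `Γ`. -/
def corCoact : N.carrier →ₗ[k] K ⊗[k] N.carrier := (N.corestrict q).coact

/-- The coaction of `Γ` on the second factor of `D ⊗ N`. -/
def trivCoact : K ⊗[k] N.carrier →ₗ[k] H ⊗[k] (K ⊗[k] N.carrier) :=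
  ((Comod.triv k H K).tensor N).coact

theorem map_shear_coact (z : H ⊗[k] N.carrier) :
    (q : H →ₗ[k] K).rTensor N.carrier (shear N.coact z) =
      shear (corCoact q N) ((q : H →ₗ[k] K).rTensor N.carrier z) := by
  induction z with
  | zero => simp
  | add u u' hu hu' => simp only [map_add, hu, hu']
  | tmul a x =>
    rw [shear_tmul, LinearMap.rTensor_tmul, shear_tmul]
    change _ = (LinearMap.mulLeft k _).rTensor N.carrier
      ((q : H →ₗ[k] K).rTensor N.carrier (N.coact x))
    generalize N.coact x = y
    induction y with
    | zero => simp
    | add u u' hu hu' => simp only [map_add, hu, hu']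
    | tmul b m => simp

/-- The map `(a ⊗ d) ⊗ n ↦ a n' ⊗ (d q(n'') ⊗ n''')`, where `n' ⊗ n'' ⊗ n'''` is the iterated
coaction on `n`. It is injective, and it turns the two maps from `Γ ⊗ N` to `(Γ ⊗ D) ⊗ N` with
equalizer `B ⊗ N` into maps which are easily compared on elements `S(n') ⊗ n''`. -/
def doubleShear : (H ⊗[k] K) ⊗[k] N.carrier →ₗ[k] H ⊗[k] (K ⊗[k] N.carrier) :=
  (shear (corCoact q N)).lTensor H ∘ₗ shear (trivCoact (K := K) N) ∘ₗ
    (TensorProduct.assoc k H K N.carrier).toLinearMap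

theorem doubleShear_injective : Function.Injective (doubleShear q N) :=
  (Module.Flat.lTensor_preserves_injective_linearMap _
    (shear_coact_injective (N.corestrict q))).comp
    ((shear_coact_injective ((Comod.triv k H K).tensor N)).comp
      (TensorProduct.assoc k H K N.carrier).injective)

theorem shear_trivCoact_tmul (a : H) (d : K) (n : N.carrier) :
    shear (trivCoact N) (a ⊗ₜ (d ⊗ₜ n)) =
      (TensorProduct.mk k K N.carrier d).lTensor H (shear N.coact (a ⊗ₜ n)) := by
  rw [shear_tmul, shear_tmul]
  change (LinearMap.mulLeft k a).rTensor _ (diagMul k H K N.carrier ((1 ⊗ₜ d) ⊗ₜ N.coact n)) = _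
  generalize N.coact n = y
  induction y with
  | zero => simp
  | add u u' hu hu' => simp only [TensorProduct.tmul_add, map_add, hu, hu']
  | tmul b m => simp [diagMul_tmul]

theorem doubleShear_one (w : H ⊗[k] N.carrier) :
    doubleShear q N (((TensorProduct.mk k H K).flip 1).rTensor N.carrier w) =
      (corCoact q N).lTensor H (shear N.coact w) := by
  induction w with
  | zero => simp
  | add u u' hu hu' => simp only [map_add, hu, hu']
  | tmul a n =>
    have h1 : shear (corCoact q N) ∘ₗ TensorProduct.mk k K N.carrier 1 = corCoact q N :=
      LinearMap.ext (shear_one_tmul _)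
    simp only [doubleShear, LinearMap.comp_apply, LinearMap.rTensor_tmul, LinearMap.flip_apply,
      TensorProduct.mk_apply, LinearEquiv.coe_coe, TensorProduct.assoc_tmul]
    rw [shear_trivCoact_tmul, ← LinearMap.lTensor_comp_apply, h1]

theorem doubleShear_comul (w : H ⊗[k] N.carrier) :
    doubleShear q N (((q : H →ₗ[k] K).lTensor H ∘ₗ
      Coalgebra.comul (R := k) (A := H)).rTensor N.carrier w) =
      ((q : H →ₗ[k] K).rTensor N.carrier).lTensor H (TensorProduct.assoc k H H N.carrier
        ((Coalgebra.comul (R := k) (A := H)).rTensor N.carrier (shear N.coact w))) := by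
  rw [← shear_coact_colinear, ← LinearMap.lTensor_comp_apply,
    show (q : H →ₗ[k] K).rTensor N.carrier ∘ₗ shear N.coact =
      shear (corCoact q N) ∘ₗ (q : H →ₗ[k] K).rTensor N.carrier from
      LinearMap.ext (map_shear_coact q N), LinearMap.lTensor_comp_apply, doubleShear,
    LinearMap.comp_apply, LinearMap.comp_apply]
  refine congrArg ((shear (corCoact q N)).lTensor H) ?_
  induction w with
  | zero => simp
  | add u u' hu hu' => simp only [map_add, hu, hu']
  | tmul a n =>
    rw [TensorProduct.map_tmul, LinearMap.rTensor_tmul, LinearMap.comp_apply]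
    generalize Coalgebra.comul (R := k) a = y
    induction y with
    | zero => simp
    | add u u' hu hu' => simp only [TensorProduct.add_tmul, map_add, hu, hu']
    | tmul b c =>
      rw [LinearMap.lTensor_tmul, LinearEquiv.coe_coe, TensorProduct.assoc_tmul,
        shear_trivCoact_tmul, shear_tmul]
      generalize N.coact n = y
      induction y with
      | zero => simp
      | add u u' hu hu' => simp only [TensorProduct.tmul_add, map_add, hu, hu']
      | tmul e m => simp [diagMul_tmul]

/-- For an element `n` of `N` which is invariant over `D`, the element `S(n') ⊗ n''` belongs to
`B ⊗ N`. -/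
theorem antiCoact_mem (n : N.carrier) (hn : corCoact q N n = 1 ⊗ₜ n) :
    ∃ m, (cotensor q).subtype.rTensor N.carrier m = antiCoact N n := by
  have hex := Module.Flat.rTensor_exact (R := k) N.carrier
    (f := (cotensor q).subtype) (g := (q : H →ₗ[k] K).lTensor H ∘ₗ
      Coalgebra.comul (R := k) (A := H) - (TensorProduct.mk k H K).flip 1)
    (LinearMap.exact_subtype_ker_map _)
  refine (hex _).1 ?_
  rw [LinearMap.rTensor_sub, LinearMap.sub_apply, sub_eq_zero]
  apply doubleShear_injective q N
  rw [doubleShear_one, doubleShear_comul, shear_coact_antiCoact, assoc_comul_one_tmul]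
  rw [LinearMap.lTensor_tmul, LinearMap.lTensor_tmul, LinearMap.rTensor_tmul, hn]
  congr 2
  exact map_one q

theorem counitHom_of_shearB {n : N.carrier} {m : cotensor q ⊗[k] N.carrier}
    (h : shearB q N m = 1 ⊗ₜ n) : (counitHom q N).lin m = n := by
  rw [counitHom_lin, ← counitLeft_shear]
  refine (congrArg (counitLeft k H N.carrier) h).trans ?_
  rw [counitLeft_tmul, Bialgebra.counit_one, one_smul]

theorem coact_of_shearB {n : N.carrier} {m : cotensor q ⊗[k] N.carrier}
    (h : shearB q N m = 1 ⊗ₜ n) : ((comodB q).tensor N).coact m = 1 ⊗ₜ m := by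
  have hinj : Function.Injective ((shearB q N).lTensor H) :=
    Module.Flat.lTensor_preserves_injective_linearMap _ (shearB_injective q N)
  apply hinj
  refine (shearB_colinear q N m).trans ?_
  rw [h, assoc_comul_one_tmul]
  exact congrArg (fun y => (1 : H) ⊗ₜ[k] y) h.symm

theorem exists_shearB (n : N.carrier) (hn : corCoact q N n = 1 ⊗ₜ n) :
    ∃ m, shearB q N m = 1 ⊗ₜ n := by
  obtain ⟨m, hm⟩ := antiCoact_mem q N n hn
  exact ⟨m, by rw [shearB, LinearMap.comp_apply, hm, shear_coact_antiCoact]⟩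

theorem cohSurj_counitHom_zero : CohSurj (counitHom q N) 0 :=
  cohSurj_zero _ fun n hn => by
    obtain ⟨m, hm⟩ := exists_shearB q N n hn
    exact ⟨m, coact_of_shearB q N hm, counitHom_of_shearB q N hm⟩

theorem counitHom_tensor {N N' : Comod.{v} k H} (f : Comod.Hom (BialgHom.id k H) N N')
    (m : cotensor q ⊗[k] N.carrier) :
    (counitHom q N').lin (((Comod.Hom.id (comodB q)).tensor f).lin m) =
      f.lin ((counitHom q N).lin m) := by
  have h : (counitHom q N').lin ∘ₗ ((Comod.Hom.id (comodB q)).tensor f).lin =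
      f.lin ∘ₗ (counitHom q N).lin := by
    refine TensorProduct.ext' fun b n => ?_
    exact (map_smul f.lin _ n).symm
  exact LinearMap.congr_fun h m

/-- The change-of-rings isomorphism `Ext_Γ(k, B ⊗ N) ≅ Ext_D(k, N)`, in each degree. Both sides
vanish in positive degrees for the comodules `Γ ⊗ N`, over `D` because of the colinear map `φ`,
which allows for dimension shifting along the embeddings of `N` in `Γ ⊗ N`. -/
theorem coh_counitHom (φ : K →ₗ[k] H)
    (hφ : ∀ d, (q : H →ₗ[k] K).rTensor H (Coalgebra.comul (R := k) (φ d)) =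
      φ.lTensor K (Coalgebra.comul (R := k) d)) (hφ1 : φ 1 = 1) (t : ℕ) :
    ∀ N : Comod.{v} k H, CohSurj (counitHom q N) t ∧ CohInj (counitHom q N) t := by
  induction t with
  | zero => exact fun N => ⟨cohSurj_counitHom_zero q N, cohInj_counitHom_zero q N⟩
  | succ t ih =>
    intro N
    let ε := Bialgebra.counitBialgHom k H
    have hi := unitHom_injective ε N
    have hp := projHom_surjective ε N
    have hip := unitHom_projHom_exact ε N
    have hi2 := tensor_injective (comodB q) _ hi
    have hp2 := tensor_surjective (comodB q) _ hp
    have hip2 := tensor_exact (comodB q) _ _ hip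
    exact ⟨CohSurj.succ (i := (Comod.Hom.id (comodB q)).tensor (unitHom ε N))
        (p := (Comod.Hom.id (comodB q)).tensor (projHom ε N)) (i' := (unitHom ε N).corestrict q)
        (p' := (projHom ε N).corestrict q) hi2 hp2 hip2 hi hp hip
        (counitHom_tensor q (unitHom ε N)) (counitHom_tensor q (projHom ε N))
        (relInj_corestrict q φ hφ hφ1 N) (ih _).1,
      CohInj.succ (i := (Comod.Hom.id (comodB q)).tensor (unitHom ε N))
        (p := (Comod.Hom.id (comodB q)).tensor (projHom ε N)) (i' := (unitHom ε N).corestrict q)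
        (p' := (projHom ε N).corestrict q) hi2 hp2 hip2 hip
        (counitHom_tensor q (unitHom ε N)) (counitHom_tensor q (projHom ε N))
        (relInj_tensor_cofree _ N) (ih _).1 (ih _).2⟩

end

end ChangeOfRings

/-! ### Gradings of vector spaces and tensor products -/

section Gradings

variable {k : Type} [Field k] {V W U : Type*} [AddCommGroup V] [Module k V] [AddCommGroup W]
  [Module k W] [AddCommGroup U] [Module k U] {ι : Type*} [DecidableEq ι]

/-- The element `y` is homogeneous of degree `v`. -/
def IsHom (p : ι → V →ₗ[k] V) (v : ι) (y : V) : Prop := ∀ u, p u y = if u = v then y else 0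

/-- Operators are the projections of a grading if the homogeneous elements span. -/
theorem isGrading_of_span {p : ι → V →ₗ[k] V}
    (h : Submodule.span k {y | ∃ v, IsHom p v y} = ⊤) : IsGrading fun u => ⇑(p u) where
  proj u v x := by
    have hx : x ∈ Submodule.span k {y | ∃ v, IsHom p v y} := h ▸ Submodule.mem_top
    induction hx using Submodule.span_induction with
    | mem y hy =>
      obtain ⟨w, hw⟩ := hy
      rw [hw v]
      by_cases hvw : v = w
      · rw [if_pos hvw, hw u, hvw]
      · rw [if_neg hvw, map_zero, ite_self]
    | zero => simp
    | add y z _ _ hy hz => rw [map_add, map_add, hy, hz]; split_ifs <;> simp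
    | smul c y _ hy => rw [map_smul, map_smul, hy]; split_ifs <;> simp
  total x := by
    have hx : x ∈ Submodule.span k {y | ∃ v, IsHom p v y} := h ▸ Submodule.mem_top
    induction hx using Submodule.span_induction with
    | mem y hy =>
      obtain ⟨w, hw⟩ := hy
      refine ⟨{w}, fun t ht => ?_⟩
      simp only [hw _]
      rw [Finset.sum_ite_eq' t w, if_pos (ht (Finset.mem_singleton_self w))]
    | zero => exact ⟨∅, by simp⟩
    | add y z _ _ hy hz =>
      obtain ⟨s, hs⟩ := hy
      obtain ⟨s', hs'⟩ := hz
      refine ⟨s ∪ s', fun t ht => ?_⟩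
      simp only [map_add, Finset.sum_add_distrib]
      rw [hs t (Finset.union_subset_left ht), hs' t (Finset.union_subset_right ht)]
    | smul c y _ hy =>
      obtain ⟨s, hs⟩ := hy
      refine ⟨s, fun t ht => ?_⟩
      simp only [map_smul, ← Finset.smul_sum]
      rw [hs t ht]

theorem IsHom.zero {p : ι → V →ₗ[k] V} {v : ι} : IsHom p v 0 := fun u => by simp

theorem IsHom.add {p : ι → V →ₗ[k] V} {v : ι} {x y : V} (hx : IsHom p v x) (hy : IsHom p v y) :
    IsHom p v (x + y) := by
  intro u
  rw [map_add, hx u, hy u]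
  split_ifs <;> simp

theorem IsHom.smul {p : ι → V →ₗ[k] V} {v : ι} {x : V} (hx : IsHom p v x) (c : k) :
    IsHom p v (c • x) := by
  intro u
  rw [map_smul, hx u]
  split_ifs <;> simp

theorem IsHom.sum {p : ι → V →ₗ[k] V} {v : ι} {κ : Type*} {s : Finset κ} {f : κ → V}
    (h : ∀ i ∈ s, IsHom p v (f i)) : IsHom p v (∑ i ∈ s, f i) :=
  Finset.sum_induction f (IsHom p v) (fun _ _ => IsHom.add) IsHom.zero h

theorem IsGrading.isHom {p : ι → V →ₗ[k] V} (h : IsGrading fun u => ⇑(p u)) {v : ι} {y : V}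
    (hy : p v y = y) : IsHom p v y := by
  intro u
  rw [← hy, h.proj, hy]

theorem IsGrading.induction {p : ι → V →ₗ[k] V} (h : IsGrading fun u => ⇑(p u)) {P : V → Prop}
    (h0 : P 0) (hadd : ∀ x y, P x → P y → P (x + y)) (hom : ∀ v x, IsHom p v x → P x) (x : V) :
    P x := by
  obtain ⟨s, hs⟩ := h.total x
  rw [← hs s subset_rfl]
  exact Finset.sum_induction _ P hadd h0 fun v _ => hom v _ (h.isHom (h.idem v x))

/-- A map commutes with the projections if it preserves homogeneous elements. -/
theorem IsGrading.comm {p : ι → V →ₗ[k] V} {p' : ι → W →ₗ[k] W} (h : IsGrading fun u => ⇑(p u))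
    {f : V →ₗ[k] W} (hf : ∀ v x, IsHom p v x → IsHom p' v (f x)) (u : ι) (x : V) :
    f (p u x) = p' u (f x) := by
  refine h.induction (P := fun x => f (p u x) = p' u (f x)) ?_ ?_ ?_ x
  · simp
  · intro x y hx hy
    simp only [map_add, hx, hy]
  · intro v x hx
    rw [hx u, hf v x hx u]
    split_ifs
    · rfl
    · exact map_zero f

/-- The operators `p` are the projections of the grading `𝒱`. -/
structure GradedBy (p : ℕ → V →ₗ[k] V) (𝒱 : ℕ → Submodule k V) : Prop where
  grading : IsGrading fun u => ⇑(p u)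
  mem : ∀ u x, x ∈ 𝒱 u ↔ p u x = x

theorem GradedBy.isHom_iff {p : ℕ → V →ₗ[k] V} {𝒱 : ℕ → Submodule k V} (h : GradedBy p 𝒱) {v : ℕ}
    {x : V} : IsHom p v x ↔ x ∈ 𝒱 v :=
  ⟨fun hx => (h.mem v x).2 (by rw [hx v, if_pos rfl]), fun hx => h.grading.isHom ((h.mem v x).1 hx)⟩

theorem exists_gradedBy {𝒱 : ℕ → Submodule k V} (h : DirectSum.IsInternal 𝒱) :
    ∃ p, GradedBy p 𝒱 := by
  let e := LinearEquiv.ofBijective (DirectSum.coeLinearMap 𝒱) h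
  let p : ℕ → V →ₗ[k] V := fun u =>
    (𝒱 u).subtype ∘ₗ DirectSum.component k ℕ (fun u => 𝒱 u) u ∘ₗ e.symm.toLinearMap
  have he : ∀ v (x : 𝒱 v), e.symm x = DirectSum.lof k ℕ (fun u => 𝒱 u) v x := by
    intro v x
    rw [LinearEquiv.symm_apply_eq]
    exact (DirectSum.coeLinearMap_lof 𝒱 v x).symm
  have hp : ∀ v, ∀ x ∈ 𝒱 v, IsHom p v x := by
    intro v x hx u
    simp only [p, LinearMap.comp_apply, LinearEquiv.coe_coe]
    rw [he v ⟨x, hx⟩]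
    split_ifs with huv
    · subst huv
      rw [DirectSum.component.lof_self]
      rfl
    · rw [DirectSum.component.of, dif_neg (Ne.symm huv), map_zero]
  refine ⟨p, isGrading_of_span ?_, fun u x => ⟨fun hx => by rw [hp u x hx u, if_pos rfl], ?_⟩⟩
  · rw [eq_top_iff, ← h.submodule_iSup_eq_top]
    exact iSup_le fun v x hx => Submodule.subset_span ⟨v, hp v x hx⟩
  · intro hx
    rw [← hx]
    exact Subtype.property _

/-- The projections of the tensor product grading. -/
def tensorProj (p : ℕ → V →ₗ[k] V) (p' : ℕ → W →ₗ[k] W) (u : ℕ) : V ⊗[k] W →ₗ[k] V ⊗[k] W :=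
  ∑ i ∈ Finset.HasAntidiagonal.antidiagonal u, TensorProduct.map (p i.1) (p' i.2)

section Tensor

variable {p : ℕ → V →ₗ[k] V} {p' : ℕ → W →ₗ[k] W} {p'' : ℕ → U →ₗ[k] U}

theorem tensorProj_tmul (u : ℕ) (x : V) (y : W) : tensorProj p p' u (x ⊗ₜ y) =
    ∑ i ∈ Finset.HasAntidiagonal.antidiagonal u, p i.1 x ⊗ₜ p' i.2 y := by
  simp [tensorProj, LinearMap.sum_apply]

theorem IsHom.tensorProj_add {v : ℕ} {x : V} (hx : IsHom p v x) (u : ℕ) (y : W) :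
    tensorProj p p' (v + u) (x ⊗ₜ y) = x ⊗ₜ p' u y := by
  rw [tensorProj_tmul, Finset.sum_eq_single (v, u)]
  · rw [hx v, if_pos rfl]
  · rintro ⟨i, j⟩ hij hne
    rw [Finset.HasAntidiagonal.mem_antidiagonal] at hij
    rw [hx i, if_neg, TensorProduct.zero_tmul]
    rintro rfl
    exact hne (Prod.ext rfl (Nat.add_left_cancel hij))
  · intro h
    exact absurd (Finset.HasAntidiagonal.mem_antidiagonal.2
      (rfl : ((v, u) : ℕ × ℕ).1 + ((v, u) : ℕ × ℕ).2 = v + u)) h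

theorem IsHom.tensorProj_lt {v : ℕ} {x : V} (hx : IsHom p v x) {u : ℕ} (hu : u < v) (y : W) :
    tensorProj p p' u (x ⊗ₜ y) = 0 := by
  rw [tensorProj_tmul]
  refine Finset.sum_eq_zero ?_
  rintro ⟨i, j⟩ hij
  rw [Finset.HasAntidiagonal.mem_antidiagonal] at hij
  rw [hx i, if_neg (by rintro rfl; simp at hij; omega), TensorProduct.zero_tmul]

theorem IsHom.tmul {v w : ℕ} {x : V} {y : W} (hx : IsHom p v x) (hy : IsHom p' w y) :
    IsHom (tensorProj p p') (v + w) (x ⊗ₜ y) := by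
  intro u
  by_cases hu : u < v
  · rw [hx.tensorProj_lt hu, if_neg (by omega)]
  · obtain ⟨u, rfl⟩ := Nat.exists_eq_add_of_le (not_lt.1 hu)
    rw [hx.tensorProj_add, hy u]
    simp only [Nat.add_left_cancel_iff]
    split_ifs <;> simp

theorem map_proj_mem_span (hp : IsGrading fun u => ⇑(p u)) (hp' : IsGrading fun u => ⇑(p' u))
    (v w : ℕ) (z : V ⊗[k] W) : TensorProduct.map (p v) (p' w) z ∈
      Submodule.span k {z : V ⊗[k] W | ∃ x y, IsHom p v x ∧ IsHom p' w y ∧ x ⊗ₜ y = z} := by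
  induction z with
  | zero => rw [map_zero]; exact zero_mem _
  | add z z' hz hz' => rw [map_add]; exact add_mem hz hz'
  | tmul x y =>
    exact Submodule.subset_span ⟨_, _, hp.isHom (hp.idem _ _), hp'.isHom (hp'.idem _ _), rfl⟩

/-- The homogeneous tensors are sums of tensor products of homogeneous elements. -/
theorem IsHom.mem_span (hp : IsGrading fun u => ⇑(p u)) (hp' : IsGrading fun u => ⇑(p' u))
    {u : ℕ} {z : V ⊗[k] W} (hz : IsHom (tensorProj p p') u z) :
    z ∈ Submodule.span k {z : V ⊗[k] W | ∃ v w x y, IsHom p v x ∧ IsHom p' w y ∧ v + w = u ∧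
      x ⊗ₜ y = z} := by
  have h := hz u
  rw [if_pos rfl] at h
  rw [← h, tensorProj, LinearMap.sum_apply]
  refine Submodule.sum_mem _ fun i hi => ?_
  refine Submodule.span_mono ?_ (map_proj_mem_span hp hp' i.1 i.2 z)
  rintro _ ⟨x, y, hx, hy, rfl⟩
  exact ⟨i.1, i.2, x, y, hx, hy, Finset.HasAntidiagonal.mem_antidiagonal.1 hi, rfl⟩

theorem span_tmul_eq_top (hp : IsGrading fun u => ⇑(p u)) (hp' : IsGrading fun u => ⇑(p' u)) :
    Submodule.span k {z : V ⊗[k] W | ∃ v w x y, IsHom p v x ∧ IsHom p' w y ∧ z = x ⊗ₜ y} = ⊤ := by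
  rw [eq_top_iff]
  rintro z -
  induction z with
  | zero => exact zero_mem _
  | add z z' hz hz' => exact add_mem hz hz'
  | tmul x y =>
    refine hp.induction (P := fun x => x ⊗ₜ y ∈ _) ?_ ?_ ?_ x
    · rw [TensorProduct.zero_tmul]; exact zero_mem _
    · intro x x' hx hx'
      rw [TensorProduct.add_tmul]; exact add_mem hx hx'
    · intro v x hx
      refine hp'.induction (P := fun y => x ⊗ₜ y ∈ _) ?_ ?_ ?_ y
      · rw [TensorProduct.tmul_zero]; exact zero_mem _
      · intro y y' hy hy'
        rw [TensorProduct.tmul_add]; exact add_mem hy hy'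
      · intro w y hy
        exact Submodule.subset_span ⟨v, w, x, y, hx, hy, rfl⟩

theorem IsGrading.tensor (hp : IsGrading fun u => ⇑(p u)) (hp' : IsGrading fun u => ⇑(p' u)) :
    IsGrading fun u => ⇑(tensorProj p p' u) := by
  refine isGrading_of_span (eq_top_iff.2 ((span_tmul_eq_top hp hp').ge.trans ?_))
  refine Submodule.span_mono ?_
  rintro _ ⟨v, w, x, y, hx, hy, rfl⟩
  exact ⟨v + w, hx.tmul hy⟩

theorem GradedBy.tensor {𝒱 : ℕ → Submodule k V} {𝒲 : ℕ → Submodule k W} (h : GradedBy p 𝒱)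
    (h' : GradedBy p' 𝒲) : GradedBy (tensorProj p p') (tensorDeg 𝒱 𝒲) where
  grading := h.grading.tensor h'.grading
  mem u z := by
    constructor
    · intro hz
      have hle : tensorDeg 𝒱 𝒲 u ≤ LinearMap.eqLocus (tensorProj p p' u) LinearMap.id := by
        refine iSup₂_le fun i hi => Submodule.map₂_le.2 fun x hx y hy => ?_
        have := (h.isHom_iff.2 hx).tmul (h'.isHom_iff.2 hy) u
        rwa [if_pos (Finset.HasAntidiagonal.mem_antidiagonal.1 hi).symm] at this
      exact hle hz
    · intro hz
      rw [← hz, tensorProj, LinearMap.sum_apply]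
      refine Submodule.sum_mem _ fun i hi => ?_
      have hle : ∀ z : V ⊗[k] W, TensorProduct.map (p i.1) (p' i.2) z ∈ tensorDeg 𝒱 𝒲 u := by
        intro z
        induction z with
        | zero => rw [map_zero]; exact zero_mem _
        | add z z' hz hz' => rw [map_add]; exact add_mem hz hz'
        | tmul x y =>
          refine Submodule.mem_iSup_of_mem i (Submodule.mem_iSup_of_mem hi ?_)
          exact Submodule.apply_mem_map₂ _ ((h.mem _ _).2 (h.grading.idem _ _))
            ((h'.mem _ _).2 (h'.grading.idem _ _))
      exact hle z

theorem map_tensorProj {V' W' : Type*} [AddCommGroup V'] [Module k V'] [AddCommGroup W']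
    [Module k W'] {r : ℕ → V' →ₗ[k] V'} {r' : ℕ → W' →ₗ[k] W'} {f : V →ₗ[k] V'} {g : W →ₗ[k] W'}
    (hf : ∀ u x, f (p u x) = r u (f x)) (hg : ∀ u x, g (p' u x) = r' u (g x)) (u : ℕ)
    (z : V ⊗[k] W) : TensorProduct.map f g (tensorProj p p' u z) =
      tensorProj r r' u (TensorProduct.map f g z) := by
  induction z with
  | zero => simp
  | add z z' hz hz' => simp only [map_add, hz, hz']
  | tmul x y => simp only [tensorProj_tmul, map_sum, TensorProduct.map_tmul, hf, hg]

theorem assoc_tensorProj (hp : IsGrading fun u => ⇑(p u)) (hp' : IsGrading fun u => ⇑(p' u))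
    (hp'' : IsGrading fun u => ⇑(p'' u)) (u : ℕ) (z : (V ⊗[k] W) ⊗[k] U) :
    TensorProduct.assoc k V W U (tensorProj (tensorProj p p') p'' u z) =
      tensorProj p (tensorProj p' p'') u (TensorProduct.assoc k V W U z) := by
  have h : ∀ z : V ⊗[k] W, ∀ w y, IsHom p'' w y →
      TensorProduct.assoc k V W U (tensorProj (tensorProj p p') p'' u (z ⊗ₜ y)) =
      tensorProj p (tensorProj p' p'') u (TensorProduct.assoc k V W U (z ⊗ₜ y)) := by
    intro z w y hy
    have hz : z ∈ Submodule.span k {z : V ⊗[k] W | ∃ v w x y, IsHom p v x ∧ IsHom p' w y ∧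
      z = x ⊗ₜ y} := (span_tmul_eq_top hp hp').symm ▸ Submodule.mem_top
    induction hz using Submodule.span_induction with
    | mem _ h =>
      obtain ⟨v, v', x, x', hx, hx', rfl⟩ := h
      rw [(hx.tmul hx').tmul hy u, TensorProduct.assoc_tmul, hx.tmul (hx'.tmul hy) u, add_assoc]
      split_ifs <;> simp
    | zero => simp
    | add z z' _ _ hz hz' => simp only [TensorProduct.add_tmul, map_add, hz, hz']
    | smul c z _ hz => simp only [← TensorProduct.smul_tmul', map_smul, hz]
  induction z with
  | zero => simp
  | add z z' hz hz' => simp only [map_add, hz, hz']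
  | tmul z y =>
    refine hp''.induction (P := fun y => TensorProduct.assoc k V W U
      (tensorProj (tensorProj p p') p'' u (z ⊗ₜ y)) =
      tensorProj p (tensorProj p' p'') u (TensorProduct.assoc k V W U (z ⊗ₜ y))) ?_ ?_ ?_ y
    · simp
    · intro y y' hy hy'
      simp only [TensorProduct.tmul_add, map_add, hy, hy']
    · exact h z

end Tensor

/-- The projections `p`, with index extended by zero to the integers. -/
def zext (p : ℕ → V →ₗ[k] V) (u : ℤ) : V →ₗ[k] V := if 0 ≤ u then p u.toNat else 0

theorem zext_natCast (p : ℕ → V →ₗ[k] V) (u : ℕ) : zext p u = p u := by simp [zext]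

theorem zext_of_neg (p : ℕ → V →ₗ[k] V) {u : ℤ} (hu : u < 0) : zext p u = 0 := if_neg (by omega)

theorem IsGrading.zext_idem {p : ℕ → V →ₗ[k] V} (h : IsGrading fun u => ⇑(p u)) (u : ℤ) (x : V) :
    zext p u (zext p u x) = zext p u x := by
  rcases lt_or_ge u 0 with hu | hu
  · simp [zext_of_neg _ hu]
  · lift u to ℕ using hu
    rw [zext_natCast]
    exact h.idem u x

theorem zext_comm {p : ℕ → V →ₗ[k] V} {p' : ℕ → W →ₗ[k] W} {f : V →ₗ[k] W}
    (h : ∀ u x, f (p u x) = p' u (f x)) (u : ℤ) (x : V) : f (zext p u x) = zext p' u (f x) := by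
  rcases lt_or_ge u 0 with hu | hu
  · simp [zext_of_neg _ hu]
  · lift u to ℕ using hu
    rw [zext_natCast, zext_natCast, h]

theorem IsHom.zext_apply {p : ℕ → V →ₗ[k] V} {v : ℕ} {x : V} (hx : IsHom p v x) (u : ℤ) :
    zext p u x = if u = v then x else 0 := by
  rcases lt_or_ge u 0 with hu | hu
  · rw [zext_of_neg _ hu, if_neg (by omega), LinearMap.zero_apply]
  · lift u to ℕ using hu
    rw [zext_natCast, hx u]
    simp only [Nat.cast_inj]

theorem IsHom.zext_tmul {p : ℕ → V →ₗ[k] V} {p' : ℕ → W →ₗ[k] W} {v : ℕ} {x : V}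
    (hx : IsHom p v x) (u : ℤ) (y : W) :
    zext (tensorProj p p') (u + v) (x ⊗ₜ y) = x ⊗ₜ zext p' u y := by
  rcases lt_or_ge u 0 with hu | hu
  · rw [zext_of_neg p' hu, LinearMap.zero_apply, TensorProduct.tmul_zero]
    rcases lt_or_ge (u + v) 0 with huv | huv
    · rw [zext_of_neg _ huv, LinearMap.zero_apply]
    · obtain ⟨w, hw⟩ := Int.eq_ofNat_of_zero_le huv
      rw [hw, zext_natCast, hx.tensorProj_lt (by omega)]
  · lift u to ℕ using hu
    rw [zext_natCast, ← Nat.cast_add, zext_natCast, add_comm, hx.tensorProj_add]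

end Gradings

/-! ### Graded bialgebras, graded comodules and their cobar complexes -/

section Multiplicative

variable {k A : Type} [Field k] [CommRing A] [Algebra k A] {p : ℕ → A →ₗ[k] A}

/-- The projections `p` define a grading of the algebra `A`. -/
structure IsMulGrading (p : ℕ → A →ₗ[k] A) : Prop where
  grading : IsGrading fun u => ⇑(p u)
  one : IsHom p 0 (1 : A)
  mul : ∀ {u v a b}, IsHom p u a → IsHom p v b → IsHom p (u + v) (a * b)

theorem IsMulGrading.pow (h : IsMulGrading p) {u : ℕ} {a : A} (ha : IsHom p u a) (n : ℕ) :
    IsHom p (n * u) (a ^ n) := by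
  induction n with
  | zero => simpa using h.one
  | succ n ih => rw [pow_succ, Nat.succ_mul]; exact h.mul ih ha

theorem IsMulGrading.tensor {A' : Type} [CommRing A'] [Algebra k A'] {p' : ℕ → A' →ₗ[k] A'}
    (h : IsMulGrading p) (h' : IsMulGrading p') : IsMulGrading (tensorProj p p') where
  grading := h.grading.tensor h'.grading
  one := h.one.tmul h'.one
  mul {u v a b} ha hb := by
    replace ha := ha.mem_span h.grading h'.grading
    replace hb := hb.mem_span h.grading h'.grading
    induction ha using Submodule.span_induction with
    | mem a ha =>
      obtain ⟨i, i', a, a', ha, ha', rfl, rfl⟩ := ha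
      induction hb using Submodule.span_induction with
      | mem b hb =>
        obtain ⟨j, j', b, b', hb, hb', rfl, rfl⟩ := hb
        rw [Algebra.TensorProduct.tmul_mul_tmul, add_add_add_comm]
        exact (h.mul ha hb).tmul (h'.mul ha' hb')
      | zero => rw [mul_zero]; exact IsHom.zero
      | add b b' _ _ hb hb' => rw [mul_add]; exact hb.add hb'
      | smul c b _ hb => rw [mul_smul_comm]; exact hb.smul c
    | zero => rw [zero_mul]; exact IsHom.zero
    | add b b' _ _ hb hb' => rw [add_mul]; exact hb.add hb'
    | smul c b _ hb => rw [smul_mul_assoc]; exact hb.smul c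

end Multiplicative

section GradedCobar

universe v

variable {k Γ D : Type} [Field k] [CommRing Γ] [Bialgebra k Γ] [CommRing D] [Bialgebra k D]

/-- The operators `p` are the projections of a grading of the bialgebra `Γ`. -/
structure IsGradedBialgebra (p : ℕ → Γ →ₗ[k] Γ) : Prop extends IsMulGrading p where
  comul_comm : ∀ u a,
    Coalgebra.comul (R := k) (p u a) = tensorProj p p u (Coalgebra.comul (R := k) a)
  counit : ∀ {v a}, v ≠ 0 → IsHom p v a → Coalgebra.counit (R := k) a = 0

/-- The operators `pN` are the projections of a grading of the comodule `N`. -/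
structure IsGradedComod (p : ℕ → Γ →ₗ[k] Γ) (N : Comod.{v} k Γ)
    (pN : ℕ → N.carrier →ₗ[k] N.carrier) : Prop where
  grading : IsGrading fun u => ⇑(pN u)
  coact_comm : ∀ u n, N.coact (pN u n) = tensorProj p pN u (N.coact n)

theorem tensorProj_diagMul {p : ℕ → Γ →ₗ[k] Γ} (hp : IsGradedBialgebra p) {X N : Type*}
    [AddCommGroup X] [Module k X] [AddCommGroup N] [Module k N] {pX : ℕ → X →ₗ[k] X}
    {pN : ℕ → N →ₗ[k] N} (hX : IsGrading fun u => ⇑(pX u)) (hN : IsGrading fun u => ⇑(pN u)) (u : ℕ)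
    (z : (Γ ⊗[k] X) ⊗[k] (Γ ⊗[k] N)) :
    diagMul k Γ X N (tensorProj (tensorProj p pX) (tensorProj p pN) u z) =
      tensorProj p (tensorProj pX pN) u (diagMul k Γ X N z) := by
  refine IsGrading.comm ((hp.grading.tensor hX).tensor (hp.grading.tensor hN)) ?_ u z
  intro v z hz
  replace hz := hz.mem_span (hp.grading.tensor hX) (hp.grading.tensor hN)
  induction hz using Submodule.span_induction with
  | mem z hz =>
    obtain ⟨i, j, a, b, ha, hb, rfl, rfl⟩ := hz
    replace ha := ha.mem_span hp.grading hX
    induction ha using Submodule.span_induction with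
    | mem a ha =>
      obtain ⟨i, i', a, a', ha, ha', rfl, rfl⟩ := ha
      replace hb := hb.mem_span hp.grading hN
      induction hb using Submodule.span_induction with
      | mem b hb =>
        obtain ⟨j, j', b, b', hb, hb', rfl, rfl⟩ := hb
        rw [diagMul_tmul, add_add_add_comm]
        exact (hp.mul ha hb).tmul (ha'.tmul hb')
      | zero => simp [IsHom.zero]
      | add b b' _ _ hb hb' => rw [TensorProduct.tmul_add, map_add]; exact hb.add hb'
      | smul c b _ hb => rw [TensorProduct.tmul_smul, map_smul]; exact hb.smul c
    | zero => simp [IsHom.zero]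
    | add b b' _ _ hb hb' => rw [TensorProduct.add_tmul, map_add]; exact hb.add hb'
    | smul c b _ hb => rw [← TensorProduct.smul_tmul', map_smul]; exact hb.smul c
  | zero => simp [IsHom.zero]
  | add b b' _ _ hb hb' => rw [map_add]; exact hb.add hb'
  | smul c b _ hb => rw [map_smul]; exact hb.smul c

theorem IsGradedComod.tensor {p : ℕ → Γ →ₗ[k] Γ} (hp : IsGradedBialgebra p) {X : Comod.{0} k Γ}
    {N : Comod.{v} k Γ} {pX : ℕ → X.carrier →ₗ[k] X.carrier} {pN : ℕ → N.carrier →ₗ[k] N.carrier}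
    (hX : IsGradedComod p X pX) (hN : IsGradedComod p N pN) :
    IsGradedComod p (X.tensor N) (tensorProj pX pN) where
  grading := hX.grading.tensor hN.grading
  coact_comm u z := by
    refine Eq.trans ?_ (tensorProj_diagMul hp hX.grading hN.grading u _)
    exact congrArg (diagMul k Γ X.carrier N.carrier)
      (map_tensorProj hX.coact_comm hN.coact_comm u z)

/-- The projections of the grading of the cobar cochains. -/
def stageProj (p : ℕ → Γ →ₗ[k] Γ) (N : Comod.{v} k Γ) (pN : ℕ → N.carrier →ₗ[k] N.carrier) :
    ∀ t, ℕ → (cobarStage N t).V →ₗ[k] (cobarStage N t).V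
  | 0 => pN
  | t + 1 => tensorProj p (stageProj p N pN t)

variable {p : ℕ → Γ →ₗ[k] Γ} {N : Comod.{v} k Γ} {pN : ℕ → N.carrier →ₗ[k] N.carrier}

theorem nextDel_comm {V : Type v} [AddCommGroup V] [Module k V] {del : V →ₗ[k] Γ ⊗[k] V}
    {pV : ℕ → V →ₗ[k] V} (hp : IsGradedBialgebra p) (hV : IsGrading fun u => ⇑(pV u))
    (h : ∀ u x, del (pV u x) = tensorProj p pV u (del x)) (u : ℕ) (z : Γ ⊗[k] V) :
    nextDel del (tensorProj p pV u z) = tensorProj p (tensorProj p pV) u (nextDel del z) := by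
  simp only [nextDel, LinearMap.sub_apply, LinearMap.comp_apply, map_sub, LinearEquiv.coe_coe]
  congr 1
  · rw [← assoc_tensorProj hp.grading hp.grading hV]
    exact congrArg _ (map_tensorProj (p' := pV) (r' := pV) (g := LinearMap.id)
      hp.comul_comm (fun _ _ => rfl) u z)
  · exact map_tensorProj (p := p) (r := p) (f := LinearMap.id) (fun _ _ => rfl) h u z

theorem stageProj_grading (hp : IsGradedBialgebra p) (hN : IsGradedComod p N pN) :
    ∀ t, IsGrading fun u => ⇑(stageProj p N pN t u)
  | 0 => hN.grading
  | t + 1 => hp.grading.tensor (stageProj_grading hp hN t)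

theorem gradedBy_stageProj {𝒢 : ℕ → Submodule k Γ} {𝒩 : ℕ → Submodule k N.carrier}
    (hp : GradedBy p 𝒢) (hN : GradedBy pN 𝒩) :
    ∀ t, GradedBy (stageProj p N pN t) (cobarDeg 𝒢 N 𝒩 t)
  | 0 => hN
  | t + 1 => hp.tensor (gradedBy_stageProj hp hN t)

theorem stage_del_comm (hp : IsGradedBialgebra p) (hN : IsGradedComod p N pN) :
    ∀ t u x, (cobarStage N t).del (stageProj p N pN t u x) =
      tensorProj p (stageProj p N pN t) u ((cobarStage N t).del x)
  | 0 => hN.coact_comm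
  | t + 1 => nextDel_comm hp (stageProj_grading hp hN t) (stage_del_comm hp hN t)

theorem cobarCons_one_comm (hp : IsGradedBialgebra p) (t u : ℕ) (x : (cobarStage N t).V) :
    cobarCons N t 1 (stageProj p N pN t u x) =
      stageProj p N pN (t + 1) u (cobarCons N t 1 x) := by
  have := (hp.one.tensorProj_add (p' := stageProj p N pN t) u x).symm
  rw [zero_add] at this
  exact this

theorem cobarD_comm (hp : IsGradedBialgebra p) (hN : IsGradedComod p N pN) (t u : ℕ)
    (x : (cobarStage N t).V) :
    cobarD N t (stageProj p N pN t u x) = stageProj p N pN (t + 1) u (cobarD N t x) := by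
  have h1 : ∀ y, cobarD N t y = cobarCons N t 1 y - cobarDel N t y := fun _ => rfl
  rw [h1, h1, map_sub, cobarCons_one_comm hp]
  congr 1
  exact stage_del_comm hp hN t u x

theorem cobarMap_proj {q : Γ →ₐc[k] D} {p' : ℕ → D →ₗ[k] D} {N' : Comod.{v} k D}
    {pN' : ℕ → N'.carrier →ₗ[k] N'.carrier} (hq : ∀ u a, q (p u a) = p' u (q a))
    (f : Comod.Hom q N N') (hf : ∀ u n, f.lin (pN u n) = pN' u (f.lin n)) :
    ∀ t u x, cobarMap f t (stageProj p N pN t u x) = stageProj p' N' pN' t u (cobarMap f t x)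
  | 0 => hf
  | t + 1 => map_tensorProj (f := (q : Γ →ₗ[k] D)) hq (cobarMap_proj hq f hf t)

/-- Multiplication by `b₁₀ = [ξ|ξ²] + [ξ²|ξ]` raises the internal degree by `12`. -/
theorem cobarB_comm {ξ : Prim k Γ} (h1 : IsHom p 4 ξ.val) (h2 : IsHom p 8 (ξ.val ^ 2)) (t : ℕ)
    (u : ℤ) (x : (cobarStage N t).V) :
    cobarB ξ N t (zext (stageProj p N pN t) u x) =
      zext (stageProj p N pN (t + 2)) (u + 12) (cobarB ξ N t x) := by
  have key : ∀ {a b : Γ} {v w : ℕ}, IsHom p v a → IsHom p w b →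
      cobarCons N (t + 1) a (cobarCons N t b (zext (stageProj p N pN t) u x)) =
      zext (stageProj p N pN (t + 2)) (u + w + v)
        (cobarCons N (t + 1) a (cobarCons N t b x)) := by
    intro a b v w ha hb
    have e1 := hb.zext_tmul (p' := stageProj p N pN t) u x
    have e2 := ha.zext_tmul (p' := stageProj p N pN (t + 1)) (u + w) (cobarCons N t b x)
    refine Eq.trans ?_ e2.symm
    exact congrArg (cobarCons N (t + 1) a) e1.symm
  have h3 : ∀ y, cobarB ξ N t y = cobarCons N (t + 1) ξ.val (cobarCons N t (ξ.val ^ 2) y) +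
    cobarCons N (t + 1) (ξ.val ^ 2) (cobarCons N t ξ.val y) := fun _ => rfl
  rw [h3, h3, key h1 h2, key h2 h1, map_add]
  congr 3 <;> (push_cast; ring)

end GradedCobar

/-! ### Gradings of complexes and of their cohomology -/

section GradedComplexes

universe v

variable {R : Type} [CommRing R] {x : R} {A B C : Type v} [AddCommGroup A] [Module R A]
  [AddCommGroup B] [Module R B] [AddCommGroup C] [Module R C] {dA : A →ₗ[R] A} {dB : B →ₗ[R] B}
  {dC : C →ₗ[R] C}

/-- The differential `dA` has degree `(1, 0)`. -/
def IsGradedDiff (dA : A →ₗ[R] A) (p : ℤ × ℤ → A →+ A) : Prop :=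
  ∀ t u a, dA (p (t, u) a) = p (t + 1, u) (dA a)

variable {p : ℤ × ℤ → A →+ A} {p' : ℤ × ℤ → B →+ B} {p'' : ℤ × ℤ → C →+ C}

theorem IsGradedDiff.mem_ker (h : IsGradedDiff dA p) (d : ℤ × ℤ) {a : A}
    (ha : a ∈ LinearMap.ker dA) : p d a ∈ LinearMap.ker dA := by
  rw [LinearMap.mem_ker] at ha ⊢
  rw [h d.1 d.2 a, ha, map_zero]

theorem Coh.mk_eq_mk {z z' : LinearMap.ker dA} :
    Coh.mk dA z = Coh.mk dA z' ↔ ∃ y, dA y = (z : A) - z' := by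
  rw [← sub_eq_zero, ← map_sub, Coh.mk_eq_zero]
  rfl

/-- The projections of the grading of the cohomology. -/
def cohProj (h : IsGradedDiff dA p) (d : ℤ × ℤ) : Coh dA →+ Coh dA :=
  QuotientAddGroup.lift _
    ((Coh.mk dA).toAddMonoidHom.comp
      (((p d).comp (LinearMap.ker dA).subtype.toAddMonoidHom).codRestrict (LinearMap.ker dA)
        fun z => h.mem_ker d z.2))
    (by
      rintro z ⟨y, hy⟩
      refine (Coh.mk_eq_zero _).2 ⟨p (d.1 - 1, d.2) y, ?_⟩
      rw [h, sub_add_cancel]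
      exact congrArg (p d) hy)

theorem cohProj_mk (h : IsGradedDiff dA p) (d : ℤ × ℤ) (z : LinearMap.ker dA) :
    cohProj h d (Coh.mk dA z) = Coh.mk dA ⟨p d z, h.mem_ker d z.2⟩ := rfl

theorem ExactCouple.IsBigrading.coh (hp : ExactCouple.IsBigrading x p) (h : IsGradedDiff dA p) :
    ExactCouple.IsBigrading x (cohProj h) where
  proj d d' y := by
    obtain ⟨z, rfl⟩ := Coh.mk_surjective y
    rw [cohProj_mk, cohProj_mk]
    split_ifs with hd
    · exact congrArg _ (Subtype.ext ((hp.proj d d' z).trans (if_pos hd)))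
    · exact (congrArg _ (Subtype.ext ((hp.proj d d' z).trans (if_neg hd)))).trans (map_zero _)
  total y := by
    obtain ⟨z, rfl⟩ := Coh.mk_surjective y
    obtain ⟨s, hs⟩ := hp.total (z : A)
    refine ⟨s, fun t ht => ?_⟩
    simp only [cohProj_mk]
    rw [← map_sum]
    refine congrArg _ (Subtype.ext ?_)
    exact (AddSubmonoidClass.coe_finsetSum _ _).trans (hs t ht)
  smul t u y := by
    obtain ⟨z, rfl⟩ := Coh.mk_surjective y
    rw [cohProj_mk, ← map_smul, ← map_smul, cohProj_mk]
    exact congrArg _ (Subtype.ext (hp.smul t u z))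

theorem cohProj_map (hA : IsGradedDiff dA p) (hB : IsGradedDiff dB p') (f : A →ₗ[R] B)
    (hf : ∀ x, f (dA x) = dB (f x)) (hfp : ∀ d a, f (p d a) = p' d (f a)) (d : ℤ × ℤ)
    (y : Coh dA) : Coh.map f hf (cohProj hA d y) = cohProj hB d (Coh.map f hf y) := by
  obtain ⟨z, rfl⟩ := Coh.mk_surjective y
  exact congrArg (Coh.mk dB) (Subtype.ext (hfp d z))

theorem cohProj_conn (hA : IsGradedDiff dA p) (hB : IsGradedDiff dB p')
    (hC : IsGradedDiff dC p'') (f : A →ₗ[R] B) (g : B →ₗ[R] C) (hf : ∀ x, f (dA x) = dB (f x))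
    (hg : ∀ x, g (dB x) = dC (g x)) (hfi : Function.Injective f) (hgs : Function.Surjective g)
    (hex : Function.Exact f g) (hdB : ∀ x, dB (dB x) = 0) (hfp : ∀ d a, f (p d a) = p' d (f a))
    (hgp : ∀ d a, g (p' d a) = p'' d (g a)) (t u : ℤ) (y : Coh dC) :
    Coh.conn f g hf hg hfi hex hdB hgs (cohProj hC (t, u) y) =
      cohProj hA (t + 1, u) (Coh.conn f g hf hg hfi hex hdB hgs y) := by
  obtain ⟨b, rfl⟩ := Coh.connProj_surjective g hg hgs y
  rw [Coh.conn_connProj, cohProj_mk]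
  refine Coh.conn_mk f g hf hg hfi hex hdB hgs (p' (t, u) b) _ _ (hgp _ _) ?_
  rw [hfp, Coh.connAux_spec, hB]

end GradedComplexes

/-! ### The total cobar complex and the bigrading of `Ext` -/

section TotalComplex

universe v

variable {k Γ D : Type} [Field k] [CommRing Γ] [Bialgebra k Γ] [CommRing D] [Bialgebra k D]

namespace Cobar

/-- The component in degree `t` of a cobar cochain. -/
def comp (ξ : Prim k Γ) (N : Comod.{v} k Γ) (t : ℕ) : Cobar ξ N →ₗ[k] (cobarStage N t).V :=
  DirectSum.component k ℕ (fun t => (cobarStage N t).V) t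

variable {ξ : Prim k Γ} {N : Comod.{v} k Γ}

theorem comp_of (t : ℕ) (x : (cobarStage N t).V) : comp ξ N t (of ξ N t x) = x :=
  DirectSum.component.lof_self k (M := fun t => (cobarStage N t).V) t x

theorem comp_of_ne {t t' : ℕ} (h : t' ≠ t) (x : (cobarStage N t').V) :
    comp ξ N t (of ξ N t' x) = 0 :=
  (DirectSum.component.of k (M := fun t => (cobarStage N t).V) t t' x).trans (dif_neg h)

theorem exists_sum_of (z : Cobar ξ N) :
    ∃ s : Finset ℕ, z = ∑ t ∈ s, of ξ N t (comp ξ N t z) := by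
  classical
  exact ⟨_, (DirectSum.sum_support_of (β := fun t => (cobarStage N t).V) z).symm⟩

theorem eq_zero_of_comp {z : Cobar ξ N} (h : ∀ t, comp ξ N t z = 0) : z = 0 := by
  obtain ⟨s, hs⟩ := exists_sum_of z
  rw [hs]
  exact Finset.sum_eq_zero fun t _ => by rw [h, map_zero]

theorem comp_d_zero (z : Cobar ξ N) : comp ξ N 0 (d ξ N z) = 0 := by
  induction z using induction with
  | h0 => simp
  | hof t x => rw [d_of, comp_of_ne (Nat.succ_ne_zero t)]
  | hadd x y hx hy => rw [map_add, map_add, hx, hy, add_zero]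

theorem comp_d_succ (t : ℕ) (z : Cobar ξ N) :
    comp ξ N (t + 1) (d ξ N z) = cobarD N t (comp ξ N t z) := by
  induction z using induction with
  | h0 => simp
  | hof t' x =>
    rw [d_of]
    by_cases h : t' = t
    · subst h
      rw [comp_of, comp_of]
    · rw [comp_of_ne h, comp_of_ne (fun h' => h (Nat.succ_injective h')), map_zero]
  | hadd x y hx hy => simp only [map_add, hx, hy]

theorem comp_map {φ : Γ →ₐc[k] D} {L : Comod.{v} k D} (ζ : Prim k D)
    (h : φ ξ.val = ζ.val) (f : Comod.Hom φ N L) (t : ℕ) (z : Cobar ξ N) :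
    comp ζ L t (map ξ ζ h f z) = cobarMap f t (comp ξ N t z) := by
  induction z using induction with
  | h0 => simp
  | hof t' x =>
    rw [map_of]
    by_cases h : t' = t
    · subst h
      rw [comp_of, comp_of]
    · rw [comp_of_ne h, comp_of_ne h, map_zero]
  | hadd x y hx hy => simp only [map_add, hx, hy]

theorem d_eq_zero_iff {z : Cobar ξ N} : d ξ N z = 0 ↔ ∀ t, cobarD N t (comp ξ N t z) = 0 := by
  constructor
  · intro h t
    rw [← comp_d_succ, h, map_zero]
  · intro h
    refine eq_zero_of_comp fun t => ?_
    cases t with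
    | zero => exact comp_d_zero z
    | succ t => rw [comp_d_succ, h]

theorem of_mem_range_d {t : ℕ} {x : (cobarStage N t).V} (hx : x ∈ cobarBd N t) :
    of ξ N t x ∈ LinearMap.range (d ξ N) := by
  cases t with
  | zero => rw [(Submodule.mem_bot k).1 hx, map_zero]; exact zero_mem _
  | succ t =>
    obtain ⟨y, rfl⟩ := hx
    exact ⟨of ξ N t y, d_of ξ N t y⟩

theorem mem_range_d_iff {z : Cobar ξ N} :
    (∃ y, d ξ N y = z) ↔ ∀ t, comp ξ N t z ∈ cobarBd N t := by
  constructor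
  · rintro ⟨y, rfl⟩ t
    cases t with
    | zero => rw [comp_d_zero]; exact zero_mem _
    | succ t => rw [comp_d_succ]; exact ⟨_, rfl⟩
  · intro h
    obtain ⟨s, hs⟩ := exists_sum_of z
    rw [hs]
    exact Submodule.sum_mem _ fun t _ => of_mem_range_d (h t)

end Cobar

/-- A map of comodules which induces bijections on cohomology in each degree induces a bijection
on `Ext`. -/
theorem ExtMod.map_bijective {φ : Γ →ₐc[k] D} (ξ : Prim k Γ) (ζ : Prim k D) (h : φ ξ.val = ζ.val)
    {N : Comod.{v} k Γ} {N' : Comod.{v} k D} (f : Comod.Hom φ N N')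
    (hs : ∀ t, CohSurj f t) (hi : ∀ t, CohInj f t) :
    Function.Bijective (ExtMod.map ξ ζ h f) := by
  constructor
  · rw [injective_iff_map_eq_zero]
    intro y hy
    obtain ⟨z, rfl⟩ := Coh.mk_surjective y
    have h1 := Cobar.mem_range_d_iff.1 ((Coh.mk_eq_zero _).1 hy)
    refine (Coh.mk_eq_zero _).2 (Cobar.mem_range_d_iff.2 fun t => hi t _ ?_ ?_)
    · exact Cobar.d_eq_zero_iff.1 z.2 t
    · rw [← Cobar.comp_map ζ h]
      exact h1 t
  · intro y
    obtain ⟨z, rfl⟩ := Coh.mk_surjective y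
    choose w hw hwz using fun t => hs t _ (Cobar.d_eq_zero_iff.1 z.2 t)
    obtain ⟨s, hsz⟩ := Cobar.exists_sum_of (z : Cobar ζ N')
    have hd : (∑ t ∈ s, Cobar.of ξ N t (w t)) ∈ LinearMap.ker (Cobar.d ξ N) :=
      Submodule.sum_mem _ fun t _ => by rw [LinearMap.mem_ker, Cobar.d_of, hw, map_zero]
    refine ⟨Coh.mk _ ⟨_, hd⟩, Coh.mk_eq_mk.2 ?_⟩
    change (Cobar.map ξ ζ h f (∑ t ∈ s, Cobar.of ξ N t (w t)) - (z : Cobar ζ N')) ∈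
      LinearMap.range (Cobar.d ζ N')
    rw [hsz, map_sum, ← Finset.sum_sub_distrib]
    refine Submodule.sum_mem _ fun t _ => ?_
    rw [Cobar.map_of, ← map_sub]
    exact Cobar.of_mem_range_d (hwz t)

/-- The projections of the bigrading of the cobar complex by homological and internal degree. -/
def Cobar.proj (ξ : Prim k Γ) (p : ℕ → Γ →ₗ[k] Γ) (N : Comod.{v} k Γ)
    (pN : ℕ → N.carrier →ₗ[k] N.carrier) (i : ℤ × ℤ) : Cobar ξ N →ₗ[k] Cobar ξ N :=
  Cobar.desc ξ N fun t =>
    if (t : ℤ) = i.1 then Cobar.of ξ N t ∘ₗ zext (stageProj p N pN t) i.2 else 0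

/-- The projections of the bigrading of the cobar complex, as maps of abelian groups. -/
abbrev Cobar.projAdd (ξ : Prim k Γ) (p : ℕ → Γ →ₗ[k] Γ) (N : Comod.{v} k Γ)
    (pN : ℕ → N.carrier →ₗ[k] N.carrier) (i : ℤ × ℤ) : Cobar ξ N →+ Cobar ξ N :=
  (Cobar.proj ξ p N pN i).toAddMonoidHom

variable {ξ : Prim k Γ} {p : ℕ → Γ →ₗ[k] Γ} {N : Comod.{v} k Γ}
  {pN : ℕ → N.carrier →ₗ[k] N.carrier}

theorem Cobar.proj_of (i : ℤ × ℤ) (t : ℕ) (x : (cobarStage N t).V) :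
    Cobar.proj ξ p N pN i (Cobar.of ξ N t x) =
      if (t : ℤ) = i.1 then Cobar.of ξ N t (zext (stageProj p N pN t) i.2 x) else 0 := by
  rw [Cobar.proj, Cobar.desc_of]
  split_ifs <;> rfl

theorem Cobar.comp_proj (t : ℕ) (u : ℤ) (t' : ℕ) (z : Cobar ξ N) :
    Cobar.comp ξ N t' (Cobar.proj ξ p N pN (t, u) z) =
      if t' = t then zext (stageProj p N pN t') u (Cobar.comp ξ N t' z) else 0 := by
  induction z using Cobar.induction with
  | h0 => simp
  | hof s x =>
    rw [Cobar.proj_of]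
    dsimp only
    by_cases h : s = t'
    · subst h
      rw [Cobar.comp_of]
      by_cases h' : s = t
      · rw [if_pos (by exact_mod_cast h'), if_pos h', Cobar.comp_of]
      · rw [if_neg (by exact_mod_cast h'), if_neg h', map_zero]
    · rw [Cobar.comp_of_ne h, map_zero, ite_self]
      split_ifs
      · rw [Cobar.comp_of_ne h]
      · rw [map_zero]
  | hadd x y hx hy =>
    simp only [map_add, hx, hy]
    split_ifs <;> simp

theorem Cobar.proj_natCast (t u : ℕ) (z : Cobar ξ N) :
    Cobar.proj ξ p N pN (t, u) z =
      Cobar.of ξ N t (stageProj p N pN t u (Cobar.comp ξ N t z)) := by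
  induction z using Cobar.induction with
  | h0 => simp
  | hof s x =>
    rw [Cobar.proj_of]
    dsimp only
    by_cases h : s = t
    · subst h
      rw [if_pos rfl, Cobar.comp_of]
      rw [zext_natCast]
    · rw [Cobar.comp_of_ne h, if_neg (by exact_mod_cast h), map_zero, map_zero]
  | hadd x y hx hy => simp only [map_add, hx, hy]

theorem Cobar.proj_d (hp : IsGradedBialgebra p) (hN : IsGradedComod p N pN) :
    IsGradedDiff (Cobar.d ξ N) (Cobar.projAdd ξ p N pN) := by
  intro t u z
  change Cobar.d ξ N (Cobar.proj ξ p N pN (t, u) z) =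
    Cobar.proj ξ p N pN (t + 1, u) (Cobar.d ξ N z)
  induction z using Cobar.induction with
  | h0 => simp
  | hof s x =>
    rw [Cobar.d_of, Cobar.proj_of, Cobar.proj_of]
    by_cases h : (s : ℤ) = t
    · rw [if_pos h, if_pos (by push_cast; rw [h]), Cobar.d_of]
      exact congrArg _ (zext_comm (cobarD_comm hp hN s) u x)
    · rw [if_neg h, if_neg (by push_cast; exact fun h' => h (by simpa using h')), map_zero]
  | hadd x y hx hy => simp only [map_add, hx, hy]

theorem Cobar.isBigrading (hp : IsGradedBialgebra p) (hN : IsGradedComod p N pN)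
    (h1 : IsHom p 4 ξ.val) (h2 : IsHom p 8 (ξ.val ^ 2)) :
    ExactCouple.IsBigrading (Polynomial.X : k[X]) (Cobar.projAdd ξ p N pN) where
  toIsGrading := by
    refine isGrading_of_span (k := k) (p := Cobar.proj ξ p N pN) (eq_top_iff.2 ?_)
    rintro z -
    induction z using Cobar.induction with
    | h0 => exact zero_mem _
    | hof t x =>
      refine (stageProj_grading hp hN t).induction (P := fun x => Cobar.of ξ N t x ∈ _) ?_ ?_ ?_ x
      · rw [map_zero]; exact zero_mem _
      · intro x y hx hy
        rw [map_add]; exact add_mem hx hy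
      · intro v x hx
        refine Submodule.subset_span ⟨((t : ℤ), (v : ℤ)), fun i => ?_⟩
        rw [Cobar.proj_of, hx.zext_apply]
        obtain ⟨i, j⟩ := i
        simp only [Prod.mk.injEq]
        by_cases hi : (t : ℤ) = i
        · subst hi
          by_cases hj : j = v <;> simp [hj]
        · rw [if_neg hi, if_neg (fun h => hi h.1.symm)]
    | hadd x y hx hy => exact add_mem hx hy
  smul t u z := by
    change (Polynomial.X : k[X]) • Cobar.proj ξ p N pN (t, u) z =
      Cobar.proj ξ p N pN (t + 2, u + 12) ((Polynomial.X : k[X]) • z)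
    induction z using Cobar.induction with
    | h0 => simp
    | hof s x =>
      rw [Cobar.X_smul, Cobar.X_smul, Cobar.b, Cobar.desc_of, LinearMap.comp_apply, Cobar.proj_of,
        Cobar.proj_of]
      by_cases h : (s : ℤ) = t
      · rw [if_pos h, if_pos (by push_cast; rw [h]), Cobar.desc_of, LinearMap.comp_apply]
        exact congrArg _ (cobarB_comm h1 h2 s u x)
      · rw [if_neg h, if_neg (by push_cast; exact fun h' => h (by simpa using h')), map_zero]
    | hadd x y hx hy => simp only [map_add, smul_add, hx, hy]

theorem Cobar.map_proj {φ : Γ →ₐc[k] D} {p' : ℕ → D →ₗ[k] D} {N' : Comod.{v} k D}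
    {pN' : ℕ → N'.carrier →ₗ[k] N'.carrier} (ζ : Prim k D) (h : φ ξ.val = ζ.val)
    (hφ : ∀ u a, φ (p u a) = p' u (φ a))
    (f : Comod.Hom φ N N') (hf : ∀ u n, f.lin (pN u n) = pN' u (f.lin n)) (i : ℤ × ℤ)
    (z : Cobar ξ N) : Cobar.map ξ ζ h f (Cobar.projAdd ξ p N pN i z) =
      Cobar.projAdd ζ p' N' pN' i (Cobar.map ξ ζ h f z) := by
  change Cobar.map ξ ζ h f (Cobar.proj ξ p N pN i z) =
    Cobar.proj ζ p' N' pN' i (Cobar.map ξ ζ h f z)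
  induction z using Cobar.induction with
  | h0 => simp
  | hof s x =>
    rw [Cobar.proj_of, Cobar.map_of, Cobar.proj_of]
    split_ifs
    · rw [Cobar.map_of]
      exact congrArg _ (zext_comm (cobarMap_proj hφ f hf s) i.2 x)
    · exact map_zero _
  | hadd x y hx hy => simp only [map_add, hx, hy]

/-- The projections of the bigrading of `Ext_Γ(k, N)`. -/
def extProj (ξ : Prim k Γ) (hp : IsGradedBialgebra p) (hN : IsGradedComod p N pN) :
    ℤ × ℤ → ExtMod ξ N →+ ExtMod ξ N :=
  cohProj (Cobar.proj_d hp hN)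

theorem extProj_isBigrading (hp : IsGradedBialgebra p) (hN : IsGradedComod p N pN)
    (h1 : IsHom p 4 ξ.val) (h2 : IsHom p 8 (ξ.val ^ 2)) :
    ExactCouple.IsBigrading (Polynomial.X : k[X]) (extProj ξ hp hN) :=
  ExactCouple.IsBigrading.coh (Cobar.isBigrading hp hN h1 h2) (Cobar.proj_d hp hN)

theorem extDeg_eq_homDeg {𝒢 : ℕ → Submodule k Γ} {𝒩 : ℕ → Submodule k N.carrier}
    (hp : IsGradedBialgebra p) (hN : IsGradedComod p N pN) (h𝒢 : GradedBy p 𝒢)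
    (h𝒩 : GradedBy pN 𝒩) :
    extDeg ξ 𝒢 N 𝒩 = ExactCouple.homDeg (extProj ξ hp hN) := by
  funext t u
  have hst := gradedBy_stageProj (N := N) h𝒢 h𝒩 t
  ext y
  constructor
  · rintro ⟨z, ⟨x, hx, hxz⟩, rfl⟩
    refine congrArg (Coh.mk (Cobar.d ξ N)) (Subtype.ext ?_)
    change Cobar.proj ξ p N pN (t, u) z = z
    rw [← hxz, Cobar.proj_natCast, Cobar.comp_of, (hst.mem u x).1 hx]
  · intro hy
    obtain ⟨z, rfl⟩ := Coh.mk_surjective y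
    refine ⟨_, ⟨stageProj p N pN t u (Cobar.comp ξ N t z), ?_, ?_⟩, hy⟩
    · exact (hst.mem _ _).2 (hst.grading.idem _ _)
    · exact (Cobar.proj_natCast t u (z : Cobar ξ N)).symm

/-- `Ext^{t,u}` vanishes if each homogeneous cocycle is a coboundary. -/
theorem extProj_eq_zero (hp : IsGradedBialgebra p) (hN : IsGradedComod p N pN) {t u : ℤ}
    (h : ∀ s : ℕ, (s : ℤ) = t → ∀ z, cobarD N s z = 0 → zext (stageProj p N pN s) u z = z →
      z ∈ cobarBd N s) (y : ExtMod ξ N) : extProj ξ hp hN (t, u) y = 0 := by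
  obtain ⟨z, rfl⟩ := Coh.mk_surjective y
  refine (Coh.mk_eq_zero _).2 ?_
  change ∃ y, Cobar.d ξ N y = Cobar.proj ξ p N pN (t, u) z
  rcases lt_or_ge t 0 with ht | ht
  · refine ⟨0, ?_⟩
    generalize (z : Cobar ξ N) = z
    rw [map_zero]
    induction z using Cobar.induction with
    | h0 => simp
    | hof s x => rw [Cobar.proj_of, if_neg (by dsimp only; omega)]
    | hadd x y hx hy => rw [map_add, ← hx, ← hy, add_zero]
  · lift t to ℕ using ht
    refine Cobar.mem_range_d_iff.2 fun s => ?_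
    rw [Cobar.comp_proj]
    split_ifs with hs
    · subst hs
      refine h s rfl _ ?_ ?_
      · refine (zext_comm (cobarD_comm hp hN s) u _).trans ?_
        rw [Cobar.d_eq_zero_iff.1 z.2 s, map_zero]
      · exact (stageProj_grading hp hN s).zext_idem u _
    · exact zero_mem _

theorem extProj_map {φ : Γ →ₐc[k] D} {p' : ℕ → D →ₗ[k] D} {N' : Comod.{v} k D}
    {pN' : ℕ → N'.carrier →ₗ[k] N'.carrier} (ζ : Prim k D) (h : φ ξ.val = ζ.val)
    (hp : IsGradedBialgebra p) (hN : IsGradedComod p N pN)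
    (hp' : IsGradedBialgebra p') (hN' : IsGradedComod p' N' pN')
    (hφ : ∀ u a, φ (p u a) = p' u (φ a))
    (f : Comod.Hom φ N N') (hf : ∀ u n, f.lin (pN u n) = pN' u (f.lin n)) (i : ℤ × ℤ)
    (y : ExtMod ξ N) : ExtMod.map ξ ζ h f (extProj ξ hp hN i y) =
      extProj ζ hp' hN' i (ExtMod.map ξ ζ h f y) :=
  cohProj_map _ _ _ _ (Cobar.map_proj ζ h hφ f hf) i y

end TotalComplex

/-! ### The Hopf algebra `𝔽₃[x] / (x³)` -/

namespace TruncD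

/-- The antipode `x ↦ -x`. -/
instance : HopfAlgebra (ZMod 3) TruncD :=
  HopfAlgebra.ofAlgHom (lift (-x) (by rw [neg_pow, x_pow, mul_zero]))
    (by
      apply algHom_ext
      have h : Bialgebra.comulAlgHom (ZMod 3) TruncD x = x ⊗ₜ[ZMod 3] 1 + 1 ⊗ₜ[ZMod 3] x := comul_x
      have h' : Bialgebra.counitAlgHom (ZMod 3) TruncD x = 0 := lift_x 0 (by simp)
      rw [AlgHom.comp_apply, AlgHom.comp_apply, h, h', map_add, map_zero]
      refine (congrArg₂ (· + ·) (Algebra.TensorProduct.lift_tmul _ _ _ _ _)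
        (Algebra.TensorProduct.lift_tmul _ _ _ _ _)).trans ?_
      simp [lift_x])
    (by
      apply algHom_ext
      have h : Bialgebra.comulAlgHom (ZMod 3) TruncD x = x ⊗ₜ[ZMod 3] 1 + 1 ⊗ₜ[ZMod 3] x := comul_x
      have h' : Bialgebra.counitAlgHom (ZMod 3) TruncD x = 0 := lift_x 0 (by simp)
      simp [h, h', lift_x])

theorem monic_X_pow : ((Polynomial.X : (ZMod 3)[X]) ^ 3).Monic := Polynomial.monic_X_pow 3

/-- The coefficient of `x ^ i`. -/
def coef (i : ℕ) : TruncD →ₗ[ZMod 3] ZMod 3 :=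
  Polynomial.lcoeff (ZMod 3) i ∘ₗ AdjoinRoot.modByMonicHom monic_X_pow

theorem coef_pow (i : ℕ) {j : ℕ} (hj : j < 3) : coef i (x ^ j) = if i = j then 1 else 0 := by
  have h : (Polynomial.X ^ j : (ZMod 3)[X]) %ₘ (Polynomial.X ^ 3) = Polynomial.X ^ j := by
    rw [Polynomial.modByMonic_eq_self_iff monic_X_pow, Polynomial.degree_X_pow,
      Polynomial.degree_X_pow]
    exact_mod_cast hj
  have h' : x ^ j = AdjoinRoot.mk ((Polynomial.X : (ZMod 3)[X]) ^ 3) (Polynomial.X ^ j) := by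
    rw [map_pow, AdjoinRoot.mk_X]
    rfl
  rw [h', coef]
  change (AdjoinRoot.modByMonicHom monic_X_pow (AdjoinRoot.mk _ (Polynomial.X ^ j))).coeff i = _
  rw [AdjoinRoot.modByMonicHom_mk, h, Polynomial.coeff_X_pow]

theorem eq_sum_coef (a : TruncD) : a = ∑ i ∈ Finset.range 3, coef i a • x ^ i := by
  obtain ⟨f, rfl⟩ : ∃ f, AdjoinRoot.mk ((Polynomial.X : (ZMod 3)[X]) ^ 3) f = a :=
    AdjoinRoot.mk_surjective a
  have hd : (f %ₘ Polynomial.X ^ 3).natDegree < 3 := by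
    have := Polynomial.natDegree_modByMonic_lt f monic_X_pow (by
      intro h
      have := congrArg Polynomial.natDegree h
      simp at this)
    rwa [Polynomial.natDegree_X_pow] at this
  have h := (AdjoinRoot.mk_leftInverse monic_X_pow (AdjoinRoot.mk _ f)).symm
  rw [AdjoinRoot.modByMonicHom_mk, (f %ₘ Polynomial.X ^ 3).as_sum_range' 3 hd, map_sum] at h
  refine h.trans (Finset.sum_congr rfl fun i _ => ?_)
  rw [← Polynomial.smul_X_eq_monomial, ← AdjoinRoot.smul_mk, map_pow, AdjoinRoot.mk_X]
  rfl

theorem linearMap_ext {V : Type*} [AddCommGroup V] [Module (ZMod 3) V] {f g : TruncD →ₗ[ZMod 3] V}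
    (h0 : f 1 = g 1) (h1 : f x = g x) (h2 : f (x ^ 2) = g (x ^ 2)) : f = g := by
  ext a
  rw [eq_sum_coef a]
  simp [Finset.sum_range_succ, h0, h1, h2]

theorem coef_one (i : ℕ) : coef i 1 = if i = 0 then 1 else 0 := by
  simpa using coef_pow i (j := 0) (by norm_num)

theorem coef_x (i : ℕ) : coef i x = if i = 1 then 1 else 0 := by
  simpa using coef_pow i (j := 1) (by norm_num)

theorem coef_x_sq (i : ℕ) : coef i (x ^ 2) = if i = 2 then 1 else 0 :=
  coef_pow i (by norm_num)

theorem comul_x_sq : Coalgebra.comul (R := ZMod 3) (x ^ 2) =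
    (x ^ 2) ⊗ₜ[ZMod 3] 1 + (2 : ZMod 3) • (x ⊗ₜ[ZMod 3] x) + 1 ⊗ₜ[ZMod 3] (x ^ 2) := by
  rw [Prim.comul_sq ⟨x, comul_x⟩, two_smul]

/-- The derivation `d / dx`. It is colinear, with kernel `k`, and its image is the kernel of the
coefficient of `x²`. -/
def deriv : TruncD →ₗ[ZMod 3] TruncD :=
  (coef 1).smulRight 1 + (coef 2).smulRight ((2 : ZMod 3) • x)

theorem deriv_one : deriv 1 = 0 := by simp [deriv, coef_one]

theorem deriv_x : deriv x = 1 := by simp [deriv, coef_x]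

theorem deriv_x_sq : deriv (x ^ 2) = (2 : ZMod 3) • x := by simp [deriv, coef_x_sq]

theorem comul_deriv (a : TruncD) : Coalgebra.comul (R := ZMod 3) (deriv a) =
    deriv.lTensor TruncD (Coalgebra.comul (R := ZMod 3) a) := by
  have h : Coalgebra.comul (R := ZMod 3) ∘ₗ deriv =
      deriv.lTensor TruncD ∘ₗ Coalgebra.comul (R := ZMod 3) := by
    apply linearMap_ext
    · simp [deriv_one, Algebra.TensorProduct.one_def]
    · simp [deriv_one, deriv_x, comul_x, Algebra.TensorProduct.one_def]
    · rw [LinearMap.comp_apply, LinearMap.comp_apply, comul_x_sq]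
      simp [deriv_one, deriv_x, deriv_x_sq, comul_x, TensorProduct.smul_tmul']
  exact LinearMap.congr_fun h a

/-- The coefficient of `x²` is an integral. -/
theorem lTensor_coef_two_comul (a : TruncD) :
    (coef 2).lTensor TruncD (Coalgebra.comul (R := ZMod 3) a) = 1 ⊗ₜ coef 2 a := by
  have h : (coef 2).lTensor TruncD ∘ₗ Coalgebra.comul (R := ZMod 3) =
      TensorProduct.mk (ZMod 3) TruncD (ZMod 3) 1 ∘ₗ coef 2 := by
    apply linearMap_ext
    · simp [coef_one, Algebra.TensorProduct.one_def]
    · simp [coef_one, coef_x, comul_x]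
    · rw [LinearMap.comp_apply, comul_x_sq]
      simp [coef_one, coef_x, coef_x_sq]
  exact LinearMap.congr_fun h a

/-- The linear map `x ^ i ↦ a ^ i` for `i < 3`. It is not multiplicative unless `a ^ 3 = 0`. -/
def powMap {A : Type*} [CommRing A] [Algebra (ZMod 3) A] (a : A) : TruncD →ₗ[ZMod 3] A :=
  (coef 0).smulRight 1 + (coef 1).smulRight a + (coef 2).smulRight (a ^ 2)

section

variable {A : Type*} [CommRing A] [Algebra (ZMod 3) A] (a : A)

theorem powMap_one : powMap a 1 = 1 := by simp [powMap, coef_one]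

theorem powMap_x : powMap a x = a := by simp [powMap, coef_x]

theorem powMap_x_sq : powMap a (x ^ 2) = a ^ 2 := by simp [powMap, coef_x_sq]

end

/-- For a primitive element `ξ` over `x`, the map `x ^ i ↦ ξ ^ i` for `i < 3` is colinear. -/
theorem rTensor_comul_powMap {Γ : Type} [CommRing Γ] [Bialgebra (ZMod 3) Γ]
    (q : Γ →ₐc[ZMod 3] TruncD) (ξ : Prim (ZMod 3) Γ) (hξ : q ξ.val = x) (a : TruncD) :
    (q : Γ →ₗ[ZMod 3] TruncD).rTensor Γ (Coalgebra.comul (R := ZMod 3) (powMap ξ.val a)) =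
      (powMap ξ.val).lTensor TruncD (Coalgebra.comul (R := ZMod 3) a) := by
  have h : (q : Γ →ₗ[ZMod 3] TruncD).rTensor Γ ∘ₗ Coalgebra.comul (R := ZMod 3) ∘ₗ powMap ξ.val =
      (powMap ξ.val).lTensor TruncD ∘ₗ Coalgebra.comul (R := ZMod 3) := by
    apply linearMap_ext
    · simp [powMap_one, Algebra.TensorProduct.one_def]
    · simp [powMap_one, powMap_x, comul_x, ξ.comul_val, hξ]
    · rw [LinearMap.comp_apply, LinearMap.comp_apply, LinearMap.comp_apply, comul_x_sq]
      simp [powMap_one, powMap_x, powMap_x_sq, ξ.comul_sq, hξ, two_smul]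
  exact LinearMap.congr_fun h a

/-- The projections of the grading of `D`, with `x` in degree `4`. -/
def gradProj (u : ℕ) : TruncD →ₗ[ZMod 3] TruncD :=
  ∑ i ∈ Finset.range 3, if u = 4 * i then (coef i).smulRight (x ^ i) else 0

theorem isHom_x_pow (n : ℕ) : IsHom gradProj (4 * n) (x ^ n) := by
  intro u
  rcases lt_or_ge n 3 with hn | hn
  · rw [gradProj, LinearMap.sum_apply, Finset.sum_eq_single_of_mem n (Finset.mem_range.2 hn)]
    · split_ifs <;> simp [coef_pow _ hn]
    · intro i _ hi
      split_ifs <;> simp [coef_pow _ hn, hi]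
  · rw [← Nat.sub_add_cancel hn, pow_add, x_pow, mul_zero, map_zero, ite_self]

theorem isGrading_gradProj : IsGrading fun u => ⇑(gradProj u) := by
  refine isGrading_of_span (eq_top_iff.2 ?_)
  rintro a -
  rw [eq_sum_coef a]
  exact Submodule.sum_mem _ fun i _ => Submodule.smul_mem _ _
    (Submodule.subset_span ⟨4 * i, isHom_x_pow i⟩)

end TruncD

/-! ### The vanishing line over `𝔽₃[x] / (x³)` -/

section PeriodicResolution

universe v

variable {k Γ : Type} [Field k] [CommRing Γ] [Bialgebra k Γ]

/-- If `f` lowers the degree by `c`, then so do the induced maps of cochains. -/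
theorem cobarMap_zext {p : ℕ → Γ →ₗ[k] Γ} (hp : IsGrading fun u => ⇑(p u)) {N N' : Comod.{v} k Γ}
    {pN : ℕ → N.carrier →ₗ[k] N.carrier} {pN' : ℕ → N'.carrier →ₗ[k] N'.carrier} {c : ℤ}
    (f : Comod.Hom (BialgHom.id k Γ) N N')
    (hf : ∀ u n, f.lin (zext pN u n) = zext pN' (u - c) (f.lin n)) :
    ∀ t u x, cobarMap f t (zext (stageProj p N pN t) u x) =
      zext (stageProj p N' pN' t) (u - c) (cobarMap f t x)
  | 0 => hf
  | t + 1 => by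
    have ih := cobarMap_zext hp f hf t
    intro u z
    change Γ ⊗[k] (cobarStage N t).V at z
    change (cobarMap f t).lTensor Γ (zext (tensorProj p (stageProj p N pN t)) u z) =
      zext (tensorProj p (stageProj p N' pN' t)) (u - c) ((cobarMap f t).lTensor Γ z)
    induction z with
    | zero => simp
    | add z z' hz hz' => simp only [map_add, hz, hz']
    | tmul a x =>
      refine hp.induction (P := fun a => (cobarMap f t).lTensor Γ
        (zext (tensorProj p (stageProj p N pN t)) u (a ⊗ₜ x)) =
        zext (tensorProj p (stageProj p N' pN' t)) (u - c) ((cobarMap f t).lTensor Γ (a ⊗ₜ x)))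
        ?_ ?_ ?_ a
      · simp
      · intro a b ha hb
        simp only [TensorProduct.add_tmul, map_add, ha, hb]
      · intro v a ha
        have h1 := ha.zext_tmul (p' := stageProj p N pN t) (u - v) x
        have h2 := ha.zext_tmul (p' := stageProj p N' pN' t) (u - c - v) (cobarMap f t x)
        rw [sub_add_cancel] at h1 h2
        rw [h1, LinearMap.lTensor_tmul, LinearMap.lTensor_tmul, h2, ih]
        congr 3
        ring

/-- A colinear endomorphism of `Γ` as a map of comodules. -/
def regEndHom (e : Γ →ₗ[k] Γ) (he : ∀ a, Coalgebra.comul (R := k) (e a) =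
    e.lTensor Γ (Coalgebra.comul (R := k) a)) :
    Comod.Hom (BialgHom.id k Γ) (Comod.reg k Γ) (Comod.reg k Γ) where
  lin := e
  comm a := (he a).symm

/-- The map `a ⊗ n ↦ λ(a) n` for an integral `λ` on `Γ`. -/
def integralEval (l : Γ →ₗ[k] k) (hl : ∀ a, l.lTensor Γ (Coalgebra.comul (R := k) a) = 1 ⊗ₜ l a)
    (N : Comod.{v} k Γ) : Comod.Hom (BialgHom.id k Γ) ((Comod.reg k Γ).tensor N) N where
  lin := ((TensorProduct.lid k N.carrier).toLinearMap ∘ₗ l.rTensor N.carrier :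
    Γ ⊗[k] N.carrier →ₗ[k] N.carrier)
  comm m := by
    have key : ∀ (w : Γ ⊗[k] Γ) (z : Γ ⊗[k] N.carrier),
        ((TensorProduct.lid k N.carrier).toLinearMap ∘ₗ l.rTensor N.carrier).lTensor Γ
          (diagMul k Γ Γ N.carrier (w ⊗ₜ z)) =
        (LinearMap.mul k Γ (TensorProduct.rid k Γ (l.lTensor Γ w))).rTensor N.carrier z := by
      intro w z
      induction w with
      | zero => simp
      | add w w' hw hw' =>
        simp only [TensorProduct.add_tmul, map_add, hw, hw', LinearMap.rTensor_add,
          LinearMap.add_apply]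
      | tmul a b =>
        induction z with
        | zero => simp
        | add z z' hz hz' => simp only [TensorProduct.tmul_add, map_add, hz, hz']
        | tmul c n => simp [diagMul_tmul, TensorProduct.tmul_smul, TensorProduct.smul_tmul']
    change Γ ⊗[k] N.carrier at m
    change ((TensorProduct.lid k N.carrier).toLinearMap ∘ₗ l.rTensor N.carrier).lTensor Γ
      (diagMul k Γ Γ N.carrier (TensorProduct.map (Coalgebra.comul (R := k)) N.coact m)) =
      N.coact (((TensorProduct.lid k N.carrier).toLinearMap ∘ₗ l.rTensor N.carrier) m)
    induction m with
    | zero => simp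
    | add u u' hu hu' => simp only [map_add, hu, hu']
    | tmul a n =>
      rw [TensorProduct.map_tmul, key, hl]
      simp only [TensorProduct.rid_tmul, LinearMap.comp_apply, LinearMap.rTensor_tmul,
        LinearEquiv.coe_coe, TensorProduct.lid_tmul, map_smul]
      generalize N.coact n = z
      induction z with
      | zero => simp
      | add u u' hu hu' => simp only [map_add, hu, hu', smul_add]
      | tmul b n => simp [TensorProduct.smul_tmul']

/-- If there is an exact sequence `0 → N → A → A → N → 0` with `A` acyclic, whose maps lower the
degree by `0`, `4` and `8`, then the cohomology of `N` is periodic of bidegree `(2, 12)`, and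
vanishes below a line of slope `6`. In degree `1` the bound is `c + 4`, the bottom degree of `N`
raised by the degree of the second map. -/
theorem mem_cobarBd_of_periodic {p : ℕ → Γ →ₗ[k] Γ} (hp : IsGradedBialgebra p)
    {N A : Comod.{v} k Γ} {pN : ℕ → N.carrier →ₗ[k] N.carrier}
    {pA : ℕ → A.carrier →ₗ[k] A.carrier} (hN : IsGradedComod p N pN) (hA : IsGradedComod p A pA)
    (i : Comod.Hom (BialgHom.id k Γ) N A) (e : Comod.Hom (BialgHom.id k Γ) A A)
    (l : Comod.Hom (BialgHom.id k Γ) A N) (hinj : RelInj A) (hi : Function.Injective i.lin)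
    (hie : Function.Exact i.lin e.lin) (hel : Function.Exact e.lin l.lin)
    (hl : Function.Surjective l.lin)
    (hip : ∀ u n, i.lin (zext pN u n) = zext pA (u - 0) (i.lin n))
    (hep : ∀ u n, e.lin (zext pA u n) = zext pA (u - 4) (e.lin n))
    (hlp : ∀ u n, l.lin (zext pA u n) = zext pN (u - 8) (l.lin n)) {c : ℤ}
    (hNc : ∀ u < c, zext pN u = 0) (hAc : ∀ u < c, zext pA u = 0) :
    ∀ (t : ℕ) (u : ℤ), u < c + 6 * t - 2 → ∀ z, cobarD N t z = 0 →
      zext (stageProj p N pN t) u z = z → z ∈ cobarBd N t := by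
  have hi' := Cobar.cobarMap_injective i hi
  have hie' := Cobar.cobarMap_exact i e hie
  have hel' := Cobar.cobarMap_exact e l hel
  -- `i z` is the coboundary of a homogeneous cochain `y`, and `e y` is a cocycle
  have first : ∀ (t : ℕ) (u : ℤ) (z : (cobarStage N (t + 1)).V), cobarD N (t + 1) z = 0 →
      zext (stageProj p N pN (t + 1)) u z = z →
      ∃ y, cobarD A t y = cobarMap i (t + 1) z ∧ cobarD A t (cobarMap e t y) = 0 ∧
        zext (stageProj p A pA t) (u - 4) (cobarMap e t y) = cobarMap e t y := by
    intro t u z hz hzu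
    obtain ⟨y, hy⟩ := hinj.exists_cobarD (z := cobarMap i (t + 1) z)
      (by rw [← cobarMap_cobarD, hz, map_zero])
    have hy' : cobarD A t (zext (stageProj p A pA t) u y) = cobarMap i (t + 1) z := by
      rw [zext_comm (cobarD_comm hp hA t), hy]
      have := cobarMap_zext hp.grading i hip (t + 1) u z
      rw [sub_zero, hzu] at this
      exact this.symm
    refine ⟨_, hy', ?_, ?_⟩
    · rw [← cobarMap_cobarD, hy']
      exact (hie' (t + 1)).apply_apply_eq_zero z
    · rw [cobarMap_zext hp.grading e hep]
      exact (stageProj_grading hp hA t).zext_idem _ _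
  -- if `e y = d w'` where `w'` may be corrected to an element of the image of `e`, then `z` bounds
  have last : ∀ (t : ℕ) (z : (cobarStage N (t + 1)).V) (y : (cobarStage A t).V),
      cobarD A t y = cobarMap i (t + 1) z → ∀ y' ∈ cobarBd A t,
      cobarMap e t y = cobarMap e t y' → z ∈ cobarBd N (t + 1) := by
    intro t z y hy y' hy' hyy'
    obtain ⟨v, hv⟩ := (hie' t (y - y')).1 (by rw [map_sub, hyy', sub_self])
    refine ⟨v, hi' (t + 1) ?_⟩
    rw [cobarMap_cobarD, hv, map_sub, hy, cobarD_eq_zero_of_mem_cobarBd hy', sub_zero]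
  intro t
  induction t using Nat.twoStepInduction with
  | zero =>
    intro u hu z _ hzu
    have : zext pN u z = z := hzu
    rw [← this, hNc u (by push_cast at hu; omega)]
    exact zero_mem _
  | one =>
    intro u hu z hz hzu
    obtain ⟨y, hy, -, hyu⟩ := first 0 u z hz hzu
    have hy0 : cobarMap e 0 y = 0 := by
      rw [← hyu]
      exact congrArg (fun f : A.carrier →ₗ[k] A.carrier => f (cobarMap e 0 y))
        (hAc (u - 4) (by push_cast at hu; omega))
    exact last 0 z y hy 0 (zero_mem _) (by rw [hy0, map_zero])
  | more t ih _ =>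
    intro u hu z hz hzu
    obtain ⟨y, hy, hdy, hyu⟩ := first (t + 1) u z hz hzu
    obtain ⟨y₂, hy₂⟩ := hinj.exists_cobarD hdy
    have hy₂' : cobarD A t (zext (stageProj p A pA t) (u - 4) y₂) = cobarMap e (t + 1) y := by
      rw [zext_comm (cobarD_comm hp hA t), hy₂, hyu]
    obtain ⟨y₃, hy₃, hly₃⟩ : ∃ y₃ ∈ cobarBd A t, cobarMap l t y₃ =
        cobarMap l t (zext (stageProj p A pA t) (u - 4) y₂) := by
      refine exists_mem_cobarBd l hl (ih (u - 12) (by push_cast at hu; omega) _ ?_ ?_)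
      · rw [← cobarMap_cobarD, hy₂']
        exact (hel' (t + 1)).apply_apply_eq_zero y
      · rw [cobarMap_zext hp.grading l hlp]
        have : u - 4 - 8 = u - 12 := by ring
        rw [this]
        exact (stageProj_grading hp hN t).zext_idem _ _
    obtain ⟨w, hw⟩ := (hel' t (zext (stageProj p A pA t) (u - 4) y₂ - y₃)).1
      (by rw [map_sub, hly₃, sub_self])
    refine last (t + 1) z y hy (cobarD A t w) ⟨w, rfl⟩ ?_
    rw [cobarMap_cobarD, hw, map_sub, hy₂', cobarD_eq_zero_of_mem_cobarBd hy₃, sub_zero]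

end PeriodicResolution

namespace TruncD

universe v

section Coefficients

variable {V : Type*} [AddCommGroup V] [Module (ZMod 3) V]

/-- The coefficient of `x ^ i` of an element of `D ⊗ V`. -/
def tcoef (i : ℕ) : TruncD ⊗[ZMod 3] V →ₗ[ZMod 3] V :=
  (TensorProduct.lid (ZMod 3) V).toLinearMap ∘ₗ (coef i).rTensor V

theorem tcoef_tmul (i : ℕ) (a : TruncD) (n : V) : tcoef i (a ⊗ₜ[ZMod 3] n) = coef i a • n := by
  simp [tcoef]

theorem eq_sum_tcoef (z : TruncD ⊗[ZMod 3] V) :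
    z = ∑ i ∈ Finset.range 3, (x ^ i) ⊗ₜ[ZMod 3] tcoef i z := by
  induction z with
  | zero => simp
  | add z z' hz hz' =>
    simp only [map_add, TensorProduct.tmul_add, Finset.sum_add_distrib]
    rw [← hz, ← hz']
  | tmul a n =>
    conv_lhs => rw [eq_sum_coef a, TensorProduct.sum_tmul]
    simp only [tcoef_tmul, TensorProduct.smul_tmul]

theorem rTensor_deriv (z : TruncD ⊗[ZMod 3] V) : deriv.rTensor V z =
    1 ⊗ₜ[ZMod 3] tcoef 1 z + x ⊗ₜ[ZMod 3] ((2 : ZMod 3) • tcoef 2 z) := by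
  conv_lhs => rw [eq_sum_tcoef z]
  simp [Finset.sum_range_succ, deriv_one, deriv_x, deriv_x_sq, TensorProduct.smul_tmul]

theorem mk_one_injective :
    Function.Injective (TensorProduct.mk (ZMod 3) TruncD V 1) := by
  refine Function.LeftInverse.injective (g := tcoef 0) fun n => ?_
  rw [TensorProduct.mk_apply, tcoef_tmul, coef_one, if_pos rfl, one_smul]

/-- Exactness at the first `D ⊗ V` of `0 → V → D ⊗ V → D ⊗ V → V → 0`, the periodic resolution with
maps `1 ⊗ -`, `d / dx` and the coefficient of `x²`. -/
theorem mk_one_deriv_exact :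
    Function.Exact (TensorProduct.mk (ZMod 3) TruncD V 1) (deriv.rTensor V) := by
  intro z
  constructor
  · intro h
    rw [rTensor_deriv] at h
    have h1 : tcoef 1 z = 0 := by
      simpa [tcoef_tmul, coef_one, coef_x] using congrArg (tcoef 0) h
    have h2 : (2 : ZMod 3) • tcoef 2 z = 0 := by
      simpa only [map_add, tcoef_tmul, coef_one, coef_x, map_zero, if_pos, one_ne_zero, if_false,
        zero_smul, one_smul, zero_add] using congrArg (tcoef 1) h
    have h3 : tcoef 2 z = 0 := (smul_eq_zero.1 h2).resolve_left (by decide)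
    refine ⟨tcoef 0 z, ?_⟩
    conv_rhs => rw [eq_sum_tcoef z]
    simp [Finset.sum_range_succ, h1, h3]
  · rintro ⟨n, rfl⟩
    simp [deriv_one]

/-- Exactness at the second `D ⊗ V` of the periodic resolution. -/
theorem deriv_tcoef_exact :
    Function.Exact (deriv.rTensor V) (tcoef (V := V) 2) := by
  intro z
  constructor
  · intro h
    refine ⟨x ⊗ₜ tcoef 0 z + (x ^ 2) ⊗ₜ ((2 : ZMod 3) • tcoef 1 z), ?_⟩
    conv_rhs => rw [eq_sum_tcoef z]
    -- `2 * 2 = 1` in `𝔽₃`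
    have h4 : (2 : ZMod 3) * 2 = 1 := by decide
    simp [Finset.sum_range_succ, h, deriv_x, deriv_x_sq, TensorProduct.smul_tmul, smul_smul, h4]
  · rintro ⟨z, rfl⟩
    rw [rTensor_deriv]
    simp [tcoef_tmul, coef_one, coef_x]

theorem tcoef_surjective : Function.Surjective (tcoef (V := V) 2) := fun n =>
  ⟨(x ^ 2) ⊗ₜ n, by rw [tcoef_tmul, coef_x_sq, if_pos rfl, one_smul]⟩

end Coefficients

section Degrees

variable {V : Type*} [AddCommGroup V] [Module (ZMod 3) V] {pV : ℕ → V →ₗ[ZMod 3] V}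

theorem zext_x_pow_tmul (i : ℕ) (u : ℤ) (n : V) :
    zext (tensorProj gradProj pV) u ((x ^ i) ⊗ₜ n) = (x ^ i) ⊗ₜ zext pV (u - 4 * i) n := by
  have h := (isHom_x_pow i).zext_tmul (p' := pV) (u - 4 * i) n
  push_cast at h
  rwa [sub_add_cancel] at h

theorem zext_tensorProj (u : ℤ) (z : TruncD ⊗[ZMod 3] V) :
    zext (tensorProj gradProj pV) u z =
      ∑ i ∈ Finset.range 3, (x ^ i) ⊗ₜ[ZMod 3] zext pV (u - 4 * i) (tcoef i z) := by
  conv_lhs => rw [eq_sum_tcoef z, map_sum]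
  simp only [zext_x_pow_tmul]

theorem tcoef_zext (u : ℤ) {i : ℕ} (hi : i < 3) (z : TruncD ⊗[ZMod 3] V) :
    tcoef i (zext (tensorProj gradProj pV) u z) = zext pV (u - 4 * i) (tcoef i z) := by
  rw [zext_tensorProj, map_sum, Finset.sum_eq_single_of_mem i (Finset.mem_range.2 hi)]
  · rw [tcoef_tmul, coef_pow _ hi, if_pos rfl, one_smul]
  · intro j hj hji
    rw [tcoef_tmul, coef_pow _ (Finset.mem_range.1 hj), if_neg (Ne.symm hji), zero_smul]

theorem deriv_zext (u : ℤ) (z : TruncD ⊗[ZMod 3] V) :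
    deriv.rTensor V (zext (tensorProj gradProj pV) u z) =
      zext (tensorProj gradProj pV) (u - 4) (deriv.rTensor V z) := by
  have h0 := fun n => zext_x_pow_tmul (pV := pV) 0 (u - 4) n
  have h1 := fun n => zext_x_pow_tmul (pV := pV) 1 (u - 4) n
  simp only [pow_zero, pow_one] at h0 h1
  rw [rTensor_deriv, rTensor_deriv, map_add, h0, h1, tcoef_zext u (by norm_num),
    tcoef_zext u (by norm_num), map_smul]
  have e1 : u - 4 * (1 : ℕ) = u - 4 - 4 * (0 : ℕ) := by push_cast; ring
  have e2 : u - 4 * (2 : ℕ) = u - 4 - 4 * (1 : ℕ) := by push_cast; ring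
  rw [e1, e2]

end Degrees

/-- A homogeneous cocycle of degree `(t, u)` over `D` with `u < c + 6 t - 2` is a coboundary, if
the comodule is concentrated in degrees at least `c`. -/
theorem mem_cobarBd (hp : IsGradedBialgebra gradProj) {N : Comod.{v} (ZMod 3) TruncD}
    {pN : ℕ → N.carrier →ₗ[ZMod 3] N.carrier} (hN : IsGradedComod gradProj N pN) {c : ℤ}
    (hc : ∀ u < c, zext pN u = 0) (t : ℕ) (u : ℤ) (hu : u < c + 6 * t - 2)
    (z : (cobarStage N t).V) (hz : cobarD N t z = 0)
    (hzu : zext (stageProj gradProj N pN t) u z = z) : z ∈ cobarBd N t := by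
  have hreg : IsGradedComod gradProj (Comod.reg (ZMod 3) TruncD) gradProj :=
    ⟨hp.grading, hp.comul_comm⟩
  refine mem_cobarBd_of_periodic hp hN (IsGradedComod.tensor hp hreg hN) (regUnitHom N)
    ((regEndHom deriv comul_deriv).tensor (Comod.Hom.id N))
    (integralEval (coef 2) lTensor_coef_two_comul N) (relInj_reg_tensor N) mk_one_injective
    mk_one_deriv_exact deriv_tcoef_exact tcoef_surjective ?_ deriv_zext ?_ hc ?_ t u hu z hz hzu
  · intro u n
    have := zext_x_pow_tmul (pV := pN) 0 (u - 0) n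
    rw [pow_zero] at this
    refine Eq.trans ?_ this.symm
    simp only [sub_zero, Nat.cast_zero, mul_zero]
    rfl
  · intro u z
    refine (tcoef_zext u (by norm_num) z).trans ?_
    norm_num
    rfl
  · intro u hu
    refine LinearMap.ext fun z => (zext_tensorProj u z).trans (Finset.sum_eq_zero fun i _ => ?_)
    rw [hc _ (by omega), LinearMap.zero_apply, TensorProduct.tmul_zero]

end TruncD

/-! ### The gradings of `P` and of its quotients -/

section Base

variable (k : Type) [Field k]

/-- The projections of the grading of `k`, which is concentrated in degree `0`. -/
def baseProj (u : ℕ) : k →ₗ[k] k := if u = 0 then LinearMap.id else 0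

theorem isHom_baseProj (a : k) : IsHom (baseProj k) 0 a := by
  intro u
  rw [baseProj]
  split_ifs <;> rfl

theorem isMulGrading_base : IsMulGrading (baseProj k) where
  grading := isGrading_of_span (eq_top_iff.2 fun a _ =>
    Submodule.subset_span ⟨0, isHom_baseProj k a⟩)
  one := isHom_baseProj k 1
  mul {u v a b} ha hb := by
    rcases eq_or_ne u 0 with rfl | hu
    · rcases eq_or_ne v 0 with rfl | hv
      · exact isHom_baseProj k _
      · have : b = 0 := by simpa [baseProj, hv] using (hb v).symm
        rw [this, mul_zero]
        exact IsHom.zero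
    · have : a = 0 := by simpa [baseProj, hu] using (ha u).symm
      rw [this, zero_mul]
      exact IsHom.zero

end Base

namespace RedPow

/-- The monomial with exponents `d`. -/
def mono (d : ℕ →₀ ℕ) : RedPow := (MvPolynomial.monomial d 1 : MvPolynomial ℕ (ZMod 3))

theorem mono_zero : mono 0 = 1 := rfl

theorem mono_add (d e : ℕ →₀ ℕ) : mono (d + e) = mono d * mono e := by
  have h : (MvPolynomial.monomial (d + e) 1 : MvPolynomial ℕ (ZMod 3)) =
      MvPolynomial.monomial d 1 * MvPolynomial.monomial e 1 := by
    rw [MvPolynomial.monomial_mul, one_mul]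
  exact h

theorem mono_single (n m : ℕ) : mono (Finsupp.single n m) = xi (n + 1) ^ m :=
  (MvPolynomial.X_pow_eq_monomial (R := ZMod 3) (n := n) (e := m)).symm

theorem mem_span_mono {u : ℕ} {f : RedPow} (hf : f ∈ homog u) :
    f ∈ Submodule.span (ZMod 3) {g | ∃ d, Finsupp.weight wt d = u ∧ mono d = g} := by
  have hf' : MvPolynomial.IsWeightedHomogeneous wt (R := ZMod 3) f u := hf
  have h : f = ∑ d ∈ MvPolynomial.support (R := ZMod 3) f,
      MvPolynomial.coeff (R := ZMod 3) d f • mono d := by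
    refine (MvPolynomial.as_sum (R := ZMod 3) f).trans (Finset.sum_congr rfl fun d _ => ?_)
    have := MvPolynomial.smul_monomial (R := ZMod 3) (s := d) (a := 1)
      (MvPolynomial.coeff (R := ZMod 3) d f)
    rw [smul_eq_mul, mul_one] at this
    exact this.symm
  rw [h]
  exact Submodule.sum_mem _ fun d hd => Submodule.smul_mem _ _
    (Submodule.subset_span ⟨d, hf' (MvPolynomial.mem_support_iff.1 hd), rfl⟩)

theorem xi_mem_homog (n : ℕ) : xi n ∈ homog (2 * (3 ^ n - 1)) := by
  cases n with
  | zero => exact MvPolynomial.isWeightedHomogeneous_one (ZMod 3) wt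
  | succ n => exact MvPolynomial.isWeightedHomogeneous_X (ZMod 3) wt n

/-- An algebra map from `P` preserves degrees if it does so on the generators. -/
theorem isHom_of_mem_homog {A : Type} [CommRing A] [Algebra (ZMod 3) A]
    {p : ℕ → A →ₗ[ZMod 3] A} (hp : IsMulGrading p) (f : RedPow →ₐ[ZMod 3] A)
    (hf : ∀ n, IsHom p (wt n) (f (xi (n + 1)))) {u : ℕ} {g : RedPow} (hg : g ∈ homog u) :
    IsHom p u (f g) := by
  have hmono : ∀ d, IsHom p (Finsupp.weight wt d) (f (mono d)) := by
    intro d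
    induction d using Finsupp.induction_linear with
    | zero => rw [mono_zero, map_one, map_zero]; exact hp.one
    | add d e hd he => rw [mono_add, map_mul, map_add]; exact hp.mul hd he
    | single n m =>
      rw [mono_single, map_pow, Finsupp.weight_single]
      exact hp.pow (hf n) m
  replace hg := mem_span_mono hg
  induction hg using Submodule.span_induction with
  | mem g hg =>
    obtain ⟨d, rfl, rfl⟩ := hg
    exact hmono d
  | zero => rw [map_zero]; exact IsHom.zero
  | add g g' _ _ h h' => rw [map_add]; exact h.add h'
  | smul c g _ h => rw [map_smul]; exact h.smul c

section Quotient

variable {Γ : Type} [CommRing Γ] [Bialgebra (ZMod 3) Γ] {π : RedPow →ₐc[ZMod 3] Γ}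
  {p : ℕ → Γ →ₗ[ZMod 3] Γ}

theorem isHom_of_homog (hp : GradedBy p (quotDeg π)) {u : ℕ} {f : RedPow} (hf : f ∈ homog u) :
    IsHom p u (π f) := hp.isHom_iff.2 ⟨f, hf, rfl⟩

theorem isMulGrading_of_gradedBy (hp : GradedBy p (quotDeg π)) : IsMulGrading p where
  grading := hp.grading
  one := by
    have := isHom_of_homog hp (xi_mem_homog 0)
    simpa [xi] using this
  mul {u v a b} ha hb := by
    obtain ⟨f, hf, rfl⟩ := hp.isHom_iff.1 ha
    obtain ⟨g, hg, rfl⟩ := hp.isHom_iff.1 hb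
    have := isHom_of_homog hp (f := f * g) (u := u + v)
      (MvPolynomial.IsWeightedHomogeneous.mul (R := ZMod 3) hf hg)
    rwa [map_mul] at this

theorem isHom_comul_xi (hp : GradedBy p (quotDeg π)) (n : ℕ) :
    IsHom (tensorProj p p) (2 * (3 ^ n - 1)) (Coalgebra.comul (R := ZMod 3) (π (xi n))) := by
  have h : Coalgebra.comul (R := ZMod 3) (π (xi n)) =
      ∑ i ∈ Finset.HasAntidiagonal.antidiagonal n,
        π (xi i.1) ⊗ₜ[ZMod 3] (π (xi i.2) ^ 3 ^ i.1) := by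
    rw [← CoalgHomClass.map_comp_comul_apply]
    refine (congrArg _ (comulHom_xi n)).trans ?_
    simp
  rw [h]
  refine IsHom.sum fun i hi => ?_
  -- `|ξ_i| + 3 ^ i |ξ_j| = |ξ_{i + j}|`; the truncated subtractions are exact
  have hd : 2 * (3 ^ n - 1) = 2 * (3 ^ i.1 - 1) + 3 ^ i.1 * (2 * (3 ^ i.2 - 1)) := by
    rw [← Finset.HasAntidiagonal.mem_antidiagonal.1 hi, pow_add]
    obtain ⟨a, ha⟩ := Nat.exists_eq_succ_of_ne_zero (pow_ne_zero i.1 (three_ne_zero (α := ℕ)))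
    obtain ⟨b, hb⟩ := Nat.exists_eq_succ_of_ne_zero (pow_ne_zero i.2 (three_ne_zero (α := ℕ)))
    rw [ha, hb]
    have h1 : a.succ * b.succ - 1 = a + a.succ * b := by
      rw [Nat.mul_succ, Nat.succ_eq_add_one]; omega
    rw [h1]
    simp only [Nat.succ_sub_one]
    ring
  rw [hd]
  exact (isHom_of_homog hp (xi_mem_homog _)).tmul
    ((isMulGrading_of_gradedBy hp).pow (isHom_of_homog hp (xi_mem_homog _)) _)

theorem isGradedBialgebra_of_gradedBy (hp : GradedBy p (quotDeg π)) : IsGradedBialgebra p where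
  toIsMulGrading := isMulGrading_of_gradedBy hp
  comul_comm u a := by
    refine hp.grading.comm (f := Coalgebra.comul (R := ZMod 3)) (fun v a ha => ?_) u a
    obtain ⟨f, hf, rfl⟩ := hp.isHom_iff.1 ha
    exact isHom_of_mem_homog ((isMulGrading_of_gradedBy hp).tensor (isMulGrading_of_gradedBy hp))
      ((Bialgebra.comulAlgHom (ZMod 3) Γ).comp (π : RedPow →ₐ[ZMod 3] Γ))
      (fun n => isHom_comul_xi hp (n + 1)) hf
  counit {v a} hv ha := by
    obtain ⟨f, hf, rfl⟩ := hp.isHom_iff.1 ha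
    have := isHom_of_mem_homog (isMulGrading_base (ZMod 3))
      ((Bialgebra.counitAlgHom (ZMod 3) Γ).comp (π : RedPow →ₐ[ZMod 3] Γ)) (fun n => ?_) hf v
    · rw [if_pos rfl, baseProj, if_neg hv, LinearMap.zero_apply] at this
      exact this.symm
    · have h : Coalgebra.counit (R := ZMod 3) (π (xi (n + 1))) = 0 :=
        (CoalgHomClass.counit_comp_apply π _).trans
          ((counitHom_xi (n + 1)).trans (if_neg n.succ_ne_zero))
      change IsHom _ _ (Coalgebra.counit (R := ZMod 3) (π (xi (n + 1))))
      rw [h]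
      exact IsHom.zero

theorem isHom_xiOne (hp : GradedBy p (quotDeg π)) : IsHom p 4 (xiOne π).val :=
  isHom_of_homog hp (xi_mem_homog 1)

theorem isHom_xiOne_sq (hp : GradedBy p (quotDeg π)) : IsHom p 8 ((xiOne π).val ^ 2) :=
  (isMulGrading_of_gradedBy hp).pow (isHom_xiOne hp) 2

end Quotient

/-- Below degree `12`, the only monomials are `1`, `ξ₁` and `ξ₁²`. -/
theorem exists_eq_smul_xi_one_pow {u : ℕ} (hu : u < 12) {f : RedPow} (hf : f ∈ homog u) :
    ∃ i < 3, ∃ c : ZMod 3, f = c • xi 1 ^ i := by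
  have hd : ∀ d : ℕ →₀ ℕ, Finsupp.weight wt d = u → d = Finsupp.single 0 (u / 4) := by
    intro d hd
    have h0 : ∀ n, n ≠ 0 → d n = 0 := by
      intro n hn
      by_contra hdn
      have h1 : d n * wt n ≤ u := by
        rw [← hd, Finsupp.weight_apply]
        exact Finset.single_le_sum (f := fun i => d i • wt i) (fun _ _ => Nat.zero_le _)
          (Finsupp.mem_support_iff.2 hdn)
      have h2 : 9 ≤ 3 ^ (n + 1) :=
        (Nat.pow_le_pow_right (by norm_num : 0 < 3) (by omega : 2 ≤ n + 1))
      have h3 : 16 ≤ wt n := by rw [wt]; omega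
      have h4 : wt n ≤ d n * wt n := Nat.le_mul_of_pos_left _ (Nat.pos_of_ne_zero hdn)
      omega
    have h5 : d = Finsupp.single 0 (d 0) := by
      ext n
      by_cases hn : n = 0
      · rw [hn, Finsupp.single_eq_same]
      · rw [h0 n hn, Finsupp.single_apply, if_neg (Ne.symm hn)]
    rw [h5, Finsupp.weight_single, smul_eq_mul, show wt 0 = 4 from rfl] at hd
    rw [h5, ← hd, Nat.mul_div_cancel _ (by norm_num)]
  refine ⟨u / 4, by omega, ?_⟩
  have hle : Submodule.span (ZMod 3) {g | ∃ d, Finsupp.weight wt d = u ∧ mono d = g} ≤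
      Submodule.span (ZMod 3) {xi 1 ^ (u / 4)} := by
    refine Submodule.span_mono ?_
    rintro _ ⟨d, hdu, rfl⟩
    rw [hd d hdu, mono_single]
    rfl
  obtain ⟨c, hc⟩ := Submodule.mem_span_singleton.1 (hle (mem_span_mono hf))
  exact ⟨c, hc.symm⟩

end RedPow

/-! ### The grading of `D` -/

namespace TruncD

theorem eq_smul_of_isHom {u : ℕ} {a : TruncD} (ha : IsHom gradProj u a) :
    a = 0 ∨ ∃ (n : ℕ) (c : ZMod 3), u = 4 * n ∧ a = c • x ^ n := by
  have h := ha u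
  rw [if_pos rfl, gradProj, LinearMap.sum_apply] at h
  by_cases hu : ∃ n < 3, u = 4 * n
  · obtain ⟨n, hn, rfl⟩ := hu
    refine Or.inr ⟨n, coef n a, rfl, ?_⟩
    rw [Finset.sum_eq_single_of_mem n (Finset.mem_range.2 hn), if_pos rfl] at h
    · exact h.symm
    · intro i _ hi
      rw [if_neg (by omega), LinearMap.zero_apply]
  · left
    rw [← h]
    refine Finset.sum_eq_zero fun i hi => ?_
    rw [if_neg fun h => hu ⟨i, Finset.mem_range.1 hi, h⟩, LinearMap.zero_apply]

theorem isMulGrading : IsMulGrading gradProj where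
  grading := isGrading_gradProj
  one := by simpa using isHom_x_pow 0
  mul {u v a b} ha hb := by
    rcases eq_smul_of_isHom ha with rfl | ⟨n, c, rfl, rfl⟩
    · rw [zero_mul]; exact IsHom.zero
    rcases eq_smul_of_isHom hb with rfl | ⟨m, c', rfl, rfl⟩
    · rw [mul_zero]; exact IsHom.zero
    rw [smul_mul_smul_comm, ← pow_add, ← mul_add]
    exact (isHom_x_pow _).smul _

/-- The grading of `D` is the one induced from `P`. -/
theorem gradedBy_gradProj {π : RedPow →ₐc[ZMod 3] TruncD} (h1 : π (RedPow.xi 1) = x)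
    (h : ∀ n ≥ 2, π (RedPow.xi n) = 0) : GradedBy gradProj (RedPow.quotDeg π) where
  grading := isGrading_gradProj
  mem u a := by
    constructor
    · rintro ⟨f, hf, rfl⟩
      have := RedPow.isHom_of_mem_homog isMulGrading (π : RedPow →ₐ[ZMod 3] TruncD) (fun n => ?_) hf
      · exact (this u).trans (if_pos rfl)
      · cases n with
        | zero =>
          have := isHom_x_pow 1
          rw [pow_one, ← h1] at this
          exact this
        | succ n =>
          have := h (n + 2) (by omega)
          change IsHom _ _ (π (RedPow.xi (n + 2)))
          rw [this]
          exact IsHom.zero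
    · intro ha
      rcases eq_smul_of_isHom (isGrading_gradProj.isHom ha) with rfl | ⟨n, c, rfl, rfl⟩
      · exact zero_mem _
      · refine Submodule.smul_mem _ _ ⟨RedPow.xi 1 ^ n, ?_, ?_⟩
        · have := MvPolynomial.IsWeightedHomogeneous.pow (R := ZMod 3) (RedPow.xi_mem_homog 1) n
          rw [smul_eq_mul, mul_comm] at this
          exact this
        · change π (RedPow.xi 1 ^ n) = x ^ n
          rw [map_pow, h1]

end TruncD

/-! ### The gradings of `B`, of `B / k` and of `(B / k)^{⊗ s} ⊗ M` -/

section GradedAdams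

universe v

theorem IsGrading.of_injective {ι V W : Type*} [DecidableEq ι] [AddCommGroup V] [AddCommGroup W]
    {p : ι → V → V} {p' : ι → W → W} (h : IsGrading p') (f : V →+ W) (hf : Function.Injective f)
    (hc : ∀ i x, f (p i x) = p' i (f x)) : IsGrading p where
  proj i j x := by
    apply hf
    rw [hc, hc, h.proj]
    split_ifs <;> simp [hc]
  total x := by
    obtain ⟨s, hs⟩ := h.total (f x)
    refine ⟨s, fun t ht => hf ?_⟩
    rw [map_sum, ← hs t ht]
    exact Finset.sum_congr rfl fun i _ => hc i x

theorem IsGrading.of_surjective {ι V W : Type*} [DecidableEq ι] [AddCommGroup V] [AddCommGroup W]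
    {p : ι → V → V} {p' : ι → W → W} (h : IsGrading p) (f : V →+ W) (hf : Function.Surjective f)
    (hc : ∀ i x, f (p i x) = p' i (f x)) : IsGrading p' where
  proj i j y := by
    obtain ⟨x, rfl⟩ := hf y
    rw [← hc, ← hc, h.proj]
    split_ifs <;> simp
  total y := by
    obtain ⟨x, rfl⟩ := hf y
    obtain ⟨s, hs⟩ := h.total x
    refine ⟨s, fun t ht => ?_⟩
    conv_rhs => rw [← hs t ht, map_sum]
    exact Finset.sum_congr rfl fun i _ => (hc i x).symm

variable {k Γ D : Type} [Field k] [CommRing Γ] [Bialgebra k Γ] [CommRing D] [Bialgebra k D]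

theorem IsHom.tensorProj_right {V W : Type*} [AddCommGroup V] [Module k V] [AddCommGroup W]
    [Module k W] {p : ℕ → V →ₗ[k] V} {p' : ℕ → W →ₗ[k] W} {y : W} (hy : IsHom p' 0 y) (u : ℕ)
    (x : V) : tensorProj p p' u (x ⊗ₜ[k] y) = p u x ⊗ₜ y := by
  rw [tensorProj_tmul, Finset.sum_eq_single (u, 0)]
  · rw [hy 0, if_pos rfl]
  · rintro ⟨i, j⟩ hij hne
    rw [Finset.HasAntidiagonal.mem_antidiagonal] at hij
    rw [hy j, if_neg, TensorProduct.tmul_zero]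
    rintro rfl
    exact hne (Prod.ext (by simpa using hij) rfl)
  · intro h
    exact absurd (Finset.HasAntidiagonal.mem_antidiagonal.2
      (rfl : ((u, 0) : ℕ × ℕ).1 + ((u, 0) : ℕ × ℕ).2 = u)) h

/-- The map `q` preserves the gradings with projections `p` and `p'`. -/
structure IsGradedMap (q : Γ →ₐc[k] D) (p : ℕ → Γ →ₗ[k] Γ) (p' : ℕ → D →ₗ[k] D) : Prop where
  source : IsGradedBialgebra p
  target : IsGradedBialgebra p'
  comm : ∀ u a, q (p u a) = p' u (q a)

variable {q : Γ →ₐc[k] D} {p : ℕ → Γ →ₗ[k] Γ} {p' : ℕ → D →ₗ[k] D} (h : IsGradedMap q p p')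
  {𝒢 : ℕ → Submodule k Γ}

include h in
theorem IsGradedMap.mem_cotensor (u : ℕ) {b : Γ} (hb : b ∈ cotensor q) : p u b ∈ cotensor q := by
  rw [LocExt.mem_cotensor] at hb ⊢
  rw [h.source.comul_comm]
  refine (map_tensorProj (p := p) (r := p) (f := LinearMap.id) (g := (q : Γ →ₗ[k] D))
    (fun _ _ => rfl) h.comm u _).trans ?_
  rw [← h.target.one.tensorProj_right]
  exact congrArg _ hb

/-- The projections of the grading of `B`. -/
def bProj (u : ℕ) : cotensor q →ₗ[k] cotensor q :=
  (p u).restrict fun _ hb => h.mem_cotensor u hb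

theorem isGrading_bProj : IsGrading fun u => ⇑(bProj h u) :=
  h.source.grading.of_injective (cotensor q).subtype.toAddMonoidHom (cotensor q).injective_subtype
    fun _ _ => rfl

theorem gradedBy_bProj (hp : GradedBy p 𝒢) : GradedBy (bProj h) (bDeg q 𝒢) where
  grading := isGrading_bProj h
  mem u b := (hp.mem u b).trans (Subtype.ext_iff (a1 := bProj h u b) (a2 := b)).symm

theorem isHom_one_bProj : IsHom (bProj h) 0 (⟨1, one_mem_cotensor q⟩ : cotensor q) := by
  intro u
  apply Subtype.ext
  refine (h.source.one u).trans ?_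
  split_ifs <;> rfl

theorem isGradedComod_comodB : IsGradedComod p (comodB q) (bProj h) where
  grading := isGrading_bProj h
  coact_comm u b := by
    change cotensor q at b
    change cotensorCoact q (bProj h u b) = tensorProj p (bProj h) u (cotensorCoact q b)
    apply cotensor_injective q
    rw [cotensorCoact_spec]
    refine (h.source.comul_comm u (b : cotensor q).1).trans ?_
    rw [← cotensorCoact_spec]
    exact (map_tensorProj (p := p) (r := p) (f := LinearMap.id) (g := (cotensor q).subtype)
      (fun _ _ => rfl) (fun _ _ => rfl) u _).symm

/-- The projections of the grading of `B / k`. -/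
def bbarProj (u : ℕ) : (cotensor q ⧸ unitLine q) →ₗ[k] (cotensor q ⧸ unitLine q) :=
  (unitLine q).mapQ (unitLine q) (bProj h u) (Submodule.span_le.2 (by
    rintro _ rfl
    change bProj h u _ ∈ unitLine q
    rw [isHom_one_bProj h u]
    split_ifs
    · exact Submodule.mem_span_singleton_self _
    · exact zero_mem _))

theorem bbarProj_mkQ (u : ℕ) (b : cotensor q) :
    bbarProj h u ((unitLine q).mkQ b) = (unitLine q).mkQ (bProj h u b) := rfl

theorem isGrading_bbarProj : IsGrading fun u => ⇑(bbarProj h u) :=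
  (isGrading_bProj h).of_surjective (unitLine q).mkQ.toAddMonoidHom (unitLine q).mkQ_surjective
    fun _ _ => rfl

theorem gradedBy_bbarProj (hp : GradedBy p 𝒢) : GradedBy (bbarProj h) (bbarDeg q 𝒢) where
  grading := isGrading_bbarProj h
  mem u b := by
    constructor
    · rintro ⟨b, hb, rfl⟩
      rw [bbarProj_mkQ, ((gradedBy_bProj h hp).mem u b).1 hb]
    · intro hb
      obtain ⟨b, rfl⟩ := (unitLine q).mkQ_surjective b
      rw [← hb]
      exact ⟨bProj h u b, ((gradedBy_bProj h hp).mem u _).2 ((isGrading_bProj h).idem u b), rfl⟩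

theorem isGradedComod_comodBbar : IsGradedComod p (comodBbar q) (bbarProj h) where
  grading := isGrading_bbarProj h
  coact_comm u b := by
    obtain ⟨b, rfl⟩ := (unitLine q).mkQ_surjective b
    change (unitLine q).mkQ.lTensor Γ (cotensorCoact q (bProj h u b)) =
      tensorProj p (bbarProj h) u ((unitLine q).mkQ.lTensor Γ (cotensorCoact q b))
    refine (congrArg _ ((isGradedComod_comodB h).coact_comm u b)).trans ?_
    exact map_tensorProj (p := p) (r := p) (f := LinearMap.id) (g := (unitLine q).mkQ)
      (fun _ _ => rfl) (fun _ _ => rfl) u _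

variable {M : Comod.{v} k Γ} (pM : ℕ → M.carrier →ₗ[k] M.carrier)

/-- The projections of the grading of `(B / k)^{⊗ s} ⊗ M`. -/
def barPowProj : ∀ s, ℕ → (barPow q M s).carrier →ₗ[k] (barPow q M s).carrier
  | 0 => pM
  | s + 1 => tensorProj (bbarProj h) (barPowProj s)

variable {pM}

theorem isGradedComod_barPow (hM : IsGradedComod p M pM) :
    ∀ s, IsGradedComod p (barPow q M s) (barPowProj h pM s)
  | 0 => hM
  | s + 1 => (isGradedComod_comodBbar h).tensor h.source (isGradedComod_barPow hM s)

theorem gradedBy_barPowProj {ℳ : ℕ → Submodule k M.carrier} (hp : GradedBy p 𝒢)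
    (hM : GradedBy pM ℳ) : ∀ s, GradedBy (barPowProj h pM s) (barPowDeg q 𝒢 M ℳ s)
  | 0 => hM
  | s + 1 => (gradedBy_bbarProj h hp).tensor (gradedBy_barPowProj hp hM s)

/-- If `B / k` is concentrated in degrees at least `c`, then `(B / k)^{⊗ s} ⊗ M` is concentrated in
degrees at least `c s`. -/
theorem zext_barPowProj_eq_zero {c : ℕ} (hc : ∀ u < c, bbarProj h u = 0) :
    ∀ (s : ℕ) (u : ℤ), u < c * s → zext (barPowProj h pM s) u = 0
  | 0, u, hu => zext_of_neg _ (by simpa using hu)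
  | s + 1, u, hu => by
    rcases lt_or_ge u 0 with hu0 | hu0
    · exact zext_of_neg _ hu0
    · lift u to ℕ using hu0
      rw [zext_natCast]
      change tensorProj (bbarProj h) (barPowProj h pM s) u = 0
      refine Finset.sum_eq_zero fun i hi => ?_
      rw [Finset.HasAntidiagonal.mem_antidiagonal] at hi
      rcases lt_or_ge i.1 c with hic | hic
      · rw [hc _ hic, TensorProduct.map_zero_left]
      · have h0 := zext_barPowProj_eq_zero hc s i.2 (by
          have h1 : ((i.1 : ℕ) : ℤ) + (i.2 : ℕ) = u := by exact_mod_cast hi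
          have h2 : (c : ℤ) ≤ i.1 := by exact_mod_cast hic
          push_cast at hu
          rw [mul_add, mul_one] at hu
          linarith)
        rw [zext_natCast] at h0
        rw [h0, TensorProduct.map_zero_right]

variable {N : Comod.{v} k Γ} {pN : ℕ → N.carrier →ₗ[k] N.carrier}

include h in
theorem IsGradedComod.corestrict (hN : IsGradedComod p N pN) :
    IsGradedComod p' (N.corestrict q) pN where
  grading := hN.grading
  coact_comm u n := by
    change (q : Γ →ₗ[k] D).rTensor N.carrier (N.coact (pN u n)) =
      tensorProj p' pN u ((q : Γ →ₗ[k] D).rTensor N.carrier (N.coact n))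
    refine (congrArg _ (hN.coact_comm u n)).trans ?_
    exact map_tensorProj (p' := pN) (r' := pN) (f := (q : Γ →ₗ[k] D)) (g := LinearMap.id) h.comm
      (fun _ _ => rfl) u _

/-! ### The long exact sequences and the gradings -/

theorem unitHom_proj (u : ℕ) (n : N.carrier) :
    (unitHom q N).lin (pN u n) = tensorProj (bProj h) pN u ((unitHom q N).lin n) := by
  have := (isHom_one_bProj h).tensorProj_add (p' := pN) u n
  rw [zero_add] at this
  exact this.symm

theorem projHom_proj (u : ℕ) (z : cotensor q ⊗[k] N.carrier) :
    (projHom q N).lin (tensorProj (bProj h) pN u z) =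
      tensorProj (bbarProj h) pN u ((projHom q N).lin z) :=
  map_tensorProj (p' := pN) (r' := pN) (f := (unitLine q).mkQ) (g := LinearMap.id)
    (fun _ _ => rfl) (fun _ _ => rfl) u z

/-- Contraction with a functional of degree `0` preserves the gradings. -/
theorem lid_rTensor_tensorProj {V W : Type*} [AddCommGroup V] [Module k V] [AddCommGroup W]
    [Module k W] {pV : ℕ → V →ₗ[k] V} {pW : ℕ → W →ₗ[k] W} (hV : IsGrading fun u => ⇑(pV u))
    (hW : IsGrading fun u => ⇑(pW u)) {f : V →ₗ[k] k} (hf : ∀ v x, v ≠ 0 → IsHom pV v x → f x = 0)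
    (u : ℕ) (z : V ⊗[k] W) :
    ((TensorProduct.lid k W).toLinearMap ∘ₗ f.rTensor W) (tensorProj pV pW u z) =
      pW u (((TensorProduct.lid k W).toLinearMap ∘ₗ f.rTensor W) z) := by
  refine (hV.tensor hW).comm (fun v z hz => ?_) u z
  replace hz := hz.mem_span hV hW
  induction hz using Submodule.span_induction with
  | mem z hz =>
    obtain ⟨i, j, x, y, hx, hy, rfl, rfl⟩ := hz
    rw [LinearMap.comp_apply, LinearMap.rTensor_tmul, LinearEquiv.coe_coe, TensorProduct.lid_tmul]
    rcases eq_or_ne i 0 with rfl | hi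
    · rw [zero_add]
      exact hy.smul _
    · rw [hf i x hi hx, zero_smul]
      exact IsHom.zero
  | zero => rw [map_zero]; exact IsHom.zero
  | add z z' _ _ h h' => rw [map_add]; exact h.add h'
  | smul c z _ h => rw [map_smul]; exact h.smul c

theorem counitHom_proj (hN : IsGradedComod p N pN) (u : ℕ) (z : cotensor q ⊗[k] N.carrier) :
    (counitHom q N).lin (tensorProj (bProj h) pN u z) = pN u ((counitHom q N).lin z) :=
  lid_rTensor_tensorProj (f := Coalgebra.counit (R := k) (A := Γ) ∘ₗ (cotensor q).subtype)
    (isGrading_bProj h) hN.grading (fun _ _ hv hb => h.source.counit hv fun w =>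
      (congrArg Subtype.val (hb w)).trans (apply_ite Subtype.val _ _ _)) u z

theorem unitHom_extProj (ξ : Prim k Γ) (hN : IsGradedComod p N pN) (d : ℤ × ℤ) (y : ExtMod ξ N) :
    ExtMod.map ξ ξ rfl (unitHom q N) (extProj ξ h.source hN d y) =
      extProj ξ h.source ((isGradedComod_comodB h).tensor h.source hN) d
        (ExtMod.map ξ ξ rfl (unitHom q N) y) :=
  extProj_map ξ rfl h.source hN h.source ((isGradedComod_comodB h).tensor h.source hN)
    (fun _ _ => rfl) (unitHom q N) (unitHom_proj h) d y

theorem projHom_extProj (ξ : Prim k Γ) (hN : IsGradedComod p N pN) (d : ℤ × ℤ)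
    (y : ExtMod ξ ((comodB q).tensor N)) :
    ExtMod.map ξ ξ rfl (projHom q N)
        (extProj ξ h.source ((isGradedComod_comodB h).tensor h.source hN) d y) =
      extProj ξ h.source ((isGradedComod_comodBbar h).tensor h.source hN) d
        (ExtMod.map ξ ξ rfl (projHom q N) y) :=
  extProj_map ξ rfl h.source ((isGradedComod_comodB h).tensor h.source hN) h.source
    ((isGradedComod_comodBbar h).tensor h.source hN) (fun _ _ => rfl) (projHom q N)
    (projHom_proj h) d y

theorem mapId_unitHom_projAdd (ξ : Prim k Γ) (i : ℤ × ℤ) (z : Cobar ξ N) :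
    Cobar.mapId ξ (unitHom q N) (Cobar.projAdd ξ p N pN i z) =
      Cobar.projAdd ξ p ((comodB q).tensor N) (tensorProj (bProj h) pN) i
        (Cobar.mapId ξ (unitHom q N) z) :=
  Cobar.map_proj (p := p) (p' := p) (φ := BialgHom.id k Γ) ξ rfl (fun _ _ => rfl) (unitHom q N)
    (unitHom_proj h) i z

theorem mapId_projHom_projAdd (ξ : Prim k Γ) (i : ℤ × ℤ) (z : Cobar ξ ((comodB q).tensor N)) :
    Cobar.mapId ξ (projHom q N)
        (Cobar.projAdd ξ p ((comodB q).tensor N) (tensorProj (bProj h) pN) i z) =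
      Cobar.projAdd ξ p ((comodBbar q).tensor N) (tensorProj (bbarProj h) pN) i
        (Cobar.mapId ξ (projHom q N) z) :=
  Cobar.map_proj (p := p) (p' := p) (φ := BialgHom.id k Γ) ξ rfl (fun _ _ => rfl) (projHom q N)
    (projHom_proj h) i z

/-- The connecting homomorphism of `0 → N → B ⊗ N → (B / k) ⊗ N → 0` has degree `(1, 0)`. -/
theorem conn_extProj (ξ : Prim k Γ) (hN : IsGradedComod p N pN) (t u : ℤ)
    (y : ExtMod ξ ((comodBbar q).tensor N)) :
    Coh.conn (Cobar.mapId ξ (unitHom q N)) (Cobar.mapId ξ (projHom q N))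
        (Cobar.mapId_d ξ _) (Cobar.mapId_d ξ _)
        (Cobar.mapId_injective ξ _ (unitHom_injective q _))
        (Cobar.mapId_exact ξ _ _ (unitHom_projHom_exact q _)) (Cobar.d_d ξ _)
        (Cobar.mapId_surjective ξ _ (projHom_surjective q _))
        (extProj ξ h.source ((isGradedComod_comodBbar h).tensor h.source hN) (t, u) y) =
      extProj ξ h.source hN (t + 1, u)
        (Coh.conn (Cobar.mapId ξ (unitHom q N)) (Cobar.mapId ξ (projHom q N))
        (Cobar.mapId_d ξ _) (Cobar.mapId_d ξ _)
        (Cobar.mapId_injective ξ _ (unitHom_injective q _))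
        (Cobar.mapId_exact ξ _ _ (unitHom_projHom_exact q _)) (Cobar.d_d ξ _)
        (Cobar.mapId_surjective ξ _ (projHom_surjective q _)) y) :=
  cohProj_conn (Cobar.proj_d h.source hN)
    (Cobar.proj_d h.source ((isGradedComod_comodB h).tensor h.source hN))
    (Cobar.proj_d h.source ((isGradedComod_comodBbar h).tensor h.source hN))
    (Cobar.mapId ξ (unitHom q N)) (Cobar.mapId ξ (projHom q N))
    (Cobar.mapId_d ξ _) (Cobar.mapId_d ξ _)
    (Cobar.mapId_injective ξ _ (unitHom_injective q _))
    (Cobar.mapId_surjective ξ _ (projHom_surjective q _))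
    (Cobar.mapId_exact ξ _ _ (unitHom_projHom_exact q _)) (Cobar.d_d ξ _)
    (mapId_unitHom_projAdd h ξ) (mapId_projHom_projAdd h ξ) t u y

end GradedAdams

/-! ### The vanishing plane -/

section Vanishing

universe v

theorem ExactCouple.image_homDeg {R A A' : Type*} [CommRing R] [AddCommGroup A] [Module R A]
    [AddCommGroup A'] [Module R A'] {f : A →ₗ[R] A'} (hf : Function.Bijective f)
    {p : ℤ × ℤ → A →+ A} {p' : ℤ × ℤ → A' →+ A'} (hc : ∀ d a, f (p d a) = p' d (f a)) (t u : ℕ) :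
    f '' homDeg p t u = homDeg p' t u := by
  ext b
  constructor
  · rintro ⟨a, ha, rfl⟩
    exact (hc _ a).symm.trans (congrArg f ha)
  · intro hb
    obtain ⟨a, rfl⟩ := hf.2 b
    exact ⟨a, hf.1 ((hc _ a).trans hb), rfl⟩

/-- `B / k` vanishes below degree `12`: the elements `ξ₁` and `ξ₁²` are not in `B`, since their
images in `D` are not scalars. -/
theorem bbarProj_eq_zero {Γ : Type} [CommRing Γ] [Bialgebra (ZMod 3) Γ]
    {π : RedPow →ₐc[ZMod 3] Γ} {q : Γ →ₐc[ZMod 3] TruncD} (hq : q (π (RedPow.xi 1)) = TruncD.x)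
    {p : ℕ → Γ →ₗ[ZMod 3] Γ} (hp : GradedBy p (RedPow.quotDeg π))
    (h : IsGradedMap q p TruncD.gradProj) (u : ℕ) (hu : u < 12) : bbarProj h u = 0 := by
  refine LinearMap.ext fun y => ?_
  obtain ⟨b, rfl⟩ := (unitLine q).mkQ_surjective y
  rw [bbarProj_mkQ, LinearMap.zero_apply]
  have hb : (bProj h u b : Γ) ∈ RedPow.quotDeg π u := (hp.mem u _).2 (hp.grading.idem u _)
  obtain ⟨f, hf, hfb⟩ := hb
  obtain ⟨i, hi, c, rfl⟩ := RedPow.exists_eq_smul_xi_one_pow hu hf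
  have hfb' : (bProj h u b : Γ) = c • π (RedPow.xi 1) ^ i := by
    rw [← hfb]
    exact (map_smul π c _).trans (by rw [map_pow])
  refine (Submodule.Quotient.mk_eq_zero _).2 ?_
  rcases Nat.eq_zero_or_pos i with rfl | hi0
  · refine Submodule.mem_span_singleton.2 ⟨c, Subtype.ext ?_⟩
    rw [hfb', pow_zero]
    rfl
  · have h1 := map_cotensor q (bProj h u b)
    rw [hfb', map_smul, map_pow, hq, Algebra.algebraMap_eq_smul_one] at h1
    have h2 := congrArg (TruncD.coef i) h1
    rw [map_smul, map_smul, TruncD.coef_pow i hi, TruncD.coef_one, if_pos rfl,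
      if_neg hi0.ne', smul_zero, smul_eq_mul, mul_one] at h2
    have h3 : bProj h u b = 0 := Subtype.ext (by rw [hfb', h2, zero_smul]; rfl)
    rw [h3]
    exact zero_mem _

variable {Γ : Type} [CommRing Γ] [HopfAlgebra (ZMod 3) Γ] {π : RedPow →ₐc[ZMod 3] Γ}
  {q : Γ →ₐc[ZMod 3] TruncD} (hq : q (π (RedPow.xi 1)) = TruncD.x)
  {p : ℕ → Γ →ₗ[ZMod 3] Γ} (hp : GradedBy p (RedPow.quotDeg π))
  (h : IsGradedMap q p TruncD.gradProj) {M : Comod.{v} (ZMod 3) Γ}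
  {pM : ℕ → M.carrier →ₗ[ZMod 3] M.carrier} (hM : IsGradedComod p M pM)

include hq in
/-- Change of rings for `N_s`; the colinear map `D → Γ` which it requires sends `x ^ i` to `ξ₁ ^ i`.
-/
theorem changeOfRings_bijective (M : Comod.{v} (ZMod 3) Γ) (s : ℕ) :
    Function.Bijective (changeOfRings q (RedPow.xiOne π) M s) := by
  have hcoh := fun t => coh_counitHom q (TruncD.powMap (RedPow.xiOne π).val)
    (TruncD.rTensor_comul_powMap q (RedPow.xiOne π) hq) (TruncD.powMap_one _) t (barPow q M s)
  exact ExtMod.map_bijective _ _ _ _ (fun t => (hcoh t).1) fun t => (hcoh t).2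

/-- The projections of the bigrading of `Ext_Γ(k, N_s)`, where `N_s = (B / k)^{⊗ s} ⊗ M`. -/
def adamsProjD (π : RedPow →ₐc[ZMod 3] Γ) (s : ℕ) :
    ℤ × ℤ → (adamsCouple q (RedPow.xiOne π) M).D s →+ (adamsCouple q (RedPow.xiOne π) M).D s :=
  extProj (RedPow.xiOne π) h.source (isGradedComod_barPow h hM s)

/-- The projections of the bigrading of `Ext_Γ(k, B ⊗ N_s)`, where `N_s = (B / k)^{⊗ s} ⊗ M`. -/
def adamsProjE (π : RedPow →ₐc[ZMod 3] Γ) (s : ℕ) :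
    ℤ × ℤ → (adamsCouple q (RedPow.xiOne π) M).E s →+ (adamsCouple q (RedPow.xiOne π) M).E s :=
  extProj (RedPow.xiOne π) h.source
    (IsGradedComod.tensor h.source (isGradedComod_comodB h) (isGradedComod_barPow h hM s))

theorem adamsProjE_natural (s : ℕ) (d : ℤ × ℤ) (y : (adamsCouple q (RedPow.xiOne π) M).E s) :
    changeOfRings q (RedPow.xiOne π) M s (adamsProjE h hM π s d y) =
      extProj ((RedPow.xiOne π).map q) h.target ((isGradedComod_barPow h hM s).corestrict h) d
        (changeOfRings q (RedPow.xiOne π) M s y) :=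
  extProj_map _ _ _ _ _ _ h.comm _ (counitHom_proj h (isGradedComod_barPow h hM s)) d y

include hq hp in
/-- `Ext_Γ^{t,u}(k, B ⊗ N_s)` vanishes for `u < 12 s + 6 t - 2`, by the vanishing line over `D`. -/
theorem adamsProjE_eq_zero (s : ℕ) (t u : ℤ) (hu : u < 12 * (s : ℤ) + 6 * t - 2)
    (y : (adamsCouple q (RedPow.xiOne π) M).E s) : adamsProjE h hM π s (t, u) y = 0 := by
  apply (changeOfRings_bijective hq M s).1
  rw [adamsProjE_natural, map_zero]
  refine extProj_eq_zero _ _ (fun r hr z hz hzu => ?_) _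
  refine TruncD.mem_cobarBd (N := (barPow q M s).corestrict q) (c := 12 * (s : ℤ)) h.target
    ((isGradedComod_barPow h hM s).corestrict h) (fun w hw => ?_) r u (by rw [hr]; exact hu) z hz
    hzu
  exact zext_barPowProj_eq_zero h (c := 12) (bbarProj_eq_zero hq hp h) s w (by exact_mod_cast hw)

theorem adamsCouple_i_comm (s : ℕ) (t u : ℤ)
    (y : (adamsCouple q (RedPow.xiOne π) M).D (s + 1)) :
    (adamsCouple q (RedPow.xiOne π) M).i s (adamsProjD h hM π (s + 1) (t, u) y) =
      adamsProjD h hM π s (t + 1, u) ((adamsCouple q (RedPow.xiOne π) M).i s y) :=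
  conn_extProj h (RedPow.xiOne π) (isGradedComod_barPow h hM s) t u y

theorem adamsCouple_j_comm (s : ℕ) (d : ℤ × ℤ) (y : (adamsCouple q (RedPow.xiOne π) M).D s) :
    (adamsCouple q (RedPow.xiOne π) M).j s (adamsProjD h hM π s d y) =
      adamsProjE h hM π s d ((adamsCouple q (RedPow.xiOne π) M).j s y) :=
  unitHom_extProj h (RedPow.xiOne π) (isGradedComod_barPow h hM s) d y

theorem adamsCouple_κ_comm (s : ℕ) (d : ℤ × ℤ) (y : (adamsCouple q (RedPow.xiOne π) M).E s) :
    (adamsCouple q (RedPow.xiOne π) M).κ s (adamsProjE h hM π s d y) =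
      adamsProjD h hM π (s + 1) d ((adamsCouple q (RedPow.xiOne π) M).κ s y) :=
  projHom_extProj h (RedPow.xiOne π) (isGradedComod_barPow h hM s) d y

theorem adamsProjD_eq_zero_of_neg (s : ℕ) (t u : ℤ) (ht : t < 0)
    (y : (adamsCouple q (RedPow.xiOne π) M).D s) : adamsProjD h hM π s (t, u) y = 0 :=
  extProj_eq_zero _ _ (fun r hr => absurd hr (by omega)) y

include hq hp in
/-- `Ext_Γ^{t,u}(k, N_s)` vanishes for `u < 12 s + 6 t - 2`, by induction on `t` along the exact
sequences `Ext^{t-1}(k, N_{s+1}) → Ext^t(k, N_s) → Ext^t(k, B ⊗ N_s)`. -/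
theorem adamsProjD_eq_zero (t : ℕ) : ∀ (s : ℕ) (u : ℤ), u < 12 * (s : ℤ) + 6 * t - 2 →
    ∀ y : (adamsCouple q (RedPow.xiOne π) M).D s, adamsProjD h hM π s (t, u) y = 0 := by
  have key : ∀ (t : ℤ), (∀ (s : ℕ) (u : ℤ), u < 12 * (s : ℤ) + 6 * (t - 1) - 2 →
      ∀ y : (adamsCouple q (RedPow.xiOne π) M).D s, adamsProjD h hM π s (t - 1, u) y = 0) →
      ∀ (s : ℕ) (u : ℤ), u < 12 * (s : ℤ) + 6 * t - 2 →
      ∀ y : (adamsCouple q (RedPow.xiOne π) M).D s, adamsProjD h hM π s (t, u) y = 0 := by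
    intro t ih s u hu y
    have hj : (adamsCouple q (RedPow.xiOne π) M).j s (adamsProjD h hM π s (t, u) y) = 0 := by
      rw [adamsCouple_j_comm, adamsProjE_eq_zero hq hp h hM s t u hu]
    obtain ⟨w, hw⟩ := ((adamsCouple q (RedPow.xiOne π) M).exact_i_j s _).1 hj
    have hidem : adamsProjD h hM π s (t, u) (adamsProjD h hM π s (t, u) y) =
        adamsProjD h hM π s (t, u) y :=
      (extProj_isBigrading h.source (isGradedComod_barPow h hM s) (RedPow.isHom_xiOne hp)
        (RedPow.isHom_xiOne_sq hp)).idem (t, u) y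
    have hi := adamsCouple_i_comm h hM s (t - 1) u w
    rw [ih (s + 1) u (by push_cast; linarith) w, map_zero, hw, sub_add_cancel, hidem] at hi
    exact hi.symm
  induction t with
  | zero => exact key 0 fun s u _ y => adamsProjD_eq_zero_of_neg h hM s _ u (by norm_num) y
  | succ t ih =>
    push_cast
    exact key _ (by simpa only [add_sub_cancel_right] using ih)

include hq hp in
theorem isGradedVanishing : (adamsCouple q (RedPow.xiOne π) M).IsGradedVanishing
    (Polynomial.X : (ZMod 3)[X]) (adamsProjD h hM π) (adamsProjE h hM π) where
  bigradingD _ := extProj_isBigrading _ _ (RedPow.isHom_xiOne hp) (RedPow.isHom_xiOne_sq hp)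
  bigradingE _ := extProj_isBigrading _ _ (RedPow.isHom_xiOne hp) (RedPow.isHom_xiOne_sq hp)
  i_comm := adamsCouple_i_comm h hM
  j_comm := adamsCouple_j_comm h hM
  κ_comm := adamsCouple_κ_comm h hM
  vanish s t u y hu := by
    rcases lt_or_ge t 0 with ht | ht
    · exact adamsProjD_eq_zero_of_neg h hM s t u ht y
    · lift t to ℕ using ht
      exact adamsProjD_eq_zero hq hp h hM t s u hu y

end Vanishing

end LocExt

end

theorem propositionA1 {Γ : Type} [CommRing Γ] [HopfAlgebra (ZMod 3) Γ]
    (π : RedPow →ₐc[ZMod 3] Γ) (hπ : Function.Surjective π)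
    (hπ_graded : DirectSum.IsInternal (RedPow.quotDeg π))
    (q : Γ →ₐc[ZMod 3] TruncD) (hq_one : q (π (RedPow.xi 1)) = TruncD.x)
    (hq : ∀ n ≥ 2, q (π (RedPow.xi n)) = 0)
    (M : Comod (ZMod 3) Γ) (ℳ : ℕ → Submodule (ZMod 3) M.carrier)
    (hℳ_graded : DirectSum.IsInternal ℳ)
    (hℳ : ∀ u, ∀ m ∈ ℳ u, M.coact m ∈ tensorDeg (RedPow.quotDeg π) ℳ u) :
    -- The `E_1` page of the localized spectral sequence is `b⁻¹ Ext_D(k, (B / k)^{⊗ s} ⊗ M)`.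
    (∀ s, Function.Bijective
        (ExactCouple.locMap (Polynomial.X : (ZMod 3)[X]) (changeOfRings q (RedPow.xiOne π) M s)) ∧
      ∀ t u : ℤ,
        ExactCouple.locMap (Polynomial.X : (ZMod 3)[X]) (changeOfRings q (RedPow.xiOne π) M s) ''
          ExactCouple.locDeg (Polynomial.X : (ZMod 3)[X])
            (adamsDegE q (RedPow.xiOne π) (RedPow.quotDeg π) M ℳ s) t u =
        ExactCouple.locDeg (Polynomial.X : (ZMod 3)[X])
          (extDeg ((RedPow.xiOne π).map q) (RedPow.quotDeg (q.comp π))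
            ((barPow q M s).corestrict q) (barPowDeg q (RedPow.quotDeg π) M ℳ s)) t u) ∧
    -- There is a vanishing plane in the localized `E_1` page.
    (∀ (s : ℕ) (t u : ℤ), u < 12 * s + 6 * t - 2 →
      ∀ y ∈ ExactCouple.locDeg (Polynomial.X : (ZMod 3)[X])
        (adamsDegE q (RedPow.xiOne π) (RedPow.quotDeg π) M ℳ s) t u, y = 0) ∧
    -- The localized spectral sequence converges to `b⁻¹ Ext_Γ(k, M)`.
    (adamsCouple q (RedPow.xiOne π) M).LocConverges (Polynomial.X : (ZMod 3)[X])
      (adamsDegE q (RedPow.xiOne π) (RedPow.quotDeg π) M ℳ)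
      (adamsDegD q (RedPow.xiOne π) (RedPow.quotDeg π) M ℳ) := by
  obtain ⟨p, hp⟩ := exists_gradedBy hπ_graded
  obtain ⟨pM, hpM⟩ := exists_gradedBy hℳ_graded
  have hgp := RedPow.isGradedBialgebra_of_gradedBy hp
  have hp' : GradedBy TruncD.gradProj (RedPow.quotDeg (q.comp π)) :=
    TruncD.gradedBy_gradProj hq_one hq
  have h : IsGradedMap q p TruncD.gradProj :=
    ⟨hgp, RedPow.isGradedBialgebra_of_gradedBy hp',
      hgp.grading.comm (f := (q : Γ →ₗ[ZMod 3] TruncD)) fun v a ha => by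
        obtain ⟨f, hf, rfl⟩ := hp.isHom_iff.1 ha
        exact RedPow.isHom_of_homog hp' hf⟩
  have hM : IsGradedComod p M pM :=
    ⟨hpM.grading, hpM.grading.comm fun v m hm =>
      (hp.tensor hpM).isHom_iff.2 (hℳ v m (hpM.isHom_iff.1 hm))⟩
  have hN := gradedBy_barPowProj h hp hpM
  have hE : adamsDegE q (RedPow.xiOne π) (RedPow.quotDeg π) M ℳ =
      fun s => ExactCouple.homDeg (adamsProjE h hM π s) :=
    funext fun s => extDeg_eq_homDeg _ _ hp ((gradedBy_bProj h hp).tensor (hN s))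
  have hD : adamsDegD q (RedPow.xiOne π) (RedPow.quotDeg π) M ℳ =
      ExactCouple.homDeg (adamsProjD h hM π 0) :=
    extDeg_eq_homDeg _ _ hp hpM
  have hv := isGradedVanishing hq_one hp h hM
  refine ⟨fun s => ⟨ExactCouple.locMap_bijective _ (changeOfRings_bijective hq_one M s), ?_⟩,
    ?_, ?_⟩
  · refine ExactCouple.locMap_image_locDeg _ fun t u => ?_
    rw [hE, extDeg_eq_homDeg h.target ((isGradedComod_barPow h hM s).corestrict h) hp' (hN s)]
    exact ExactCouple.image_homDeg (changeOfRings_bijective hq_one M s)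
      (adamsProjE_natural h hM s) t u
  · intro s t u hu y hy
    rw [hE] at hy
    obtain ⟨m, a, ha, rfl⟩ := (hv.bigradingE s).mem_locDeg.1 hy
    rw [← ha, adamsProjE_eq_zero hq_one hp h hM s _ _ (by linarith)]
    exact LocalizedModule.zero_mk _
  · rw [hE, hD]
    exact hv.locConverges
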